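/- Let $n\ge 1$ and let $\mathbb{R}_n$ be the real Clifford algebra with units $e_1,\dots,e_n$, $e_i^2=-1$, $e_ie_j=-e_je_i$ for $i\neq j$, with basis $(e_A)_A$ and $|s|^2=\sum_A s_A^2$. Let $\mathbb{R}^{n+1}=\{s_0+s_1e_1+\dots+s_ne_n\}\subseteq\mathbb{R}_n$ be the paravectors, $\mathbb{S}=\{J\in\mathbb{R}^{n+1} : J_0=0,\ |J|=1\}$, and for $J\in\mathbb{S}$ let $\mathbb{C}_J=\{x+Jy : x,y\in\mathbb{R}\}$. For $\alpha\in(0,\frac{\pi}{2})$ put $I_\alpha=(-\alpha,\alpha)\cup(\pi-\alpha,\pi+\alpha)$ and $D_\alpha=\{te^{J\phi} : t>0,\ J\in\mathbb{S},\ \phi\in I_\alpha\}$. Let $V=V_{\mathbb{R}}\otimes\mathbb{R}_n$ be the Clifford module over a real Banach space $V_{\mathbb{R}}$, with $\|\sum_A v_A\otimes e_A\|^2=\sum_A\|v_A\|^2$, and let $T$ be a closed right-linear operator in $V$ whose domain is invariant under left and right multiplication by $\mathbb{R}_n$. For a real polynomial $p=\sum_{k=0}^N p_ks^k$ of degree $N$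 let $p[T]=\sum_{k=0}^N p_kT^k$ with domain $\operatorname{dom}(T^N)$ (with $N=0$ if $p=0$). Let $Q_s[T]=T^2-2s_0T+|s|^2$ with domain $\operatorname{dom}(T^2)$, let $\rho_S(T)$ be the set of $s\in\mathbb{R}^{n+1}$ for which $Q_s[T]$ has an everywhere defined bounded inverse, and for $s\in\rho_S(T)$ let $S_L^{-1}(s,T)=Q_s[T]^{-1}\overline{s}-TQ_s[T]^{-1}$. Assume that $T$ is bisectorial of angle $\omega\in(0,\frac{\pi}{2})$, i.e. $\mathbb{R}^{n+1}\setminus\rho_S(T)\subseteq\overline{D_\omega}$ and for every $\varphi\in(\omega,\frac{\pi}{2})$ there is $C_\varphi\ge 0$ with $\|S_L^{-1}(s,T)\|\le C_\varphi/|s|$ for all $s\in\mathbb{R}^{n+1}\setminus(D_\varphi\cup\{0\})$. Let $\mathcal{N}^0(D_\theta)$ be the set of bounded functions $g:D_\theta\to\mathbb{R}_n$ with $\int_0^\infty|g(te^{J\phi})|\frac{dt}{t}<\infty$ for all $J\in\mathbb{S}$, $\phi\in I_\theta$, which are intrinsic slice hyperholomorphic: $g(x+Jy)=g_0(x,y)+Jg_1(x,y)$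 for all $J\in\mathbb{S}$, with real valued $C^1$ functions $g_0,g_1$ which are respectively even and odd in $y$ and satisfy $\partial_xg_0=\partial_yg_1$, $\partial_yg_0=-\partial_xg_1$. Let $p$ and $q$ be real polynomials such that (i) $\deg(q)\ge\deg(p)+1$ (with $\deg 0=-\infty$), (ii) $p(0)=0$, (iii) $q(s)\neq 0$ for all $s\in\overline{D_\omega}$. Then $q[T]:\operatorname{dom}(q[T])\to V$ is bijective, there exists $\theta\in(\omega,\frac{\pi}{2})$ such that $\frac{p}{q}\in\mathcal{N}^0(D_\theta)$, and $$\Big(\frac{p}{q}\Big)(T)=p[T]\,q[T]^{-1}$$ as operators (including equality of domains), where the bounded operator $$\Big(\frac{p}{q}\Big)(T)=\frac{1}{2\pi}\int_{\partial D_\varphi\cap\mathbb{C}_J}S_L^{-1}(s,T)\,ds_J\,\frac{p(s)}{q(s)}=\frac{1}{2\pi}\sum_{\pm}\int_{\mathbb{R}}S_L^{-1}(\gamma_\pm(t),T)\,\frac{\gamma_\pm'(t)}{J}\,\frac{p(\gamma_\pm(t))}{q(\gamma_\pm(t))}\,dt,\qquad \gamma_\pm(t)=\pm|t|e^{-\operatorname{sgn}(t)J\varphi},$$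 is given by the $\omega$-functional calculus: for every $\varphi\in(\omega,\theta)$ and every $J\in\mathbb{S}$ the integrals converge absolutely in operator norm and have this same value. -/

import Mathlib

noncomputable section

namespace CliffordOmega

/-! ### The real Clifford algebra with `n` imaginary units

A Clifford number is `∑ A, s_A e_A`, where `A` runs through the subsets `{i₁ < ⋯ < i_r}` of the
`n` indices and `e_A = e_{i₁} ⋯ e_{i_r}`. The absolute value is the Euclidean norm of the
coefficients. -/

/-- The real Clifford algebra `ℝ_n`. -/
def Cl (n : ℕ) : Type := EuclideanSpace ℝ (Finset (Fin n))

variable {n : ℕ}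

instance : NormedAddCommGroup (Cl n) :=
  inferInstanceAs (NormedAddCommGroup (EuclideanSpace ℝ (Finset (Fin n))))

instance : NormedSpace ℝ (Cl n) :=
  inferInstanceAs (NormedSpace ℝ (EuclideanSpace ℝ (Finset (Fin n))))

/-- The coefficient `s_A`. -/
def Cl.coeff (s : Cl n) (A : Finset (Fin n)) : ℝ := WithLp.ofLp s A

/-- The Clifford number with prescribed coefficients. -/
def Cl.ofCoeff (c : Finset (Fin n) → ℝ) : Cl n := WithLp.toLp 2 c

@[simp] theorem Cl.coeff_ofCoeff (c : Finset (Fin n) → ℝ) (A : Finset (Fin n)) :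
    (Cl.ofCoeff c).coeff A = c A := rfl

@[ext] theorem Cl.ext {s t : Cl n} (h : ∀ A, s.coeff A = t.coeff A) : s = t :=
  PiLp.ext h

@[simp] theorem Cl.coeff_add (s t : Cl n) (A : Finset (Fin n)) :
    (s + t).coeff A = s.coeff A + t.coeff A := rfl

@[simp] theorem Cl.coeff_zero (A : Finset (Fin n)) : (0 : Cl n).coeff A = 0 := rfl

@[simp] theorem Cl.coeff_smul (r : ℝ) (s : Cl n) (A : Finset (Fin n)) :
    (r • s).coeff A = r * s.coeff A := rfl

/-- The sign in `e_A e_B = sgn A B • e_{A ∆ B}`: reordering contributes one factor `-1` for every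
pair `b < a`, and `e_i² = -1` contributes one factor `-1` for every common index. -/
def sgn (A B : Finset (Fin n)) : ℝ := ∏ a ∈ A, ∏ b ∈ B, if b ≤ a then -1 else 1

theorem prod_symmDiff_of_sq {ι : Type*} [DecidableEq ι] (f : ι → ℝ) (hf : ∀ i, f i * f i = 1)
    (A B : Finset ι) : ∏ i ∈ symmDiff A B, f i = (∏ i ∈ A, f i) * ∏ i ∈ B, f i := by
  have hd : Disjoint (A \ B) (B \ A) := disjoint_sdiff_sdiff
  have h1 : symmDiff A B = (A \ B) ∪ (B \ A) := rfl
  have hA := Finset.prod_inter_mul_prod_sdiff A B f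
  have hB := Finset.prod_inter_mul_prod_sdiff B A f
  have hI : (∏ i ∈ A ∩ B, f i) * (∏ i ∈ A ∩ B, f i) = 1 := by
    rw [← Finset.prod_mul_distrib]
    exact Finset.prod_eq_one fun i _ => hf i
  rw [h1, Finset.prod_union hd, ← hA, ← hB, Finset.inter_comm B A]
  linear_combination (-(∏ i ∈ A \ B, f i) * ∏ i ∈ B \ A, f i) * hI

theorem sgn_symmDiff_left (A B C : Finset (Fin n)) :
    sgn (symmDiff A B) C = sgn A C * sgn B C := by
  unfold sgn
  refine prod_symmDiff_of_sq _ (fun i => ?_) A B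
  rw [← Finset.prod_mul_distrib]
  exact Finset.prod_eq_one fun j _ => by split_ifs <;> norm_num

theorem sgn_symmDiff_right (A B C : Finset (Fin n)) :
    sgn A (symmDiff B C) = sgn A B * sgn A C := by
  unfold sgn
  rw [← Finset.prod_mul_distrib]
  refine Finset.prod_congr rfl fun i _ => ?_
  exact prod_symmDiff_of_sq _ (fun j => by split_ifs <;> norm_num) B C

@[simp] theorem sgn_empty_left (A : Finset (Fin n)) : sgn ∅ A = 1 := by simp [sgn]

@[simp] theorem sgn_empty_right (A : Finset (Fin n)) : sgn A ∅ = 1 := by simp [sgn]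

/-- The basis vector `e_A`. -/
def basisVec (A : Finset (Fin n)) : Cl n := Cl.ofCoeff fun B => if B = A then 1 else 0

instance : One (Cl n) := ⟨basisVec ∅⟩

/-- Bilinear extension of `e_A e_B = sgn A B • e_{A ∆ B}`: the `C`-th coefficient of `s t` is the
sum of `sgn B A * s_B * t_A` over all `A, B` with `B ∆ A = C`, that is `A = B ∆ C`. -/
instance : Mul (Cl n) :=
  ⟨fun s t => Cl.ofCoeff fun C =>
    ∑ B, sgn B (symmDiff B C) * s.coeff B * t.coeff (symmDiff B C)⟩

theorem Cl.coeff_one (A : Finset (Fin n)) :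
    (1 : Cl n).coeff A = if A = ∅ then 1 else 0 := rfl

theorem Cl.coeff_mul (s t : Cl n) (C : Finset (Fin n)) :
    (s * t).coeff C = ∑ B, sgn B (symmDiff B C) * s.coeff B * t.coeff (symmDiff B C) := rfl

theorem Cl.mul_assoc' (s t u : Cl n) : s * t * u = s * (t * u) := by
  ext D
  simp only [Cl.coeff_mul, Finset.mul_sum, Finset.sum_mul]
  rw [Finset.sum_comm]
  refine Finset.sum_congr rfl fun B _ => ?_
  have hinv : Function.Involutive (symmDiff B) := fun C => symmDiff_symmDiff_cancel_left B C
  refine Fintype.sum_equiv hinv.toPerm _ _ fun C => ?_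
  rw [Function.Involutive.coe_toPerm]
  obtain ⟨X, rfl⟩ : ∃ X, C = symmDiff B X := ⟨symmDiff B C, (hinv C).symm⟩
  obtain ⟨Y, rfl⟩ : ∃ Y, D = symmDiff (symmDiff B X) Y :=
    ⟨symmDiff (symmDiff B X) D, (symmDiff_symmDiff_cancel_left _ D).symm⟩
  have h1 : symmDiff B (symmDiff B X) = X := hinv X
  have h2 : symmDiff (symmDiff B X) (symmDiff (symmDiff B X) Y) = Y :=
    symmDiff_symmDiff_cancel_left _ Y
  have h3 : symmDiff B (symmDiff (symmDiff B X) Y) = symmDiff X Y := by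
    rw [← symmDiff_assoc, h1]
  have h4 : symmDiff X (symmDiff X Y) = Y := symmDiff_symmDiff_cancel_left X Y
  rw [h1, h2, h3, h4, sgn_symmDiff_left, sgn_symmDiff_right]
  ring

instance : Ring (Cl n) :=
  { (inferInstance : NormedAddCommGroup (Cl n)).toAddCommGroup with
    mul := (· * ·)
    one := 1
    mul_assoc := Cl.mul_assoc'
    one_mul := fun s => by
      ext C
      have h : symmDiff ∅ C = C := bot_symmDiff C
      simp [Cl.coeff_mul, Cl.coeff_one, h]
    mul_one := fun s => by
      ext C
      rw [Cl.coeff_mul, Finset.sum_eq_single C]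
      · simp [Cl.coeff_one]
      · intro B _ hB
        simp [Cl.coeff_one, hB]
      · simp
    left_distrib := fun s t u => by
      ext C
      simp [Cl.coeff_mul, mul_add, Finset.sum_add_distrib]
    right_distrib := fun s t u => by
      ext C
      simp [Cl.coeff_mul, mul_add, add_mul, Finset.sum_add_distrib]
    zero_mul := fun s => by
      ext C
      simp [Cl.coeff_mul]
    mul_zero := fun s => by
      ext C
      simp [Cl.coeff_mul] }

instance : Algebra ℝ (Cl n) :=
  Algebra.ofModule
    (fun r s t => by
      ext C
      simp only [Cl.coeff_mul, Cl.coeff_smul, Finset.mul_sum]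
      exact Finset.sum_congr rfl fun B _ => by ring)
    (fun r s t => by
      ext C
      simp only [Cl.coeff_mul, Cl.coeff_smul, Finset.mul_sum]
      exact Finset.sum_congr rfl fun B _ => by ring)

theorem basisVec_mul (A B : Finset (Fin n)) :
    basisVec A * basisVec B = sgn A B • basisVec (symmDiff A B) := by
  ext C
  rw [Cl.coeff_mul, Finset.sum_eq_single A]
  · have h : symmDiff A C = B ↔ C = symmDiff A B := by
      constructor
      · rintro rfl; simp
      · rintro rfl; simp
    by_cases hC : C = symmDiff A B
    · subst hC; simp [basisVec]
    · simp [basisVec, hC, h]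
  · intro D _ hD
    simp [basisVec, hD]
  · simp

/-- `e_i² = -1`. -/
theorem basisVec_singleton_sq (i : Fin n) : basisVec {i} * basisVec {i} = (-1 : Cl n) := by
  rw [basisVec_mul, symmDiff_self]
  simp only [sgn, Finset.prod_singleton, le_refl, if_true, neg_smul, one_smul]
  rfl

/-- `e_i e_j = - e_j e_i` for `i ≠ j`. -/
theorem basisVec_singleton_anticomm {i j : Fin n} (h : i ≠ j) :
    (basisVec {i} * basisVec {j} : Cl n) = -(basisVec {j} * basisVec {i}) := by
  rw [basisVec_mul, basisVec_mul, symmDiff_comm ({j} : Finset (Fin n)) {i}, ← neg_smul]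
  congr 1
  simp only [sgn, Finset.prod_singleton]
  rcases lt_or_gt_of_ne h with h | h
  · simp [h.le, not_le.2 h]
  · simp [h.le, not_le.2 h]

/-- `e_{i₁} (e_{i₂} ⋯ e_{i_r}) = e_{i₁ ⋯ i_r}` for `i₁ < i₂ < ⋯ < i_r`. -/
theorem basisVec_insert {i : Fin n} {A : Finset (Fin n)} (h : ∀ a ∈ A, i < a) :
    (basisVec {i} * basisVec A : Cl n) = basisVec (insert i A) := by
  have hi : i ∉ A := fun hA => lt_irrefl _ (h i hA)
  rw [basisVec_mul]
  have h1 : sgn {i} A = 1 := by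
    simp only [sgn, Finset.prod_singleton]
    exact Finset.prod_eq_one fun b hb => if_neg (not_le.2 (h b hb))
  have h2 : symmDiff {i} A = insert i A := by
    rw [(Finset.disjoint_singleton_left.2 hi).symmDiff_eq_sup]
    rfl
  rw [h1, h2, one_smul]

/-- Clifford conjugation. -/
def conj (s : Cl n) : Cl n :=
  Cl.ofCoeff fun A => (-1) ^ (A.card * (A.card + 1) / 2) * s.coeff A

/-- The paravectors `ℝ^{n+1} = {s₀ + s₁ e₁ + ⋯ + s_n e_n}`, as a subset of `ℝ_n`. -/
def paravectors (n : ℕ) : Set (Cl n) := {s | ∀ A : Finset (Fin n), 2 ≤ A.card → s.coeff A = 0}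

/-- The sphere `𝕊` of purely imaginary paravectors of modulus one. -/
def imagSphere (n : ℕ) : Set (Cl n) := {s | s ∈ paravectors n ∧ s.coeff ∅ = 0 ∧ ‖s‖ = 1}

/-- The point `t e^{Jφ} = t cos φ + J t sin φ` of the plane `ℂ_J`. -/
def polar (J : Cl n) (t φ : ℝ) : Cl n :=
  (t * Real.cos φ) • (1 : Cl n) + (t * Real.sin φ) • J

/-- `I_ω = (-ω, ω) ∪ (π - ω, π + ω)`. -/
def angles (ω : ℝ) : Set ℝ :=
  Set.Ioo (-ω) ω ∪ Set.Ioo (Real.pi - ω) (Real.pi + ω)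

/-- The open double sector `D_ω` of nonzero paravectors with argument in `I_ω`. -/
def doubleSector (n : ℕ) (ω : ℝ) : Set (Cl n) :=
  {s | ∃ J ∈ imagSphere n, ∃ t : ℝ, 0 < t ∧ ∃ φ ∈ angles ω, s = polar J t φ}

/-! ### Slice hyperholomorphic functions -/

/-- The set `{(x, y) | x + 𝕊 y ⊆ U}`. -/
def planeSet (U : Set (Cl n)) : Set (ℝ × ℝ) :=
  {z | ∀ J ∈ imagSphere n, z.1 • (1 : Cl n) + z.2 • J ∈ U}

/-- `f = f₀ + J f₁` on the open axially symmetric set `U`, with the compatibility conditions and the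
Cauchy-Riemann equations, where `f₀, f₁` are continuously differentiable. -/
structure IsSliceDecomposition (U : Set (Cl n)) (f : Cl n → Cl n) (f₀ f₁ : ℝ × ℝ → Cl n) :
    Prop where
  contDiffOn_zero : ContDiffOn ℝ 1 f₀ (planeSet U)
  contDiffOn_one : ContDiffOn ℝ 1 f₁ (planeSet U)
  eq_add : ∀ z ∈ planeSet U, ∀ J ∈ imagSphere n,
    f (z.1 • (1 : Cl n) + z.2 • J) = f₀ z + J * f₁ z
  even : ∀ z ∈ planeSet U, f₀ (z.1, -z.2) = f₀ z
  odd : ∀ z ∈ planeSet U, f₁ (z.1, -z.2) = -f₁ z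
  cauchyRiemann_one : ∀ z ∈ planeSet U, fderiv ℝ f₀ z (1, 0) = fderiv ℝ f₁ z (0, 1)
  cauchyRiemann_two : ∀ z ∈ planeSet U, fderiv ℝ f₀ z (0, 1) = -fderiv ℝ f₁ z (1, 0)

/-- Intrinsic functions `𝒩(U)`: `f₀` and `f₁` can be chosen real valued. -/
def IsIntrinsic (U : Set (Cl n)) (f : Cl n → Cl n) : Prop :=
  ∃ f₀ f₁ : ℝ × ℝ → Cl n, IsSliceDecomposition U f f₀ f₁ ∧
    ∀ z ∈ planeSet U, (∃ a : ℝ, f₀ z = algebraMap ℝ (Cl n) a) ∧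
      ∃ b : ℝ, f₁ z = algebraMap ℝ (Cl n) b

/-- The space `𝒩⁰(D_θ)` of bounded intrinsic functions on `D_θ` for which
`∫₀^∞ |g(t e^{Jφ})| dt / t` is finite for all `J ∈ 𝕊`, `φ ∈ I_θ`. -/
structure MemNZero (θ : ℝ) (g : Cl n → Cl n) : Prop where
  intrinsic : IsIntrinsic (doubleSector n θ) g
  bounded : ∃ M : ℝ, ∀ s ∈ doubleSector n θ, ‖g s‖ ≤ M
  integrable : ∀ J ∈ imagSphere n, ∀ φ ∈ angles θ,
    MeasureTheory.IntegrableOn (fun t : ℝ => ‖g (polar J t φ)‖ / t) (Set.Ioi 0)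

/-- The function `s ↦ p(s) q(s)⁻¹` of a paravector variable. -/
def ratFun (p q : Polynomial ℝ) (s : Cl n) : Cl n :=
  Polynomial.aeval s p * Ring.inverse (Polynomial.aeval s q)

/-! ### Clifford modules and operators -/

/-- The Clifford module `V = E ⊗ ℝ_n` over the real Banach space `E`; the element
`∑ A, v_A ⊗ e_A` is the family of its coefficients, and `‖v‖² = ∑ A, ‖v_A‖²`. -/
abbrev CliffordModule (n : ℕ) (E : Type*) : Type _ := PiLp 2 (fun _ : Finset (Fin n) => E)

variable {E : Type*} [NormedAddCommGroup E] [NormedSpace ℝ E]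

/-- Left multiplication `s v = ∑ A B, (s_B v_A) ⊗ (e_B e_A)`. -/
def leftMul (s : Cl n) : CliffordModule n E →L[ℝ] CliffordModule n E where
  toFun v := WithLp.toLp 2 fun C =>
    ∑ B, (sgn B (symmDiff B C) * s.coeff B) • v (symmDiff B C)
  map_add' v w := by
    ext C
    simp [smul_add, Finset.sum_add_distrib]
  map_smul' r v := by
    ext C
    simp only [PiLp.smul_apply, RingHom.id_apply, Finset.smul_sum]
    exact Finset.sum_congr rfl fun B _ => smul_comm _ _ _
  cont := by fun_prop

/-- Right multiplication `v s = ∑ A B, (v_A s_B) ⊗ (e_A e_B)`. -/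
def rightMul (s : Cl n) : CliffordModule n E →L[ℝ] CliffordModule n E where
  toFun v := WithLp.toLp 2 fun C =>
    ∑ B, (sgn (symmDiff B C) B * s.coeff B) • v (symmDiff B C)
  map_add' v w := by
    ext C
    simp [smul_add, Finset.sum_add_distrib]
  map_smul' r v := by
    ext C
    simp only [PiLp.smul_apply, RingHom.id_apply, Finset.smul_sum]
    exact Finset.sum_congr rfl fun B _ => smul_comm _ _ _
  cont := by fun_prop

/-- The class `𝒦(V)` of closed right-linear operators with two-sided linear domain. -/
structure IsClosedClifford (T : CliffordModule n E →ₗ.[ℝ] CliffordModule n E) : Prop where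
  closed : T.IsClosed
  left_mem : ∀ (s : Cl n), ∀ v ∈ T.domain, leftMul s v ∈ T.domain
  right_mem : ∀ (s : Cl n), ∀ v ∈ T.domain, rightMul s v ∈ T.domain
  map_right : ∀ (s : Cl n) (v : T.domain),
    T ⟨rightMul s v, right_mem s v v.2⟩ = rightMul s (T v)

section Operators

variable {W : Type*} [NormedAddCommGroup W] [NormedSpace ℝ W]

/-- The product `S T` of unbounded operators, with domain `{v ∈ dom T | T v ∈ dom S}`. -/
def opMul (S T : W →ₗ.[ℝ] W) : W →ₗ.[ℝ] W where
  domain :=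
    { carrier := {v | ∃ h : v ∈ T.domain, T ⟨v, h⟩ ∈ S.domain}
      add_mem' := by
        rintro a b ⟨ha, ha'⟩ ⟨hb, hb'⟩
        refine ⟨T.domain.add_mem ha hb, ?_⟩
        have h : T ⟨a + b, T.domain.add_mem ha hb⟩ = T ⟨a, ha⟩ + T ⟨b, hb⟩ :=
          T.map_add ⟨a, ha⟩ ⟨b, hb⟩
        rw [h]
        exact S.domain.add_mem ha' hb'
      zero_mem' := by
        refine ⟨T.domain.zero_mem, ?_⟩
        have h : T ⟨0, T.domain.zero_mem⟩ = 0 := T.map_zero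
        rw [h]
        exact S.domain.zero_mem
      smul_mem' := by
        rintro r a ⟨ha, ha'⟩
        refine ⟨T.domain.smul_mem r ha, ?_⟩
        have h : T ⟨r • a, T.domain.smul_mem r ha⟩ = r • T ⟨a, ha⟩ := T.map_smul r ⟨a, ha⟩
        rw [h]
        exact S.domain.smul_mem r ha' }
  toFun :=
    { toFun := fun v => S ⟨T ⟨v, v.2.fst⟩, v.2.snd⟩
      map_add' := fun a b => by
        rw [← S.map_add]
        congr 1
        exact Subtype.ext (T.map_add ⟨a, a.2.fst⟩ ⟨b, b.2.fst⟩)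
      map_smul' := fun r a => by
        rw [RingHom.id_apply, ← S.map_smul]
        congr 1
        exact Subtype.ext (T.map_smul r ⟨a, a.2.fst⟩) }

/-- The powers `T^0 = 1`, `T^{k+1} = T T^k`. -/
def opPow (T : W →ₗ.[ℝ] W) : ℕ → (W →ₗ.[ℝ] W)
  | 0 => (LinearMap.id : W →ₗ[ℝ] W).toPMap ⊤
  | k + 1 => opMul T (opPow T k)

theorem opPow_domain_antitone (T : W →ₗ.[ℝ] W) : Antitone fun k => (opPow T k).domain :=
  antitone_nat_of_succ_le fun _ _ h => Exists.fst h

/-- The polynomial functional calculus `p[T] = p₀ + p₁ T + ⋯ + p_N T^N` with domain `dom (T^N)`,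
where `N` is the degree of `p` (and `N = 0` if `p = 0`). -/
def polyOp (T : W →ₗ.[ℝ] W) (p : Polynomial ℝ) : W →ₗ.[ℝ] W where
  domain := (opPow T p.natDegree).domain
  toFun := ∑ k : Fin (p.natDegree + 1), p.coeff k •
    (opPow T k).toFun.comp
      (Submodule.inclusion (opPow_domain_antitone T (Nat.lt_succ_iff.1 k.2)))

/-- `B` is the everywhere defined bounded inverse of `A`. -/
def IsBoundedInverse (A : W →ₗ.[ℝ] W) (B : W →L[ℝ] W) : Prop :=
  (∀ v, ∃ h : B v ∈ A.domain, A ⟨B v, h⟩ = v) ∧ ∀ v : A.domain, B (A v) = v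

open Classical in
/-- The bounded operator `A⁻¹` (set to `0` if `A` has no bounded inverse). -/
def boundedInverse (A : W →ₗ.[ℝ] W) : W →L[ℝ] W :=
  if h : ∃ B, IsBoundedInverse A B then h.choose else 0

open Classical in
/-- The product `T B` as a bounded operator, when `B` is bounded with range in `dom T` and `T B` is
bounded (set to `0` otherwise). -/
def mulBounded (T : W →ₗ.[ℝ] W) (B : W →L[ℝ] W) : W →L[ℝ] W :=
  if h : ∃ L : W →L[ℝ] W, ∀ v, ∃ hv : B v ∈ T.domain, L v = T ⟨B v, hv⟩ then h.choose else 0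

/-- By the closed graph theorem `mulBounded T B` is the product `T B` for all closed `T` and all
bounded `B` with range in `dom T`. -/
theorem mulBounded_apply [CompleteSpace W] {T : W →ₗ.[ℝ] W} (hT : T.IsClosed) {B : W →L[ℝ] W}
    (hB : ∀ v, B v ∈ T.domain) (v : W) : mulBounded T B v = T ⟨B v, hB v⟩ := by
  have h : ∃ L : W →L[ℝ] W, ∀ v, ∃ hv : B v ∈ T.domain, L v = T ⟨B v, hv⟩ := by
    let L : W →ₗ[ℝ] W := T.toFun.comp (B.toLinearMap.codRestrict T.domain hB)
    have hL : IsClosed (L.graph : Set (W × W)) := by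
      have h1 : (L.graph : Set (W × W)) =
          (fun z : W × W => (B z.1, z.2)) ⁻¹' (T.graph : Set (W × W)) := by
        ext z
        simp only [SetLike.mem_coe, LinearMap.mem_graph_iff, Set.mem_preimage,
          LinearPMap.mem_graph_iff]
        constructor
        · intro hz
          exact ⟨⟨B z.1, hB z.1⟩, rfl, hz.symm⟩
        · rintro ⟨y, hy, hz⟩
          rw [← hz]
          have : y = ⟨B z.1, hB z.1⟩ := Subtype.ext hy
          rw [this]
          rfl
      rw [h1]
      exact hT.preimage (by fun_prop)
    exact ⟨⟨L, L.continuous_of_isClosed_graph hL⟩, fun v => ⟨hB v, rfl⟩⟩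
  unfold mulBounded
  rw [dif_pos h]
  exact (h.choose_spec v).snd

end Operators

/-! ### The `S`-spectrum, bisectorial operators and the `ω`-functional calculus -/

/-- `Q_s[T] = T² - 2 s₀ T + |s|²`, with domain `dom (T²)`. -/
def opQ (s : Cl n) (T : CliffordModule n E →ₗ.[ℝ] CliffordModule n E) :
    CliffordModule n E →ₗ.[ℝ] CliffordModule n E :=
  polyOp T (Polynomial.X ^ 2 - Polynomial.C (2 * s.coeff ∅) * Polynomial.X +
    Polynomial.C (‖s‖ ^ 2))

/-- The `S`-resolvent set. -/
def sResolventSet (T : CliffordModule n E →ₗ.[ℝ] CliffordModule n E) : Set (Cl n) :=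
  {s | s ∈ paravectors n ∧ ∃ B, IsBoundedInverse (opQ s T) B}

/-- The `S`-spectrum. -/
def sSpectrum (T : CliffordModule n E →ₗ.[ℝ] CliffordModule n E) : Set (Cl n) :=
  paravectors n \ sResolventSet T

/-- The left `S`-resolvent `S_L⁻¹(s, T) = Q_s[T]⁻¹ s̄ - T Q_s[T]⁻¹`, for `s` in the `S`-resolvent
set, where an operator times a Clifford number acts as `(T s)(v) = T (s v)`. -/
def leftSResolvent (s : Cl n) (T : CliffordModule n E →ₗ.[ℝ] CliffordModule n E) :
    CliffordModule n E →L[ℝ] CliffordModule n E :=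
  (boundedInverse (opQ s T)).comp (leftMul (conj s)) - mulBounded T (boundedInverse (opQ s T))

/-- Closed operators which are bisectorial of angle `ω`. -/
structure IsBisectorial (T : CliffordModule n E →ₗ.[ℝ] CliffordModule n E) (ω : ℝ) : Prop where
  closedClifford : IsClosedClifford T
  spectrum_subset : sSpectrum T ⊆ closure (doubleSector n ω)
  resolvent_bound : ∀ φ ∈ Set.Ioo ω (Real.pi / 2), ∃ C : ℝ, 0 ≤ C ∧
    ∀ s ∈ paravectors n, s ∉ doubleSector n φ → s ≠ 0 → ‖leftSResolvent s T‖ ≤ C / ‖s‖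

/-- The integrand `S_L⁻¹(γ(t), T) (γ'(t) / J) f(γ(t))` of the path integral
`∫_γ S_L⁻¹(s, T) ds_J f(s)`. -/
def pathIntegrand (T : CliffordModule n E →ₗ.[ℝ] CliffordModule n E) (f : Cl n → Cl n) (J : Cl n)
    (γ : ℝ → Cl n) (t : ℝ) : CliffordModule n E →L[ℝ] CliffordModule n E :=
  (leftSResolvent (γ t) T).comp (leftMul (deriv γ t * Ring.inverse J * f (γ t)))

/-- The path `γ₊(t) = |t| e^{-sgn(t) J φ}`; together, `γ₊` and `γ₋ = -γ₊` parametrize the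
positively oriented boundary of `D_φ ∩ ℂ_J`. -/
def boundaryPath (J : Cl n) (φ t : ℝ) : Cl n := polar J |t| (-(Real.sign t * φ))

/-- `F = f(T)` in the sense of the `ω`-functional calculus, for `T` bisectorial of angle `ω` and `f`
on the double sector `D_θ`: for every angle `φ ∈ (ω, θ)` and every imaginary unit `J` the integral
over the boundary of `D_φ ∩ ℂ_J` converges absolutely, and
`F = (2π)⁻¹ ∫ S_L⁻¹(s, T) ds_J f(s)`. -/
def HasOmegaCalculus (T : CliffordModule n E →ₗ.[ℝ] CliffordModule n E) (ω θ : ℝ)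
    (f : Cl n → Cl n) (F : CliffordModule n E →L[ℝ] CliffordModule n E) : Prop :=
  ∀ φ ∈ Set.Ioo ω θ, ∀ J ∈ imagSphere n,
    MeasureTheory.Integrable (pathIntegrand T f J (boundaryPath J φ)) ∧
    MeasureTheory.Integrable (pathIntegrand T f J (-boundaryPath J φ)) ∧
    F = (1 / (2 * Real.pi)) • ((∫ t, pathIntegrand T f J (boundaryPath J φ) t) +
      ∫ t, pathIntegrand T f J (-boundaryPath J φ) t)

end CliffordOmega

end

open CliffordOmega

/-! On each plane `ℂ_J` the S-resolvent is governed by the ordinary resolvent of the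
complexification of T. For z outside the double sector, a vector v and a real functional l, put
R_v(z) = l((z - T)⁻¹ v) with (z - T)⁻¹ = Q_z[T]⁻¹ (z̄ - T); this is `resPairing`. Left
multiplication by J need not commute with T, but l(S_L⁻¹(z, T)(c v)) = Re(c R_v(z)) + Im(c
R_{Jv}(z)) (`apply_leftSResolvent_leftMulPlane`), so the operator integrals are read off from scalar
contour integrals.

Since the numerator vanishes at 0, write it as X p. For p ≠ 0 put P = (X² + 1) p, so that deg P ≤
deg q and s p(s)/q(s) = reg(s) P(s)/q(s) with reg(s) = s/(s² + 1). From (z - T)⁻¹ T = z (z - T)⁻¹ -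
1 it follows that P R_{q[T]w} - q R_{P[T]w} is a polynomial D of degree below deg q
(`exists_resPairing_polyAct`). On the boundary rays the integrand is therefore reg · R_{P[T]w} + reg
· D/q. The second summand is holomorphic inside the double sector and contributes 0. The first is
holomorphic outside it except for simple poles at ±i, and T² + 1 = Q_{±i}[T] turns the residues into
2π l((X p)[T] w) (`HasSectorialBounds.boundaryInt_resPairing`). Thus F q[T] w = (X p)[T] w comes
from one residue computation, without a product rule for the calculus. The term with J drops out: J
q[T] w = q[T] u for some u, and the scalar integral attached to u is real, while only its imaginary
part enters.

The polynomial q is a constant times quadratics Q_z with z outside the closed double sector, so q[T]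
is bijective (`bijectivePoly_of_roots`). An operator is then determined by its values on the vectors
q[T] w, which gives independence of φ and J as well as the identity with its domains.

The analytic input is the passage from the S-resolvent estimate to estimates of Q_z[T]⁻¹ and T
Q_z[T]⁻¹ (`IsBisectorial.hasSectorialBounds`), and the holomorphy of R_v
(`differentiableAt_resPairing`). Contour integrals are computed with s = e^z: rays become horizontal
lines and reg becomes 1/(2 cosh z). -/

namespace CliffordOmega

open Polynomial

/-! ### Polynomials of an unbounded operator, and bijectivity of products. -/

section PolynomialCalculus

variable {W : Type*} [NormedAddCommGroup W] [NormedSpace ℝ W] (T : W →ₗ.[ℝ] W)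

open Classical in
/-- The extension of a partially defined operator by zero. -/
noncomputable def extZero (w : W) : W := if h : w ∈ T.domain then T ⟨w, h⟩ else 0

variable {T} in
theorem extZero_of_mem {w : W} (h : w ∈ T.domain) : extZero T w = T ⟨w, h⟩ := dif_pos h

theorem opPow_apply (k : ℕ) (w : (opPow T k).domain) :
    opPow T k w = (extZero T)^[k] (w : W) := by
  induction k with
  | zero => rfl
  | succ k ih =>
    rw [Function.iterate_succ_apply', ← ih ⟨w, w.2.fst⟩, extZero_of_mem w.2.snd]
    rfl

theorem mem_domain_opPow_zero (w : W) : w ∈ (opPow T 0).domain := trivial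

theorem mem_domain_opPow_succ {k : ℕ} {w : W} :
    w ∈ (opPow T (k + 1)).domain ↔ w ∈ (opPow T k).domain ∧ (extZero T)^[k] w ∈ T.domain := by
  constructor
  · rintro ⟨h, h'⟩
    exact ⟨h, by rwa [opPow_apply] at h'⟩
  · rintro ⟨h, h'⟩
    exact ⟨h, by rwa [opPow_apply]⟩

theorem mem_domain_opPow_one {w : W} : w ∈ (opPow T 1).domain ↔ w ∈ T.domain := by
  rw [mem_domain_opPow_succ]
  simp [mem_domain_opPow_zero]

theorem mem_domain_opPow_add {j k : ℕ} {w : W} :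
    w ∈ (opPow T (j + k)).domain ↔
      w ∈ (opPow T k).domain ∧ (extZero T)^[k] w ∈ (opPow T j).domain := by
  induction j with
  | zero => simp [mem_domain_opPow_zero]
  | succ j ih =>
    rw [Nat.add_right_comm, mem_domain_opPow_succ, ih, mem_domain_opPow_succ,
      Function.iterate_add_apply, and_assoc]

variable {T} in
theorem mem_domain_opPow_of_le {j k : ℕ} (h : j ≤ k) {w : W} (hw : w ∈ (opPow T k).domain) :
    w ∈ (opPow T j).domain := opPow_domain_antitone T h hw

variable {T} in
theorem iterate_extZero_add {k : ℕ} {v w : W} (hv : v ∈ (opPow T k).domain)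
    (hw : w ∈ (opPow T k).domain) :
    (extZero T)^[k] (v + w) = (extZero T)^[k] v + (extZero T)^[k] w := by
  have := (opPow T k).map_add ⟨v, hv⟩ ⟨w, hw⟩
  simp only [opPow_apply] at this
  exact this

variable {T} in
theorem iterate_extZero_smul {k : ℕ} (r : ℝ) {w : W} (hw : w ∈ (opPow T k).domain) :
    (extZero T)^[k] (r • w) = r • (extZero T)^[k] w := by
  have := (opPow T k).map_smul r ⟨w, hw⟩
  simp only [opPow_apply] at this
  exact this

theorem iterate_extZero_zero (k : ℕ) : (extZero T)^[k] (0 : W) = 0 := by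
  have := (opPow T k).map_zero
  simp only [opPow_apply] at this
  exact this

variable {T} in
theorem iterate_extZero_sum {ι : Type*} {k : ℕ} (s : Finset ι) (f : ι → W)
    (hf : ∀ i ∈ s, f i ∈ (opPow T k).domain) :
    (extZero T)^[k] (∑ i ∈ s, f i) = ∑ i ∈ s, (extZero T)^[k] (f i) := by
  classical
  induction s using Finset.induction_on with
  | empty => simpa using iterate_extZero_zero T k
  | insert i s hi ih =>
    rw [Finset.sum_insert hi, Finset.sum_insert hi, iterate_extZero_add (hf _ (by simp))
      (Submodule.sum_mem _ fun j hj => hf j (by simp [hj])), ih fun j hj => hf j (by simp [hj])]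

variable {T} in
theorem extZero_add {v w : W} (hv : v ∈ T.domain) (hw : w ∈ T.domain) :
    extZero T (v + w) = extZero T v + extZero T w :=
  iterate_extZero_add (k := 1) ((mem_domain_opPow_one T).2 hv) ((mem_domain_opPow_one T).2 hw)

variable {T} in
theorem extZero_smul (r : ℝ) {w : W} (hw : w ∈ T.domain) :
    extZero T (r • w) = r • extZero T w :=
  iterate_extZero_smul (k := 1) r ((mem_domain_opPow_one T).2 hw)

/-- The vector `p[T] w`, as a linear function of the polynomial `p`; it has its usual meaning for
`w` in the domain of `T ^ natDegree p`. -/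
noncomputable def polyAct (w : W) : ℝ[X] →ₗ[ℝ] W :=
  Polynomial.lsum fun k => LinearMap.toSpanSingleton ℝ W ((extZero T)^[k] w)

theorem polyAct_eq_sum (w : W) {p : ℝ[X]} {N : ℕ} (hp : p.natDegree ≤ N) :
    polyAct T w p = ∑ k ∈ Finset.range (N + 1), p.coeff k • (extZero T)^[k] w :=
  p.sum_over_range' (by simp) _ (Nat.lt_succ_of_le hp)

@[simp] theorem polyAct_C (w : W) (a : ℝ) : polyAct T w (C a) = a • w := by
  rw [polyAct_eq_sum (N := 0) T w (by simp)]
  simp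

theorem polyAct_X_pow (w : W) (k : ℕ) : polyAct T w (X ^ k) = (extZero T)^[k] w := by
  rw [polyAct_eq_sum (N := k) T w (by simp)]
  simp [coeff_X_pow]

@[simp] theorem polyAct_X (w : W) : polyAct T w X = extZero T w := by
  simpa using polyAct_X_pow T w 1

@[simp] theorem polyAct_C_mul (w : W) (a : ℝ) (p : ℝ[X]) :
    polyAct T w (C a * p) = a • polyAct T w p := by
  rw [← smul_eq_C_mul, map_smul]

/-- No domain condition is needed because X ^ k acts innermost, where only iterates of the total map
`extZero T` are composed. Moving a power to the outside requires additivity of `extZero T`, which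
holds only on the domain. -/
theorem polyAct_mul_X_pow (w : W) (p : ℝ[X]) (k : ℕ) :
    polyAct T w (p * X ^ k) = polyAct T ((extZero T)^[k] w) p := by
  induction p using Polynomial.induction_on' with
  | add p q hp hq => rw [add_mul, map_add, hp, hq, map_add]
  | monomial j a =>
    rw [← C_mul_X_pow_eq_monomial, mul_assoc, ← pow_add, polyAct_C_mul, polyAct_C_mul,
      polyAct_X_pow, polyAct_X_pow, Function.iterate_add_apply]

theorem polyOp_apply (p : ℝ[X]) (w : (polyOp T p).domain) :
    polyOp T p w = polyAct T (w : W) p := by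
  rw [polyAct_eq_sum T _ le_rfl, Finset.sum_range]
  have h : ∀ v : (opPow T p.natDegree).domain, (∑ k : Fin (p.natDegree + 1), p.coeff k •
      (opPow T k).toFun.comp (Submodule.inclusion
        (opPow_domain_antitone T (Nat.lt_succ_iff.1 k.2)))) v =
      ∑ k : Fin (p.natDegree + 1), p.coeff k • (extZero T)^[k] (v : W) := fun v => by
    rw [LinearMap.sum_apply]
    exact Finset.sum_congr rfl fun k _ => congrArg (p.coeff k • ·) (opPow_apply T k ⟨v, _⟩)
  exact h w

theorem mem_domain_polyOp {p : ℝ[X]} {w : W} :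
    w ∈ (polyOp T p).domain ↔ w ∈ (opPow T p.natDegree).domain := Iff.rfl

variable {T}

theorem polyAct_mem {j N : ℕ} {p : ℝ[X]} {w : W} (hp : p.natDegree ≤ N)
    (hw : w ∈ (opPow T (j + N)).domain) : polyAct T w p ∈ (opPow T j).domain := by
  rw [polyAct_eq_sum T w hp]
  refine Submodule.sum_mem _ fun k hk => Submodule.smul_mem _ _ ?_
  rw [Finset.mem_range] at hk
  exact ((mem_domain_opPow_add T).1 (mem_domain_opPow_of_le (by omega) hw)).2

theorem iterate_extZero_polyAct {j N : ℕ} {p : ℝ[X]} {w : W} (hp : p.natDegree ≤ N)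
    (hw : w ∈ (opPow T (j + N)).domain) :
    (extZero T)^[j] (polyAct T w p) = polyAct T w (X ^ j * p) := by
  have hmem : ∀ k ∈ Finset.range (N + 1), (extZero T)^[k] w ∈ (opPow T j).domain := fun k hk => by
    rw [Finset.mem_range] at hk
    exact ((mem_domain_opPow_add T).1 (mem_domain_opPow_of_le (by omega) hw)).2
  rw [polyAct_eq_sum T w hp, iterate_extZero_sum _ _
    fun k hk => Submodule.smul_mem _ _ (hmem k hk)]
  conv_rhs => rw [p.as_sum_range' _ (Nat.lt_succ_of_le hp), Finset.mul_sum, map_sum]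
  refine Finset.sum_congr rfl fun k hk => ?_
  rw [iterate_extZero_smul _ (hmem k hk), ← C_mul_X_pow_eq_monomial, mul_left_comm, ← pow_add,
    polyAct_C_mul, polyAct_X_pow, Function.iterate_add_apply]

theorem polyAct_mul {N M : ℕ} {p q : ℝ[X]} {w : W} (hp : p.natDegree ≤ N) (hq : q.natDegree ≤ M)
    (hw : w ∈ (opPow T (N + M)).domain) :
    polyAct T w (p * q) = polyAct T (polyAct T w q) p := by
  rw [polyAct_eq_sum T _ hp]
  conv_lhs => rw [p.as_sum_range' _ (Nat.lt_succ_of_le hp), Finset.sum_mul, map_sum]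
  refine Finset.sum_congr rfl fun k hk => ?_
  rw [Finset.mem_range] at hk
  rw [iterate_extZero_polyAct hq (mem_domain_opPow_of_le (by omega) hw),
    ← C_mul_X_pow_eq_monomial, mul_assoc, polyAct_C_mul]

/-- Elliptic regularity in miniature: in T ^ j q[T] w all terms but the leading one already lie in
dom T, so the leading one does too, and its coefficient is invertible. This is what makes the domain
of a product polynomial equal to that of the composition. -/
theorem mem_domain_of_polyAct_mem {j : ℕ} {q : ℝ[X]} (hq : q ≠ 0) {w : W}
    (hw : w ∈ (opPow T q.natDegree).domain) (h : polyAct T w q ∈ (opPow T j).domain) :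
    w ∈ (opPow T (j + q.natDegree)).domain := by
  induction j with
  | zero => rwa [zero_add]
  | succ j ih =>
    obtain ⟨h1, h2⟩ := (mem_domain_opPow_succ T).1 h
    have hj := ih h1
    have h3 : w ∈ (opPow T (j + q.natDegree)).domain ∧
        (extZero T)^[j + q.natDegree] w ∈ T.domain := by
      refine ⟨hj, ?_⟩
      rw [iterate_extZero_polyAct le_rfl hj, polyAct_eq_sum T w (N := j + q.natDegree)
        (by rw [mul_comm, natDegree_mul_X_pow _ hq, add_comm]), Finset.sum_range_succ] at h2
      have h4 : ∑ k ∈ Finset.range (j + q.natDegree),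
          (X ^ j * q).coeff k • (extZero T)^[k] w ∈ T.domain := by
        refine Submodule.sum_mem _ fun k hk => Submodule.smul_mem _ _ ?_
        rw [Finset.mem_range] at hk
        exact ((mem_domain_opPow_succ T).1 (mem_domain_opPow_of_le (by omega) hj)).2
      have h5 := (Submodule.add_mem_iff_right _ h4).1 h2
      rw [add_comm j, coeff_X_pow_mul] at h5
      rw [add_comm j]
      exact (Submodule.smul_mem_iff _ (leadingCoeff_ne_zero.2 hq)).1 h5
    rw [Nat.add_right_comm]
    exact (mem_domain_opPow_succ T).2 h3

/-- `q[T]` is a bijection from `dom (T ^ natDegree q)` onto the whole space. -/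
def BijectivePoly (T : W →ₗ.[ℝ] W) (q : ℝ[X]) : Prop :=
  (∀ v, ∃ w ∈ (opPow T q.natDegree).domain, polyAct T w q = v) ∧
    ∀ w ∈ (opPow T q.natDegree).domain, polyAct T w q = 0 → w = 0

theorem BijectivePoly.mul {p q : ℝ[X]} (hp0 : p ≠ 0) (hq0 : q ≠ 0) (hp : BijectivePoly T p)
    (hq : BijectivePoly T q) : BijectivePoly T (p * q) := by
  rw [BijectivePoly, natDegree_mul hp0 hq0]
  constructor
  · intro v
    obtain ⟨u, hu, rfl⟩ := hp.1 v
    obtain ⟨w, hw, rfl⟩ := hq.1 u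
    have := mem_domain_of_polyAct_mem hq0 hw hu
    exact ⟨w, this, polyAct_mul le_rfl le_rfl this⟩
  · intro w hw h
    rw [polyAct_mul le_rfl le_rfl hw] at h
    exact hq.2 w (mem_domain_opPow_of_le (by omega) hw) (hp.2 _ (polyAct_mem le_rfl hw) h)

theorem bijectivePoly_C {a : ℝ} (ha : a ≠ 0) : BijectivePoly T (C a) := by
  constructor
  · intro v
    exact ⟨a⁻¹ • v, by rw [natDegree_C]; trivial, by rw [polyAct_C, smul_inv_smul₀ ha]⟩
  · intro w _ h
    rw [polyAct_C] at h
    exact (smul_eq_zero.1 h).resolve_left ha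

theorem BijectivePoly.bijective {q : ℝ[X]} (hq : BijectivePoly T q) :
    Function.Bijective (polyOp T q) := by
  constructor
  · refine (injective_iff_map_eq_zero (polyOp T q).toFun).2 fun w hw => ?_
    exact Subtype.ext (hq.2 w w.2 ((polyOp_apply T q w).symm.trans hw))
  · intro v
    obtain ⟨w, hw, rfl⟩ := hq.1 v
    exact ⟨⟨w, hw⟩, polyOp_apply T q _⟩

theorem boundedInverse_spec {A : W →ₗ.[ℝ] W} (h : ∃ B, IsBoundedInverse A B) :
    IsBoundedInverse A (boundedInverse A) := by
  rw [boundedInverse, dif_pos h]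
  exact h.choose_spec

theorem IsBoundedInverse.bijectivePoly {q : ℝ[X]} {B : W →L[ℝ] W}
    (h : IsBoundedInverse (polyOp T q) B) : BijectivePoly T q := by
  constructor
  · intro v
    obtain ⟨hv, e⟩ := h.1 v
    exact ⟨B v, hv, (polyOp_apply T q ⟨B v, hv⟩).symm.trans e⟩
  · intro w hw h0
    have := h.2 ⟨w, hw⟩
    rw [polyOp_apply, h0, map_zero] at this
    exact this.symm

end PolynomialCalculus

end CliffordOmega

namespace CliffordOmega

open Polynomial

/-! ### The complex resolvent of a real operator and its holomorphy. -/

section Resolvent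

open Filter Topology ComplexConjugate

variable {W : Type*} [NormedAddCommGroup W] [NormedSpace ℝ W] (T : W →ₗ.[ℝ] W)

/-- The real polynomial `(X - z) (X - conj z)`. -/
noncomputable def quad (z : ℂ) : ℝ[X] := X ^ 2 - C (2 * z.re) * X + C (‖z‖ ^ 2)

theorem natDegree_quad (z : ℂ) : (quad z).natDegree = 2 := by
  unfold quad
  compute_degree!

theorem quad_ne_zero (z : ℂ) : quad z ≠ 0 :=
  ne_zero_of_natDegree_gt (n := 0) (by rw [natDegree_quad]; norm_num)

theorem polyAct_quad (z : ℂ) (w : W) : polyAct T w (quad z) =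
    extZero T (extZero T w) - (2 * z.re) • extZero T w + (‖z‖ ^ 2 : ℝ) • w := by
  rw [quad, map_add, map_sub, polyAct_X_pow, polyAct_C_mul, polyAct_X, polyAct_C]
  rfl

/-- The inverse of `Q_z[T] = T² - 2 Re z T + |z|²`. -/
noncomputable def quadInv (z : ℂ) : W →L[ℝ] W := boundedInverse (polyOp T (quad z))

/-- The operator `T Q_z[T]⁻¹`. -/
noncomputable def mulQuadInv (z : ℂ) : W →L[ℝ] W := mulBounded T (quadInv T z)

/-- The complex resolvent set of a real operator. -/
def HasQuadInv (z : ℂ) : Prop := ∃ B, IsBoundedInverse (polyOp T (quad z)) B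

/-- The pairing `ℓ ((z - T)⁻¹ v)`, where `(z - T)⁻¹ = Q_z[T]⁻¹ (conj z) - T Q_z[T]⁻¹` acts in the
complexification. -/
noncomputable def resPairing (l : StrongDual ℝ W) (v : W) (z : ℂ) : ℂ :=
  conj z * l (quadInv T z v) - l (extZero T (quadInv T z v))

variable {T}

theorem quadInv_mem_two {z : ℂ} (h : HasQuadInv T z) (v : W) :
    quadInv T z v ∈ (opPow T 2).domain := by
  obtain ⟨hv, -⟩ := (boundedInverse_spec h).1 v
  rwa [mem_domain_polyOp, natDegree_quad] at hv

theorem quadInv_mem {z : ℂ} (h : HasQuadInv T z) (v : W) : quadInv T z v ∈ T.domain :=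
  (mem_domain_opPow_one T).1 (mem_domain_opPow_of_le (by norm_num) (quadInv_mem_two h v))

theorem extZero_quadInv_mem {z : ℂ} (h : HasQuadInv T z) (v : W) :
    extZero T (quadInv T z v) ∈ T.domain :=
  ((mem_domain_opPow_succ T).1 (quadInv_mem_two h v)).2

theorem polyAct_quadInv {z : ℂ} (h : HasQuadInv T z) (v : W) :
    polyAct T (quadInv T z v) (quad z) = v := by
  obtain ⟨hv, e⟩ := (boundedInverse_spec h).1 v
  exact (polyOp_apply T _ ⟨_, hv⟩).symm.trans e

theorem extZero_extZero_quadInv {z : ℂ} (h : HasQuadInv T z) (v : W) :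
    extZero T (extZero T (quadInv T z v)) =
      v + (2 * z.re) • extZero T (quadInv T z v) - (‖z‖ ^ 2 : ℝ) • quadInv T z v := by
  have := polyAct_quadInv h v
  rw [polyAct_quad] at this
  nth_rw 2 [← this]
  abel

theorem quadInv_polyAct {z : ℂ} (h : HasQuadInv T z) {w : W} (hw : w ∈ (opPow T 2).domain) :
    quadInv T z (polyAct T w (quad z)) = w := by
  have hw' : w ∈ (polyOp T (quad z)).domain := by rwa [mem_domain_polyOp, natDegree_quad]
  have := (boundedInverse_spec h).2 ⟨w, hw'⟩
  rwa [polyOp_apply] at this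

/-- For w in dom T the vector Q⁻¹ w gains one more degree of regularity and lies in dom T³. Hence Q
may be applied to T Q⁻¹ w, and it gives T w. -/
theorem quadInv_extZero {z : ℂ} (h : HasQuadInv T z) {w : W} (hw : w ∈ T.domain) :
    quadInv T z (extZero T w) = extZero T (quadInv T z w) := by
  have h3 : quadInv T z w ∈ (opPow T (1 + 2)).domain := by
    have := mem_domain_of_polyAct_mem (T := T) (j := 1) (q := quad z) (quad_ne_zero z)
      (w := quadInv T z w) (by rw [natDegree_quad]; exact quadInv_mem_two h w)
      (by rw [polyAct_quadInv h, mem_domain_opPow_one]; exact hw)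
    rwa [natDegree_quad] at this
  have h2 : extZero T (quadInv T z w) ∈ (opPow T 2).domain :=
    ((mem_domain_opPow_add T (j := 2) (k := 1)).1 h3).2
  rw [← quadInv_polyAct h h2]
  congr 1
  have h4 := iterate_extZero_polyAct (j := 1) (natDegree_quad z).le h3
  rw [polyAct_quadInv h, mul_comm, polyAct_mul_X_pow] at h4
  exact h4

theorem resPairing_add {z : ℂ} (h : HasQuadInv T z) (l : StrongDual ℝ W) (v w : W) :
    resPairing T l (v + w) z = resPairing T l v z + resPairing T l w z := by
  simp only [resPairing, map_add, extZero_add (quadInv_mem h v) (quadInv_mem h w)]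
  push_cast
  ring

theorem resPairing_smul {z : ℂ} (h : HasQuadInv T z) (l : StrongDual ℝ W) (r : ℝ) (v : W) :
    resPairing T l (r • v) z = r * resPairing T l v z := by
  simp only [resPairing, map_smul, extZero_smul r (quadInv_mem h v), smul_eq_mul]
  push_cast
  ring

/-- This is (z - T)⁻¹ T = z (z - T)⁻¹ - 1, obtained from T² Q⁻¹ = 1 + (z + z̄) T Q⁻¹ - z z̄ Q⁻¹. -/
theorem resPairing_extZero {z : ℂ} (h : HasQuadInv T z) (l : StrongDual ℝ W) {w : W}
    (hw : w ∈ T.domain) :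
    resPairing T l (extZero T w) z = z * resPairing T l w z - l w := by
  simp only [resPairing, quadInv_extZero h hw, extZero_extZero_quadInv h w, map_add, map_sub,
    map_smul, smul_eq_mul]
  have h1 : z * conj z = (‖z‖ ^ 2 : ℝ) := by
    rw [Complex.mul_conj, Complex.normSq_eq_norm_sq]
  have h2 : z + conj z = (2 * z.re : ℝ) := Complex.add_conj z
  have e1 : z * (conj z * l (quadInv T z w) - l (extZero T (quadInv T z w))) =
    (z * conj z) * l (quadInv T z w) - z * l (extZero T (quadInv T z w)) := by ring
  rw [e1, h1]
  push_cast at h2 ⊢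
  linear_combination (l (extZero T (quadInv T z w)) : ℂ) * h2

/-- The pairing form of the resolvent identity. -/
theorem resPairing_sub {z z₀ : ℂ} (h : HasQuadInv T z) (h₀ : HasQuadInv T z₀)
    (l : StrongDual ℝ W) (v : W) :
    resPairing T l v z - resPairing T l v z₀ = (z₀ - z) *
      (resPairing T l (z₀.re • quadInv T z₀ v - extZero T (quadInv T z₀ v)) z +
        Complex.I * resPairing T l (-z₀.im • quadInv T z₀ v) z) := by
  -- With (z₀ - T)⁻¹ v = a + i b for real vectors a = Re z₀ u - T u and b = -Im z₀ u, the bracket in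
  -- the statement is the pairing of (z - T)⁻¹ (a + i b). Everything reduces to u, T u and v, with v
  -- eliminated through Q_{z₀} u = v.
  set u := quadInv T z₀ v with hu
  have hu1 : u ∈ T.domain := quadInv_mem h₀ v
  have hu2 : extZero T u ∈ T.domain := extZero_quadInv_mem h₀ v
  have e1 := resPairing_extZero h l hu1
  have e2 := resPairing_extZero h l hu2
  have e3 := extZero_extZero_quadInv h₀ v
  rw [← hu] at e3
  have e4 : v = extZero T (extZero T u) + ((-(2 * z₀.re)) • extZero T u +
      (‖z₀‖ ^ 2 : ℝ) • u) := by rw [e3, neg_smul]; abel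
  have e5 : resPairing T l v z = resPairing T l (extZero T (extZero T u)) z +
      ((-(2 * z₀.re) : ℝ) * resPairing T l (extZero T u) z +
        (‖z₀‖ ^ 2 : ℝ) * resPairing T l u z) := by
    conv_lhs => rw [e4]
    rw [resPairing_add h, resPairing_add h, resPairing_smul h, resPairing_smul h]
  have e6 : z₀.re • u - extZero T u = z₀.re • u + (-1 : ℝ) • extZero T u := by
    rw [neg_one_smul, sub_eq_add_neg]
  rw [e6, resPairing_add h, resPairing_smul h, resPairing_smul h, resPairing_smul h, e5, e2, e1]
  have e7 : resPairing T l v z₀ = conj z₀ * l u - l (extZero T u) := rfl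
  rw [e7]
  have h1 : ((‖z₀‖ ^ 2 : ℝ) : ℂ) = z₀ * conj z₀ := by
    rw [Complex.mul_conj, Complex.normSq_eq_norm_sq]
  have h2 : conj z₀ = z₀.re - z₀.im * Complex.I := by
    apply Complex.ext <;> simp
  rw [h1, h2]
  push_cast
  linear_combination (-(z * resPairing T l u z - l u)) * (Complex.re_add_im z₀)

/-- The closed exterior `{|Re z| sin φ ≤ |Im z| cos φ}` of the double sector of angle `φ`, without
the origin. -/
def outerCone (φ : ℝ) : Set ℂ := {z | z ≠ 0 ∧ |z.re| * Real.sin φ ≤ |z.im| * Real.cos φ}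

/-- The open exterior of the double sector of angle `φ`. -/
def openOuterCone (φ : ℝ) : Set ℂ := {z | |z.re| * Real.sin φ < |z.im| * Real.cos φ}

theorem isOpen_openOuterCone (φ : ℝ) : IsOpen (openOuterCone φ) :=
  isOpen_lt (by fun_prop) (by fun_prop)

theorem openOuterCone_subset (φ : ℝ) : openOuterCone φ ⊆ outerCone φ := fun z hz =>
  ⟨by rintro rfl; simp [openOuterCone] at hz, le_of_lt hz⟩

/-- The resolvent estimates are available only for angles strictly above ω. The defining inequality
is open in the angle, so each point has a neighbourhood on which one such estimate applies. -/
theorem exists_mem_openOuterCone {ω : ℝ} (hω : ω < Real.pi / 2) {z : ℂ}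
    (hz : z ∈ openOuterCone ω) : ∃ φ ∈ Set.Ioo ω (Real.pi / 2), z ∈ openOuterCone φ := by
  have h1 : ∀ᶠ φ in 𝓝[>] ω, z ∈ openOuterCone φ := by
    refine mem_nhdsWithin_of_mem_nhds ?_
    have : IsOpen {φ : ℝ | |z.re| * Real.sin φ < |z.im| * Real.cos φ} :=
      isOpen_lt (by fun_prop) (by fun_prop)
    exact this.mem_nhds hz
  obtain ⟨φ, h, h'⟩ := (h1.and (Ioo_mem_nhdsGT hω)).exists
  exact ⟨φ, h', h⟩

theorem outerCone_subset_openOuterCone {ω φ : ℝ} (hω : 0 < ω) (h : ω < φ) (hφ : φ < Real.pi / 2) :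
    outerCone φ ⊆ openOuterCone ω := by
  rintro z ⟨hz0, hz⟩
  have hs : Real.sin ω < Real.sin φ :=
    Real.sin_lt_sin_of_lt_of_le_pi_div_two (by linarith) hφ.le h
  have hc : Real.cos φ < Real.cos ω := Real.cos_lt_cos_of_nonneg_of_le_pi_div_two hω.le hφ.le h
  have hc0 : 0 < Real.cos φ := Real.cos_pos_of_mem_Ioo ⟨by linarith, hφ⟩
  have hs0 : 0 < Real.sin φ := Real.sin_pos_of_pos_of_lt_pi (by linarith) (by linarith)
  rcases eq_or_ne z.im 0 with h0 | h0
  · rw [h0, abs_zero, zero_mul] at hz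
    have h1 : |z.re| ≤ 0 := by
      by_contra hcon
      have := mul_pos (not_le.1 hcon) hs0
      linarith
    have h2 : z.re = 0 := abs_nonpos_iff.1 h1
    exact absurd (Complex.ext h2 h0) hz0
  · have h1 : |z.im| * Real.cos φ < |z.im| * Real.cos ω :=
      mul_lt_mul_of_pos_left hc (abs_pos.2 h0)
    have h2 : |z.re| * Real.sin ω ≤ |z.re| * Real.sin φ :=
      mul_le_mul_of_nonneg_left hs.le (abs_nonneg _)
    change |z.re| * Real.sin ω < |z.im| * Real.cos ω
    linarith

variable (T) in
/-- Resolvent bounds of a bisectorial operator, in terms of real operators. -/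
structure HasSectorialBounds (ω : ℝ) : Prop where
  hasQuadInv : ∀ z ∈ openOuterCone ω, HasQuadInv T z
  bound : ∀ φ ∈ Set.Ioo ω (Real.pi / 2), ∃ C : ℝ, 0 ≤ C ∧ ∀ z ∈ outerCone φ,
    (∀ v, ‖quadInv T z v‖ ≤ C / ‖z‖ ^ 2 * ‖v‖) ∧
      ∀ v, ‖extZero T (quadInv T z v)‖ ≤ C / ‖z‖ * ‖v‖

namespace HasSectorialBounds

variable {ω : ℝ}

theorem norm_resPairing_le (hT : HasSectorialBounds T ω) {φ : ℝ} (hφ : φ ∈ Set.Ioo ω (Real.pi / 2))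
    (l : StrongDual ℝ W) (v : W) :
    ∃ C : ℝ, 0 ≤ C ∧ ∀ z ∈ outerCone φ, ‖resPairing T l v z‖ ≤ C / ‖z‖ := by
  obtain ⟨C, hC, h⟩ := hT.bound φ hφ
  refine ⟨2 * (‖l‖ * C * ‖v‖), by positivity, fun z hz => ?_⟩
  obtain ⟨h1, h2⟩ := h z hz
  have hz0 : 0 < ‖z‖ := norm_pos_iff.2 hz.1
  have e1 : ‖l (quadInv T z v)‖ ≤ ‖l‖ * (C / ‖z‖ ^ 2 * ‖v‖) :=
    (l.le_opNorm _).trans (mul_le_mul_of_nonneg_left (h1 v) (norm_nonneg _))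
  have e2 : ‖l (extZero T (quadInv T z v))‖ ≤ ‖l‖ * (C / ‖z‖ * ‖v‖) :=
    (l.le_opNorm _).trans (mul_le_mul_of_nonneg_left (h2 v) (norm_nonneg _))
  calc ‖resPairing T l v z‖
      ≤ ‖conj z * l (quadInv T z v)‖ + ‖(l (extZero T (quadInv T z v)) : ℂ)‖ :=
        norm_sub_le _ _
    _ = ‖z‖ * ‖l (quadInv T z v)‖ + ‖l (extZero T (quadInv T z v))‖ := by
        rw [norm_mul, RCLike.norm_conj, Complex.norm_real, Complex.norm_real]
    _ ≤ ‖z‖ * (‖l‖ * (C / ‖z‖ ^ 2 * ‖v‖)) + ‖l‖ * (C / ‖z‖ * ‖v‖) := by gcongr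
    _ = 2 * (‖l‖ * C * ‖v‖) / ‖z‖ := by field_simp; ring

/-- In the resolvent identity the vectors a and b depend only on z₀, so the estimate for R_a and R_b
near z₀ makes the difference O(|z - z₀|). -/
theorem continuousAt_resPairing (hT : HasSectorialBounds T ω) (hω : ω < Real.pi / 2)
    (l : StrongDual ℝ W) (v : W) {z₀ : ℂ} (hz₀ : z₀ ∈ openOuterCone ω) :
    ContinuousAt (resPairing T l v) z₀ := by
  obtain ⟨φ, hφ, hz₀φ⟩ := exists_mem_openOuterCone hω hz₀
  have hz0 := (openOuterCone_subset _ hz₀).1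
  set a := z₀.re • quadInv T z₀ v - extZero T (quadInv T z₀ v)
  set b := -z₀.im • quadInv T z₀ v
  obtain ⟨Ca, hCa, ha⟩ := hT.norm_resPairing_le hφ l a
  obtain ⟨Cb, hCb, hb⟩ := hT.norm_resPairing_le hφ l b
  have hev : ∀ᶠ z in 𝓝 z₀, ‖resPairing T l v z - resPairing T l v z₀‖ ≤
      ‖z₀ - z‖ * ((Ca + Cb) / ‖z‖) := by
    filter_upwards [(isOpen_openOuterCone φ).mem_nhds hz₀φ,
      (isOpen_openOuterCone ω).mem_nhds hz₀] with z hz hz'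
    rw [resPairing_sub (hT.hasQuadInv z hz') (hT.hasQuadInv z₀ hz₀), norm_mul]
    refine mul_le_mul_of_nonneg_left ((norm_add_le _ _).trans ?_) (norm_nonneg _)
    rw [norm_mul, Complex.norm_I, one_mul, add_div]
    exact add_le_add (ha z (openOuterCone_subset _ hz)) (hb z (openOuterCone_subset _ hz))
  have hlim : Tendsto (fun z : ℂ => ‖z₀ - z‖ * ((Ca + Cb) / ‖z‖)) (𝓝 z₀) (𝓝 0) := by
    have : ContinuousAt (fun z : ℂ => ‖z₀ - z‖ * ((Ca + Cb) / ‖z‖)) z₀ := by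
      have : ‖z₀‖ ≠ 0 := norm_ne_zero_iff.2 hz0
      fun_prop (disch := assumption)
    simpa using this.tendsto
  rw [ContinuousAt, tendsto_iff_norm_sub_tendsto_zero]
  exact squeeze_zero' (Eventually.of_forall fun _ => norm_nonneg _) hev hlim

/-- By the resolvent identity the difference quotient equals -(R_a(z) + i R_b(z)), which converges
because R_a and R_b are themselves continuous at z₀. -/
theorem differentiableAt_resPairing (hT : HasSectorialBounds T ω) (hω : ω < Real.pi / 2)
    (l : StrongDual ℝ W) (v : W) {z₀ : ℂ} (hz₀ : z₀ ∈ openOuterCone ω) :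
    DifferentiableAt ℂ (resPairing T l v) z₀ := by
  set a := z₀.re • quadInv T z₀ v - extZero T (quadInv T z₀ v) with ha
  set b := -z₀.im • quadInv T z₀ v with hb
  refine HasDerivAt.differentiableAt (f' := -(resPairing T l a z₀ + Complex.I *
    resPairing T l b z₀)) (hasDerivAt_iff_tendsto_slope.2 ?_)
  have hc : ContinuousAt (fun z => -(resPairing T l a z + Complex.I * resPairing T l b z)) z₀ :=
    ((hT.continuousAt_resPairing hω l a hz₀).add
      (continuousAt_const.mul (hT.continuousAt_resPairing hω l b hz₀))).neg
  refine (hc.tendsto.mono_left nhdsWithin_le_nhds).congr' ?_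
  filter_upwards [self_mem_nhdsWithin,
    mem_nhdsWithin_of_mem_nhds ((isOpen_openOuterCone ω).mem_nhds hz₀)] with z hz hz'
  have hne : z - z₀ ≠ 0 := sub_ne_zero.2 hz
  rw [slope_def_field, resPairing_sub (hT.hasQuadInv z hz') (hT.hasQuadInv z₀ hz₀), ← ha, ← hb]
  field_simp
  ring

end HasSectorialBounds

end Resolvent

end CliffordOmega

namespace CliffordOmega

/-! ### Cauchy's theorem and the residue of 1/cosh on horizontal strips. -/

section Strip

open Filter Topology MeasureTheory Complex

theorem exp_neg_abs_le (x : ℝ) : Real.exp (-|x|) ≤ 2 * (1 + x ^ 2)⁻¹ := by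
  have h := Real.quadratic_le_exp_of_nonneg (abs_nonneg x)
  rw [sq_abs] at h
  have h1 : (1 + x ^ 2) / 2 ≤ Real.exp |x| := by linarith [abs_nonneg x]
  calc Real.exp (-|x|) = (Real.exp |x|)⁻¹ := Real.exp_neg _
    _ ≤ ((1 + x ^ 2) / 2)⁻¹ := inv_anti₀ (by positivity) h1
    _ = 2 * (1 + x ^ 2)⁻¹ := by rw [inv_div, div_eq_mul_inv]

theorem integrable_exp_neg_abs : Integrable fun x : ℝ => Real.exp (-|x|) :=
  (integrable_inv_one_add_sq.const_mul 2).mono' (by fun_prop)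
    (Eventually.of_forall fun x => by
      rw [Real.norm_of_nonneg (Real.exp_pos _).le]
      exact exp_neg_abs_le x)

/-- Integrals of a rapidly decreasing holomorphic function over two horizontal lines agree. -/
theorem integral_horizontal_eq {G : ℂ → ℂ} {a b M : ℝ} (hab : a ≤ b)
    (hG : ∀ z : ℂ, z.im ∈ Set.Icc a b → DifferentiableAt ℂ G z)
    (hM : ∀ z : ℂ, z.im ∈ Set.Icc a b → ‖G z‖ ≤ M * Real.exp (-|z.re|)) :
    (∀ y ∈ Set.Icc a b, Integrable fun x : ℝ => G (x + y * I)) ∧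
      ∫ x : ℝ, G (x + a * I) = ∫ x : ℝ, G (x + b * I) := by
  have hint : ∀ y ∈ Set.Icc a b, Integrable fun x : ℝ => G (x + y * I) := by
    intro y hy
    refine (integrable_exp_neg_abs.const_mul M).mono' ?_ (Eventually.of_forall fun x => ?_)
    · refine Continuous.aestronglyMeasurable (continuous_iff_continuousAt.2 fun x => ?_)
      exact ContinuousAt.comp (f := fun x : ℝ => (x + y * I : ℂ))
        (hG (x + y * I) (by simpa using hy)).continuousAt (by fun_prop)
    · simpa using hM (x + y * I) (by simpa using hy)
  refine ⟨hint, ?_⟩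
  have ha := intervalIntegral_tendsto_integral (hint a ⟨le_rfl, hab⟩)
    tendsto_neg_atTop_atBot tendsto_id
  have hb := intervalIntegral_tendsto_integral (hint b ⟨hab, le_rfl⟩)
    tendsto_neg_atTop_atBot tendsto_id
  have hrect : ∀ R : ℝ, (∫ x in -R..R, G (x + a * I)) - (∫ x in -R..R, G (x + b * I)) =
      I • (∫ y in a..b, G ((-R : ℝ) + y * I)) - I • (∫ y in a..b, G (R + y * I)) := by
    -- The rectangle with vertical sides at ±R: its vertical sides vanish as R → ∞ by the
    -- exponential bound.
    intro R
    have h := integral_boundary_rect_eq_zero_of_differentiableOn G ((-R : ℝ) + a * I) (R + b * I)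
      (fun z hz => (hG z (by
        have := hz.2
        simpa [Set.uIcc_of_le hab] using this)).differentiableWithinAt)
    simp only [add_re, ofReal_re, mul_re, I_re, mul_zero, ofReal_im, I_im, mul_one, sub_self,
      add_zero, add_im, mul_im, zero_add] at h
    linear_combination h
  have hside : ∀ s : ℝ → ℝ, (∀ R, |s R| = |R|) →
      Tendsto (fun R : ℝ => I • ∫ y in a..b, G (s R + y * I)) atTop (𝓝 0) := by
    intro s hs
    have hlim : Tendsto (fun R : ℝ => M * Real.exp (-|R|) * |b - a|) atTop (𝓝 0) := by
      have : Tendsto (fun R : ℝ => Real.exp (-|R|)) atTop (𝓝 0) :=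
        Real.tendsto_exp_neg_atTop_nhds_zero.comp tendsto_abs_atTop_atTop
      simpa using (this.const_mul M).mul_const |b - a|
    refine squeeze_zero_norm (fun R => ?_) hlim
    rw [norm_smul, norm_I, one_mul]
    refine intervalIntegral.norm_integral_le_of_norm_le_const fun y hy => ?_
    rw [Set.uIoc_of_le hab] at hy
    have := hM (s R + y * I) (by simpa using ⟨hy.1.le, hy.2⟩)
    simpa [hs] using this
  have hzero := (hside (fun R => -R) fun R => abs_neg R).sub (hside (fun R => R) fun R => rfl)
  rw [sub_zero] at hzero
  have := tendsto_nhds_unique (ha.sub hb) (hzero.congr fun R => (hrect R).symm)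
  exact sub_eq_zero.1 this

theorem norm_cosh_sq (z : ℂ) :
    ‖cosh z‖ ^ 2 = Real.sinh z.re ^ 2 + Real.cos z.im ^ 2 := by
  have h : cosh z = (Real.cosh z.re * Real.cos z.im : ℝ) + (Real.sinh z.re * Real.sin z.im : ℝ) * I
      := by
    conv_lhs => rw [← re_add_im z, cosh_add, cosh_mul_I, sinh_mul_I]
    push_cast
    ring
  rw [h, Complex.sq_norm, normSq_add_mul_I, mul_pow, mul_pow, Real.cosh_sq, Real.sin_sq]
  ring

theorem abs_sinh_le_norm_cosh (z : ℂ) : |Real.sinh z.re| ≤ ‖cosh z‖ := by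
  refine abs_le_of_sq_le_sq ?_ (norm_nonneg _)
  rw [norm_cosh_sq]
  exact le_add_of_nonneg_right (sq_nonneg _)

theorem cos_mul_cosh_le_norm_cosh (z : ℂ) : |Real.cos z.im| * Real.cosh z.re ≤ ‖cosh z‖ := by
  refine le_of_sq_le_sq ?_ (norm_nonneg _)
  rw [norm_cosh_sq, mul_pow, sq_abs, Real.cosh_sq]
  nlinarith [mul_nonneg (sq_nonneg (Real.sinh z.re)) (sq_nonneg (Real.sin z.im)),
    Real.sin_sq_add_cos_sq z.im]

theorem exp_abs_le_two_cosh (x : ℝ) : Real.exp |x| ≤ 2 * Real.cosh x := by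
  rw [← Real.cosh_abs, Real.cosh_eq]
  linarith [Real.exp_pos (-|x|)]

/-- The antiderivative is arctan ∘ sinh. -/
theorem integral_inv_cosh_real : ∫ x : ℝ, (Real.cosh x)⁻¹ = Real.pi := by
  have hint : Integrable fun x : ℝ => (Real.cosh x)⁻¹ := by
    refine (integrable_exp_neg_abs.const_mul 2).mono' (Continuous.aestronglyMeasurable ?_)
      (Eventually.of_forall fun x => ?_)
    · exact Real.continuous_cosh.inv₀ fun x => (Real.cosh_pos x).ne'
    · rw [Real.norm_of_nonneg (inv_nonneg.2 (Real.cosh_pos x).le), Real.exp_neg,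
        inv_le_comm₀ (Real.cosh_pos x) (by positivity), mul_inv, inv_inv]
      linarith [exp_abs_le_two_cosh x]
  have hderiv : ∀ x : ℝ, HasDerivAt (fun x => Real.arctan (Real.sinh x)) (Real.cosh x)⁻¹ x := by
    intro x
    have := (Real.hasDerivAt_sinh x).arctan
    rw [← Real.cosh_sq'] at this
    convert this using 1
    have := (Real.cosh_pos x).ne'
    field_simp
  have htop : Tendsto Real.sinh atTop atTop :=
    tendsto_atTop_mono' _ ((eventually_ge_atTop 0).mono fun x hx => Real.self_le_sinh_iff.2 hx)
      tendsto_id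
  have hbot : Tendsto Real.sinh atBot atBot :=
    tendsto_atBot_mono' _ ((eventually_le_atBot 0).mono fun x hx => Real.sinh_le_self_iff.2 hx)
      tendsto_id
  have := integral_of_hasDerivAt_of_tendsto hderiv hint
    ((tendsto_nhds_of_tendsto_nhdsWithin Real.tendsto_arctan_atBot).comp hbot)
    ((tendsto_nhds_of_tendsto_nhdsWithin Real.tendsto_arctan_atTop).comp htop)
  rw [this]
  ring

theorem norm_inv_cosh_le {y : ℝ} (hy : y < Real.pi / 2) (z : ℂ) (hz : |z.im| ≤ y) :
    cosh z ≠ 0 ∧ ‖(cosh z)⁻¹‖ ≤ 2 / Real.cos y * Real.exp (-|z.re|) := by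
  have hy0 : 0 ≤ y := (abs_nonneg _).trans hz
  have hcy : 0 < Real.cos y := Real.cos_pos_of_mem_Ioo ⟨by linarith [Real.pi_pos], hy⟩
  have h1 : Real.cos y ≤ |Real.cos z.im| := by
    rw [← Real.cos_abs z.im]
    exact (Real.cos_le_cos_of_nonneg_of_le_pi (abs_nonneg _) (by linarith [Real.pi_pos])
      hz).trans (le_abs_self _)
  have h2 : Real.cos y * (Real.exp |z.re| / 2) ≤ ‖cosh z‖ :=
    (mul_le_mul h1 (by linarith [exp_abs_le_two_cosh z.re]) (by positivity)
      (abs_nonneg _)).trans (cos_mul_cosh_le_norm_cosh z)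
  have h3 : 0 < Real.cos y * (Real.exp |z.re| / 2) := by positivity
  refine ⟨norm_pos_iff.1 (h3.trans_le h2), ?_⟩
  rw [norm_inv, Real.exp_neg]
  calc ‖cosh z‖⁻¹ ≤ (Real.cos y * (Real.exp |z.re| / 2))⁻¹ := inv_anti₀ h3 h2
    _ = _ := by field_simp

/-- There is no zero of cosh in |Im z| < π/2, so the line of integration can be shifted to the real
axis. -/
theorem integral_inv_cosh {y : ℝ} (hy0 : 0 ≤ y) (hy : y < Real.pi / 2) :
    (Integrable fun x : ℝ => (cosh (x + y * I))⁻¹) ∧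
    (Integrable fun x : ℝ => (cosh (x + (-y : ℝ) * I))⁻¹) ∧
    ∫ x : ℝ, (cosh (x + y * I))⁻¹ = Real.pi ∧
      ∫ x : ℝ, (cosh (x + (-y : ℝ) * I))⁻¹ = Real.pi := by
  have hd : ∀ z : ℂ, |z.im| ≤ y → DifferentiableAt ℂ (fun z => (cosh z)⁻¹) z := fun z hz =>
    differentiable_cosh.differentiableAt.inv (norm_inv_cosh_le hy z hz).1
  obtain ⟨h1, h2⟩ := integral_horizontal_eq (G := fun z => (cosh z)⁻¹) (a := -y) (b := 0)
    (by linarith) (fun z hz => hd z (abs_le.2 ⟨hz.1, hz.2.trans hy0⟩))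
    (fun z hz => (norm_inv_cosh_le hy z (abs_le.2 ⟨hz.1, hz.2.trans hy0⟩)).2)
  obtain ⟨h3, h4⟩ := integral_horizontal_eq (G := fun z => (cosh z)⁻¹) (a := 0) (b := y)
    hy0 (fun z hz => hd z (abs_le.2 ⟨by linarith [hz.1], hz.2⟩))
    (fun z hz => (norm_inv_cosh_le hy z (abs_le.2 ⟨by linarith [hz.1], hz.2⟩)).2)
  have h5 : ∫ x : ℝ, (cosh (x + (0 : ℝ) * I))⁻¹ = Real.pi := by
    rw [← integral_inv_cosh_real, ← integral_complex_ofReal]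
    simp
  exact ⟨h3 y ⟨hy0, le_rfl⟩, h1 (-y) ⟨le_rfl, by linarith⟩, h4.symm.trans h5, h2.trans h5⟩

theorem cosh_add_pi_sub (x y : ℝ) :
    cosh (x + (Real.pi - y : ℝ) * I) = -cosh (x + (-y : ℝ) * I) := by
  have h : (x + (Real.pi - y : ℝ) * I : ℂ) = (x + (-y : ℝ) * I) + Real.pi * I := by
    push_cast; ring
  rw [h, cosh_add, cosh_mul_I, sinh_mul_I]
  simp

theorem exp_abs_le_four_mul_abs_sinh {x : ℝ} (hx : 1 ≤ |x|) :
    Real.exp |x| ≤ 4 * |Real.sinh x| := by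
  have h1 : |Real.sinh x| = Real.sinh |x| := Real.abs_sinh x
  have h2 : Real.exp (-|x|) ≤ 1 := Real.exp_le_one_iff.2 (by linarith)
  have h3 : 2 ≤ Real.exp |x| := by linarith [Real.add_one_le_exp |x|]
  rw [h1, Real.sinh_eq]
  linarith

theorem cosh_eq_zero_iff_of_im_mem {z : ℂ} (hz : z.im ∈ Set.Ioo 0 Real.pi) :
    cosh z = 0 ↔ z = (Real.pi / 2 : ℝ) * I := by
  constructor
  · intro h
    have h1 := norm_cosh_sq z
    rw [h, norm_zero] at h1
    have h2 : Real.sinh z.re = 0 := by nlinarith [sq_nonneg (Real.sinh z.re)]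
    have h3 : Real.cos z.im = 0 := by nlinarith [sq_nonneg (Real.cos z.im)]
    have h4 : z.im = Real.pi / 2 :=
      Real.injOn_cos ⟨hz.1.le, hz.2.le⟩ ⟨by linarith [Real.pi_pos], by linarith [Real.pi_pos]⟩
        (h3.trans Real.cos_pi_div_two.symm)
    apply Complex.ext <;> simp [Real.sinh_eq_zero.1 h2, h4]
  · rintro rfl
    rw [cosh_mul_I, ← ofReal_cos, Real.cos_pi_div_two, ofReal_zero]

/-- The residue theorem for `K / cosh` on a horizontal strip around `π i / 2`, with `K` bounded. -/
theorem integral_mul_inv_cosh {K : ℂ → ℂ} {φ M : ℝ} (h0 : 0 < φ) (hφ : φ < Real.pi / 2)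
    (hK : ∀ z : ℂ, z.im ∈ Set.Icc φ (Real.pi - φ) → DifferentiableAt ℂ K z)
    (hM : ∀ z : ℂ, z.im ∈ Set.Icc φ (Real.pi - φ) → ‖K z‖ ≤ M) :
    (Integrable fun x : ℝ => K (x + φ * I) * (cosh (x + φ * I))⁻¹) ∧
    (Integrable fun x : ℝ =>
      K (x + (Real.pi - φ : ℝ) * I) * (cosh (x + (Real.pi - φ : ℝ) * I))⁻¹) ∧
    (∫ x : ℝ, K (x + φ * I) * (cosh (x + φ * I))⁻¹) -
      ∫ x : ℝ, K (x + (Real.pi - φ : ℝ) * I) * (cosh (x + (Real.pi - φ : ℝ) * I))⁻¹ =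
      2 * Real.pi * K ((Real.pi / 2 : ℝ) * I) := by
  set c : ℂ := (Real.pi / 2 : ℝ) * I with hc
  have hcim : c.im = Real.pi / 2 := by simp [hc]
  have hcmem : c.im ∈ Set.Ioo φ (Real.pi - φ) := by rw [hcim]; constructor <;> linarith
  have hsub : Set.Icc φ (Real.pi - φ) ⊆ Set.Ioo 0 Real.pi := fun y hy =>
    ⟨h0.trans_le hy.1, by linarith [hy.2]⟩
  have hcc : cosh c = 0 := (cosh_eq_zero_iff_of_im_mem (hsub ⟨hcmem.1.le, hcmem.2.le⟩)).2 hc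
  have hopen : IsOpen {z : ℂ | z.im ∈ Set.Ioo φ (Real.pi - φ)} :=
    isOpen_Ioo.preimage continuous_im
  -- Away from c this is (K - K(c))/cosh. Written as a quotient of divided slopes it is also
  -- holomorphic at c, since c is a simple zero of cosh. Its integrals over the two lines agree, so
  -- only K(c)/cosh contributes a residue.
  set k : ℂ → ℂ := fun z => dslope K c z * (dslope cosh c z)⁻¹ with hk
  have hd1 : ∀ z : ℂ, z.im ∈ Set.Icc φ (Real.pi - φ) → DifferentiableAt ℂ (dslope K c) z := by
    intro z hz
    rcases eq_or_ne z c with rfl | hne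
    · refine ((differentiableOn_dslope (hopen.mem_nhds hcmem)).2 fun w hw => ?_).differentiableAt
        (hopen.mem_nhds hcmem)
      exact (hK w ⟨hw.1.le, hw.2.le⟩).differentiableWithinAt
    · exact (differentiableAt_dslope_of_ne hne).2 (hK z hz)
  have hd2 : Differentiable ℂ (dslope cosh c) := by
    rw [← differentiableOn_univ, differentiableOn_dslope univ_mem]
    exact differentiable_cosh.differentiableOn
  have hne2 : ∀ z : ℂ, z.im ∈ Set.Icc φ (Real.pi - φ) → dslope cosh c z ≠ 0 := by
    intro z hz
    rcases eq_or_ne z c with rfl | hne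
    · rw [dslope_same, Complex.deriv_cosh, hc, sinh_mul_I, ← ofReal_sin, Real.sin_pi_div_two]
      simp
    · rw [dslope_of_ne _ hne, slope_def_field, hcc, sub_zero]
      exact div_ne_zero (mt (cosh_eq_zero_iff_of_im_mem (hsub hz)).1 hne) (sub_ne_zero.2 hne)
  have hkd : ∀ z : ℂ, z.im ∈ Set.Icc φ (Real.pi - φ) → DifferentiableAt ℂ k z := fun z hz =>
    (hd1 z hz).mul (hd2.differentiableAt.inv (hne2 z hz))
  have hkeq : ∀ z : ℂ, z ≠ c → k z = K z * (cosh z)⁻¹ - K c * (cosh z)⁻¹ := by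
    intro z hz
    have : z - c ≠ 0 := sub_ne_zero.2 hz
    rw [hk]
    simp only [dslope_of_ne _ hz, slope_def_field, hcc, sub_zero]
    rw [inv_div, ← sub_mul, div_mul_div_cancel₀ this, div_eq_mul_inv]
  obtain ⟨M₁, hM₁⟩ : ∃ M₁, ∀ z ∈ Set.Icc (-1 : ℝ) 1 ×ℂ Set.Icc φ (Real.pi - φ), ‖k z‖ ≤ M₁ :=
    (isCompact_Icc.reProdIm isCompact_Icc).exists_bound_of_continuousOn fun z hz =>
      (hkd z hz.2).continuousAt.continuousWithinAt
  have hM0 : 0 ≤ M := (norm_nonneg _).trans (hM c ⟨hcmem.1.le, hcmem.2.le⟩)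
  -- Near the pole the bound comes from compactness, and e absorbs the factor exp(-|Re z|) for |Re
  -- z| ≤ 1. In the tails |K - K(c)| ≤ 2M and |1/cosh| ≤ 4 exp(-|Re z|), hence 8M.
  have hbound : ∀ z : ℂ, z.im ∈ Set.Icc φ (Real.pi - φ) →
      ‖k z‖ ≤ (|M₁| * Real.exp 1 + 8 * M) * Real.exp (-|z.re|) := by
    intro z hz
    rw [add_mul]
    rcases le_total |z.re| 1 with h1 | h1
    · have h2 : ‖k z‖ ≤ |M₁| := (hM₁ z ⟨abs_le.1 h1, hz⟩).trans (le_abs_self _)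
      have h3 : 1 ≤ Real.exp 1 * Real.exp (-|z.re|) := by
        rw [← Real.exp_add]
        exact Real.one_le_exp (by linarith)
      have h4 := mul_le_mul_of_nonneg_left h3 (abs_nonneg M₁)
      have h5 : 0 ≤ 8 * M * Real.exp (-|z.re|) := by positivity
      linarith
    · have hzc : z ≠ c := by
        rintro rfl
        simp [hc] at h1
        linarith
      have h2 : ‖(cosh z)⁻¹‖ ≤ 4 * Real.exp (-|z.re|) := by
        have h3 := exp_abs_le_four_mul_abs_sinh h1
        have h4 := abs_sinh_le_norm_cosh z
        have h5 : 0 < Real.exp |z.re| / 4 := by positivity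
        rw [norm_inv, Real.exp_neg]
        calc ‖cosh z‖⁻¹ ≤ (Real.exp |z.re| / 4)⁻¹ := inv_anti₀ h5 (by linarith)
          _ = _ := by rw [inv_div, div_eq_mul_inv]
      rw [hkeq z hzc, ← sub_mul, norm_mul]
      have h6 : ‖K z - K c‖ ≤ 2 * M := (norm_sub_le _ _).trans
        (by linarith [hM z hz, hM c ⟨hcmem.1.le, hcmem.2.le⟩])
      have h7 := mul_le_mul h6 h2 (norm_nonneg _) (by positivity)
      have h8 : 0 ≤ |M₁| * Real.exp 1 * Real.exp (-|z.re|) := by positivity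
      linarith
  have hle : φ ≤ Real.pi - φ := by linarith
  obtain ⟨hki, hke⟩ := integral_horizontal_eq hle hkd hbound
  obtain ⟨hi1, hi2, he1, he2⟩ := integral_inv_cosh h0.le hφ
  have hline : ∀ y : ℝ, y ≠ Real.pi / 2 → ∀ x : ℝ, (x + y * I : ℂ) ≠ c := by
    intro y hy x h
    apply hy
    have := congrArg im h
    rw [hcim] at this
    simpa using this
  have hl1 := hline φ hφ.ne
  have hl2 := hline (Real.pi - φ) (by intro h; linarith)
  have hK1 : ∀ x : ℝ, K (x + φ * I) * (cosh (x + φ * I))⁻¹ =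
      k (x + φ * I) + K c * (cosh (x + φ * I))⁻¹ := fun x => by rw [hkeq _ (hl1 x)]; ring
  have hK2 : ∀ x : ℝ, K (x + (Real.pi - φ : ℝ) * I) * (cosh (x + (Real.pi - φ : ℝ) * I))⁻¹ =
      k (x + (Real.pi - φ : ℝ) * I) - K c * (cosh (x + (-φ : ℝ) * I))⁻¹ := fun x => by
    rw [hkeq _ (hl2 x), cosh_add_pi_sub, inv_neg]; ring
  simp only [hK1, hK2]
  have hk1 := hki φ ⟨le_rfl, hle⟩
  have hk2 := hki _ ⟨hle, le_rfl⟩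
  refine ⟨hk1.add (hi1.const_mul _), hk2.sub (hi2.const_mul _), ?_⟩
  -- The lower line gives π K(c) and the upper one -π K(c), because cosh changes sign under
  -- translation by iπ.
  rw [integral_add hk1 (hi1.const_mul _), integral_sub hk2 (hi2.const_mul _),
    integral_const_mul, integral_const_mul, he1, he2, hke]
  ring

end Strip

end CliffordOmega

namespace CliffordOmega

open Polynomial

/-! ### Growth of polynomials on closed sets, and the exponential map from strips to sectors. -/

section Cone

open Filter Topology

theorem isClosed_compl_openOuterCone (φ : ℝ) : IsClosed (openOuterCone φ)ᶜ :=
  (isOpen_openOuterCone φ).isClosed_compl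

/-- Each factor is treated alone. If δ is a radius of a ball around a missing S, then |z - a| ≥ δ
and |z| ≤ |z - a| + |a| combine to bound |z - a| below by a multiple of 1 + |z|, including for large
z. -/
theorem exists_le_norm_prod_sub {S : Set ℂ} (hS : IsClosed S) (s : Multiset ℂ)
    (hs : ∀ a ∈ s, a ∉ S) :
    ∃ c : ℝ, 0 < c ∧ ∀ z ∈ S, c * (1 + ‖z‖) ^ s.card ≤ ‖(s.map fun a => z - a).prod‖ := by
  induction s using Multiset.induction_on with
  | empty => exact ⟨1, one_pos, fun z _ => by simp⟩
  | cons a s ih =>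
    obtain ⟨c, hc, h⟩ := ih fun b hb => hs b (Multiset.mem_cons_of_mem hb)
    obtain ⟨δ, hδ, hball⟩ :=
      Metric.isOpen_iff.1 hS.isOpen_compl a (hs a (Multiset.mem_cons_self _ _))
    refine ⟨δ / (1 + ‖a‖ + δ) * c, by positivity, fun z hz => ?_⟩
    have h1 : δ ≤ ‖z - a‖ := by
      by_contra hlt
      exact hball (mem_ball_iff_norm.2 (not_le.1 hlt)) hz
    have h2 : δ / (1 + ‖a‖ + δ) * (1 + ‖z‖) ≤ ‖z - a‖ := by
      have h3 : ‖z‖ ≤ ‖z - a‖ + ‖a‖ := by simpa using norm_add_le (z - a) a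
      have h4 : 0 < 1 + ‖a‖ + δ := by positivity
      rw [div_mul_eq_mul_div, div_le_iff₀ h4]
      nlinarith [norm_nonneg a]
    rw [Multiset.map_cons, Multiset.prod_cons, norm_mul, Multiset.card_cons, pow_succ]
    calc δ / (1 + ‖a‖ + δ) * c * ((1 + ‖z‖) ^ s.card * (1 + ‖z‖))
        = (δ / (1 + ‖a‖ + δ) * (1 + ‖z‖)) * (c * (1 + ‖z‖) ^ s.card) := by ring
      _ ≤ _ := mul_le_mul h2 (h z hz) (by positivity) (norm_nonneg _)

/-- A polynomial without zeros on a closed set grows there like its leading term. -/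
theorem exists_le_norm_eval {S : Set ℂ} (hS : IsClosed S) {q : ℂ[X]} (hq0 : q ≠ 0)
    (hq : ∀ z ∈ S, q.eval z ≠ 0) :
    ∃ c : ℝ, 0 < c ∧ ∀ z ∈ S, c * (1 + ‖z‖) ^ q.natDegree ≤ ‖q.eval z‖ := by
  have hsp := IsAlgClosed.splits q
  obtain ⟨c, hc, h⟩ := exists_le_norm_prod_sub hS q.roots fun a ha haS =>
    hq a haS (isRoot_of_mem_roots ha)
  have hl : 0 < ‖q.leadingCoeff‖ := norm_pos_iff.2 (leadingCoeff_ne_zero.2 hq0)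
  refine ⟨‖q.leadingCoeff‖ * c, by positivity, fun z hz => ?_⟩
  have h1 := h z hz
  rw [← hsp.natDegree_eq_card_roots] at h1
  have h2 : q.eval z = q.leadingCoeff * (q.roots.map fun a => z - a).prod := by
    conv_lhs => rw [hsp.eq_prod_roots]
    simp [eval_multiset_prod]
  rw [h2, norm_mul, mul_assoc]
  exact mul_le_mul_of_nonneg_left h1 hl.le

theorem exists_norm_eval_le (p : ℂ[X]) {N : ℕ} (hp : p.natDegree ≤ N) :
    ∃ C : ℝ, 0 ≤ C ∧ ∀ z : ℂ, ‖p.eval z‖ ≤ C * (1 + ‖z‖) ^ N := by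
  refine ⟨∑ k ∈ Finset.range (N + 1), ‖p.coeff k‖, by positivity, fun z => ?_⟩
  rw [eval_eq_sum_range' (Nat.lt_succ_of_le hp), Finset.sum_mul]
  refine (norm_sum_le _ _).trans (Finset.sum_le_sum fun k hk => ?_)
  rw [norm_mul, norm_pow]
  refine mul_le_mul_of_nonneg_left ?_ (norm_nonneg _)
  rw [Finset.mem_range] at hk
  calc ‖z‖ ^ k ≤ (1 + ‖z‖) ^ k := by gcongr; linarith
    _ ≤ (1 + ‖z‖) ^ N := pow_le_pow_right₀ (by linarith [norm_nonneg z]) (by omega)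

theorem exists_norm_div_le {S : Set ℂ} (hS : IsClosed S) {p q : ℂ[X]} (hq0 : q ≠ 0)
    (hq : ∀ z ∈ S, q.eval z ≠ 0) (hpq : p.natDegree ≤ q.natDegree) :
    ∃ C : ℝ, 0 ≤ C ∧ ∀ z ∈ S, ‖p.eval z / q.eval z‖ ≤ C := by
  obtain ⟨c, hc, h⟩ := exists_le_norm_eval hS hq0 hq
  obtain ⟨C, hC, h'⟩ := exists_norm_eval_le p hpq
  refine ⟨C / c, by positivity, fun z hz => ?_⟩
  rw [norm_div, div_le_div_iff₀ (norm_pos_iff.2 (hq z hz)) hc]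
  calc ‖p.eval z‖ * c ≤ C * (1 + ‖z‖) ^ q.natDegree * c := by gcongr; exact h' z
    _ = C * (c * (1 + ‖z‖) ^ q.natDegree) := by ring
    _ ≤ C * ‖q.eval z‖ := by gcongr; exact h z hz

theorem neg_mem_outerCone {φ : ℝ} {z : ℂ} (hz : z ∈ outerCone φ) : -z ∈ outerCone φ :=
  ⟨neg_ne_zero.2 hz.1, by simpa using hz.2⟩

theorem neg_mem_openOuterCone_iff {φ : ℝ} {z : ℂ} :
    -z ∈ openOuterCone φ ↔ z ∈ openOuterCone φ := by
  simp [openOuterCone]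

/-- The cone inequality for e^z is nonnegativity of sin(Im z - φ) and sin(Im z + φ), one for each
sign of cos(Im z). -/
theorem exp_mem_outerCone {φ : ℝ} {z : ℂ} (h0 : 0 ≤ φ) (hφ : φ ≤ Real.pi / 2)
    (hz : z.im ∈ Set.Icc φ (Real.pi - φ)) : Complex.exp z ∈ outerCone φ := by
  refine ⟨Complex.exp_ne_zero z, ?_⟩
  have h1 : 0 ≤ Real.sin (z.im - φ) :=
    Real.sin_nonneg_of_nonneg_of_le_pi (by linarith [hz.1]) (by linarith [hz.2])
  have h2 : 0 ≤ Real.sin (z.im + φ) :=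
    Real.sin_nonneg_of_nonneg_of_le_pi (by linarith [hz.1]) (by linarith [hz.2])
  rw [Real.sin_sub] at h1
  rw [Real.sin_add] at h2
  rw [Complex.exp_re, Complex.exp_im, abs_mul, abs_mul, mul_assoc, mul_assoc]
  refine mul_le_mul_of_nonneg_left ?_ (abs_nonneg _)
  have h3 : Real.sin z.im * Real.cos φ ≤ |Real.sin z.im| * Real.cos φ :=
    mul_le_mul_of_nonneg_right (le_abs_self _)
      (Real.cos_nonneg_of_neg_pi_div_two_le_of_le (by linarith [Real.pi_pos]) hφ)
  rcases abs_cases (Real.cos z.im) with ⟨h, -⟩ | ⟨h, -⟩ <;> rw [h] <;> linarith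

theorem exp_notMem_openOuterCone {φ : ℝ} {z : ℂ} (hφ : φ ≤ Real.pi / 2)
    (hz : z.im ∈ Set.Icc (-φ) φ) : Complex.exp z ∉ openOuterCone φ := by
  intro h
  have h1 : 0 ≤ Real.sin (φ - z.im) :=
    Real.sin_nonneg_of_nonneg_of_le_pi (by linarith [hz.2]) (by linarith [hz.1])
  have h2 : 0 ≤ Real.sin (φ + z.im) :=
    Real.sin_nonneg_of_nonneg_of_le_pi (by linarith [hz.1]) (by linarith [hz.2])
  rw [Real.sin_sub] at h1
  rw [Real.sin_add] at h2
  change |(Complex.exp z).re| * _ < |(Complex.exp z).im| * _ at h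
  rw [Complex.exp_re, Complex.exp_im, abs_mul, abs_mul, mul_assoc, mul_assoc] at h
  have h4 := lt_of_mul_lt_mul_left h (abs_nonneg _)
  have hs : 0 ≤ Real.sin φ := Real.sin_nonneg_of_nonneg_of_le_pi (by linarith [hz.1, hz.2])
    (by linarith [hz.1, hz.2, Real.pi_pos])
  have h3 : Real.cos z.im * Real.sin φ ≤ |Real.cos z.im| * Real.sin φ :=
    mul_le_mul_of_nonneg_right (le_abs_self _) hs
  rcases abs_cases (Real.sin z.im) with ⟨h, -⟩ | ⟨h, -⟩ <;> rw [h] at h4 <;> linarith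

end Cone

/-! ### Contour integrals over the boundary of the double sector. -/

section Contour

open Filter Topology MeasureTheory Complex

/-- The integral of `g` along the ray of angle `y`, in logarithmic coordinates. -/
noncomputable def rayInt (y : ℝ) (g : ℂ → ℂ) : ℂ :=
  ∫ x : ℝ, exp (x + y * I) * g (exp (x + y * I))

/-- Integrability of `g` along the ray of angle `y`, in logarithmic coordinates. -/
def RayIntegrable (y : ℝ) (g : ℂ → ℂ) : Prop :=
  Integrable fun x : ℝ => exp (x + y * I) * g (exp (x + y * I))

/-- The regularizer `s / (s² + 1)`. -/
noncomputable def reg (s : ℂ) : ℂ := s / (s ^ 2 + 1)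

theorem reg_neg (s : ℂ) : reg (-s) = -reg s := by
  simp [reg, neg_div]

/-- In logarithmic coordinates the regularizer supplies exponential decay at both ends of a ray, and
its pole at i becomes the zero πi/2 of cosh. -/
theorem reg_exp (z : ℂ) : reg (exp z) = (2 * cosh z)⁻¹ := by
  have h := exp_ne_zero z
  rw [reg, two_cosh, exp_neg, ← inv_div]
  congr 1
  field_simp

theorem rayInt_congr {y : ℝ} {g h : ℂ → ℂ}
    (H : ∀ x : ℝ, g (exp (x + y * I)) = h (exp (x + y * I))) : rayInt y g = rayInt y h := by
  simp only [rayInt, H]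

theorem rayInt_add {y : ℝ} {g h : ℂ → ℂ} (hg : RayIntegrable y g) (hh : RayIntegrable y h) :
    rayInt y (fun s => g s + h s) = rayInt y g + rayInt y h := by
  simp only [rayInt, mul_add]
  exact integral_add hg hh

theorem exp_neg_angle (x φ : ℝ) :
    exp (x + (-φ : ℝ) * I) = -exp (x + (Real.pi - φ : ℝ) * I) := by
  have h : (x + (Real.pi - φ : ℝ) * I : ℂ) = (x + (-φ : ℝ) * I) + Real.pi * I := by
    push_cast; ring
  rw [h, exp_add (x + (-φ : ℝ) * I), exp_pi_mul_I]
  ring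

/-- The rays of angles -φ and π - φ are opposite. This regroups the four boundary rays from the
pairs bounding the two inner sectors to the pairs bounding the upper and lower outer sectors. -/
theorem rayInt_neg_angle (φ : ℝ) (g : ℂ → ℂ) :
    rayInt (-φ) g = -rayInt (Real.pi - φ) fun s => g (-s) := by
  simp only [rayInt, exp_neg_angle, neg_mul]
  exact integral_neg _

theorem rayIntegrable_neg_angle (φ : ℝ) (g : ℂ → ℂ) :
    RayIntegrable (-φ) g ↔ RayIntegrable (Real.pi - φ) fun s => g (-s) := by
  simp only [RayIntegrable, exp_neg_angle, neg_mul]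
  exact integrable_neg_iff

/-- Cauchy's theorem inside a sector. -/
theorem rayInt_reg_mul_eq {m : ℂ → ℂ} {φ C : ℝ} (h0 : 0 ≤ φ) (hφ : φ < Real.pi / 2)
    (hm : ∀ s, s ∉ openOuterCone φ → DifferentiableAt ℂ m s)
    (hC : ∀ s, s ∉ openOuterCone φ → ‖s * m s‖ ≤ C) :
    RayIntegrable φ (fun s => reg s * m s) ∧ RayIntegrable (-φ) (fun s => reg s * m s) ∧
      rayInt (-φ) (fun s => reg s * m s) = rayInt φ fun s => reg s * m s := by
  have hin : ∀ z : ℂ, z.im ∈ Set.Icc (-φ) φ → exp z ∉ openOuterCone φ := fun z hz =>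
    exp_notMem_openOuterCone hφ.le hz
  have hexp : ∀ z : ℂ, exp z * (reg (exp z) * m (exp z)) =
      (exp z * m (exp z)) * (2 * cosh z)⁻¹ := fun z => by rw [reg_exp]; ring
  obtain ⟨hi, he⟩ := integral_horizontal_eq (a := -φ) (b := φ) (M := C * (1 / Real.cos φ))
    (G := fun z => exp z * (reg (exp z) * m (exp z))) (by linarith)
    (fun z hz => by
      simp only [hexp]
      have h1 : DifferentiableAt ℂ (fun z => m (exp z)) z :=
        (hm _ (hin z hz)).comp z differentiable_exp.differentiableAt
      have h2 : 2 * cosh z ≠ 0 :=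
        mul_ne_zero two_ne_zero (norm_inv_cosh_le hφ z (abs_le.2 hz)).1
      exact (differentiable_exp.differentiableAt.mul h1).mul
        ((differentiable_cosh.differentiableAt.const_mul 2).inv h2))
    (fun z hz => by
      rw [hexp, norm_mul (exp z * m (exp z)), mul_inv, norm_mul (2 : ℂ)⁻¹, mul_assoc C]
      refine mul_le_mul (hC _ (hin z hz)) ?_ (by positivity)
        ((norm_nonneg _).trans (hC _ (hin z hz)))
      have h3 := (norm_inv_cosh_le hφ z (abs_le.2 hz)).2
      have h4 : ‖(2 : ℂ)⁻¹‖ = 1 / 2 := by simp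
      rw [h4]
      calc 1 / 2 * ‖(cosh z)⁻¹‖ ≤ 1 / 2 * (2 / Real.cos φ * Real.exp (-|z.re|)) := by gcongr
        _ = _ := by ring)
  exact ⟨hi φ ⟨by linarith, le_rfl⟩, hi (-φ) ⟨le_rfl, by linarith⟩, he⟩

/-- The residue theorem outside the double sector. -/
theorem rayInt_reg_mul_sub {m : ℂ → ℂ} {φ C : ℝ} (h0 : 0 < φ) (hφ : φ < Real.pi / 2)
    (hm : ∀ s ∈ outerCone φ, DifferentiableAt ℂ m s)
    (hC : ∀ s ∈ outerCone φ, ‖s * m s‖ ≤ C) :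
    RayIntegrable φ (fun s => reg s * m s) ∧
      RayIntegrable (Real.pi - φ) (fun s => reg s * m s) ∧
      rayInt φ (fun s => reg s * m s) - rayInt (Real.pi - φ) (fun s => reg s * m s) =
        Real.pi * (I * m I) := by
  have hin : ∀ z : ℂ, z.im ∈ Set.Icc φ (Real.pi - φ) → exp z ∈ outerCone φ := fun z hz =>
    exp_mem_outerCone h0.le hφ.le hz
  have hexp : ∀ z : ℂ, exp z * (reg (exp z) * m (exp z)) =
      2⁻¹ * ((exp z * m (exp z)) * (cosh z)⁻¹) := fun z => by rw [reg_exp]; ring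
  obtain ⟨h1, h2, h3⟩ := integral_mul_inv_cosh (K := fun z => exp z * m (exp z)) h0 hφ
    (fun z hz => differentiable_exp.differentiableAt.mul
      ((hm _ (hin z hz)).comp z differentiable_exp.differentiableAt))
    (fun z hz => hC _ (hin z hz))
  refine ⟨?_, ?_, ?_⟩
  · simp only [RayIntegrable, hexp]
    exact h1.const_mul _
  · simp only [RayIntegrable, hexp]
    exact h2.const_mul _
  · simp only [rayInt, hexp]
    rw [integral_const_mul, integral_const_mul, ← mul_sub, h3]
    have : exp ((Real.pi / 2 : ℝ) * I) = I := by
      push_cast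
      exact exp_pi_div_two_mul_I
    rw [this]
    ring

/-- The integral of `g` over the boundary of the double sector of angle `φ`, divided by `i`. -/
noncomputable def boundaryInt (φ : ℝ) (g : ℂ → ℂ) : ℂ :=
  (rayInt (-φ) g - rayInt φ g - (rayInt (-φ) (fun s => g (-s)) - rayInt φ fun s => g (-s))) / I

/-- Integrability of `g` over the boundary of the double sector of angle `φ`. -/
def BoundaryIntegrable (φ : ℝ) (g : ℂ → ℂ) : Prop :=
  RayIntegrable φ g ∧ RayIntegrable (-φ) g ∧
    RayIntegrable φ (fun s => g (-s)) ∧ RayIntegrable (-φ) fun s => g (-s)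

theorem boundaryInt_add {φ : ℝ} {g h : ℂ → ℂ} (hg : BoundaryIntegrable φ g)
    (hh : BoundaryIntegrable φ h) :
    boundaryInt φ (fun s => g s + h s) = boundaryInt φ g + boundaryInt φ h := by
  rw [boundaryInt, rayInt_add hg.1 hh.1, rayInt_add hg.2.1 hh.2.1, rayInt_add hg.2.2.1 hh.2.2.1,
    rayInt_add hg.2.2.2 hh.2.2.2, boundaryInt, boundaryInt]
  ring

theorem exp_mem_outerCone_neg {φ : ℝ} (h0 : 0 ≤ φ) (hφ : φ ≤ Real.pi / 2) (x : ℝ) :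
    exp (x + (-φ : ℝ) * I) ∈ outerCone φ := by
  rw [exp_neg_angle]
  exact neg_mem_outerCone (exp_mem_outerCone h0 hφ (by simp; linarith))

theorem exp_mem_outerCone_self {φ : ℝ} (h0 : 0 ≤ φ) (hφ : φ ≤ Real.pi / 2) (x : ℝ) :
    exp (x + φ * I) ∈ outerCone φ :=
  exp_mem_outerCone h0 hφ (by simp; linarith)

/-- Agreement on the rays themselves is all that can be asked: there both the resolvent is defined
and q has no zero, whereas on either side only one of the two is known. -/
theorem boundaryInt_congr {φ : ℝ} (h0 : 0 ≤ φ) (hφ : φ ≤ Real.pi / 2) {g h : ℂ → ℂ}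
    (H : ∀ s ∈ outerCone φ, s ∉ openOuterCone φ → g s = h s) :
    boundaryInt φ g = boundaryInt φ h := by
  have h1 : ∀ x : ℝ, exp (x + φ * I) ∉ openOuterCone φ := fun x =>
    exp_notMem_openOuterCone hφ (by simp; linarith)
  have h2 : ∀ x : ℝ, exp (x + (-φ : ℝ) * I) ∉ openOuterCone φ := fun x =>
    exp_notMem_openOuterCone hφ (by simp; linarith)
  have h3 := exp_mem_outerCone_self h0 hφ
  have h4 := exp_mem_outerCone_neg h0 hφ
  rw [boundaryInt, boundaryInt, rayInt_congr (y := φ) fun x => H _ (h3 x) (h1 x),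
    rayInt_congr (y := -φ) fun x => H _ (h4 x) (h2 x),
    rayInt_congr (y := φ) (g := fun s => g (-s)) (h := fun s => h (-s)) fun x =>
      H _ (neg_mem_outerCone (h3 x)) (mt neg_mem_openOuterCone_iff.1 (h1 x)),
    rayInt_congr (y := -φ) (g := fun s => g (-s)) (h := fun s => h (-s)) fun x =>
      H _ (neg_mem_outerCone (h4 x)) (mt neg_mem_openOuterCone_iff.1 (h2 x))]

/-- Cauchy's theorem in the right sector, applied to m and to s ↦ -m(-s). The latter covers the left
sector because `reg` is odd. -/
theorem boundaryInt_reg_mul_eq_zero {m : ℂ → ℂ} {φ C : ℝ} (h0 : 0 ≤ φ) (hφ : φ < Real.pi / 2)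
    (hm : ∀ s, s ∉ openOuterCone φ → DifferentiableAt ℂ m s)
    (hC : ∀ s, s ∉ openOuterCone φ → ‖s * m s‖ ≤ C) :
    BoundaryIntegrable φ (fun s => reg s * m s) ∧ boundaryInt φ (fun s => reg s * m s) = 0 := by
  obtain ⟨h1, h2, h3⟩ := rayInt_reg_mul_eq h0 hφ hm hC
  obtain ⟨h4, h5, h6⟩ := rayInt_reg_mul_eq (m := fun s => -m (-s)) (C := C) h0 hφ
    (fun s hs => (((hm (-s) (mt neg_mem_openOuterCone_iff.1 hs)).comp s
      differentiable_neg.differentiableAt).neg))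
    (fun s hs => by simpa using hC (-s) (mt neg_mem_openOuterCone_iff.1 hs))
  have hneg : (fun s => reg (-s) * m (-s)) = fun s => reg s * -m (-s) := by
    ext s; rw [reg_neg]; ring
  rw [BoundaryIntegrable, boundaryInt, hneg]
  refine ⟨⟨h1, h2, h4, h5⟩, ?_⟩
  rw [h3, h6]
  simp

/-- Deformation outwards: `reg` has residue 1/2 at i and at -i, and the reflection s ↦ -s carries
the lower outer sector to the upper one. The sign reflects that the outer sectors lie on the other
side of the contour. -/
theorem boundaryInt_reg_mul {m : ℂ → ℂ} {φ C : ℝ} (h0 : 0 < φ) (hφ : φ < Real.pi / 2)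
    (hm : ∀ s ∈ outerCone φ, DifferentiableAt ℂ m s)
    (hC : ∀ s ∈ outerCone φ, ‖s * m s‖ ≤ C) :
    BoundaryIntegrable φ (fun s => reg s * m s) ∧
      boundaryInt φ (fun s => reg s * m s) = -Real.pi * (m I + m (-I)) := by
  obtain ⟨h1, h2, h3⟩ := rayInt_reg_mul_sub h0 hφ hm hC
  obtain ⟨h4, h5, h6⟩ := rayInt_reg_mul_sub (m := fun s => -m (-s)) (C := C) h0 hφ
    (fun s hs => (((hm (-s) (neg_mem_outerCone hs)).comp s
      differentiable_neg.differentiableAt).neg))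
    (fun s hs => by simpa using hC (-s) (neg_mem_outerCone hs))
  have hneg : (fun s => reg (-s) * m (-s)) = fun s => reg s * -m (-s) := by
    ext s; rw [reg_neg]; ring
  rw [BoundaryIntegrable, boundaryInt, rayInt_neg_angle, rayInt_neg_angle, rayIntegrable_neg_angle,
    rayIntegrable_neg_angle]
  simp only [neg_neg]
  rw [hneg]
  refine ⟨⟨h1, h5, h4, h2⟩, ?_⟩
  rw [div_eq_iff I_ne_zero]
  linear_combination -h3 + h6

end Contour

end CliffordOmega

namespace CliffordOmega

open Polynomial

/-! ### The polynomial identity for the resolvent and the scalar form of the theorem. -/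

section Bezout

variable {W : Type*} [NormedAddCommGroup W] [NormedSpace ℝ W] {T : W →ₗ.[ℝ] W}

theorem resPairing_zero (l : StrongDual ℝ W) (z : ℂ) : resPairing T l 0 z = 0 := by
  have := iterate_extZero_zero T 1
  simp only [Function.iterate_one] at this
  simp [resPairing, this]

theorem resPairing_sum {ι : Type*} {z : ℂ} (h : HasQuadInv T z) (l : StrongDual ℝ W)
    (s : Finset ι) (f : ι → W) :
    resPairing T l (∑ i ∈ s, f i) z = ∑ i ∈ s, resPairing T l (f i) z := by
  classical
  induction s using Finset.induction_on with
  | empty => simpa using resPairing_zero l z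
  | insert i s hi ih => rw [Finset.sum_insert hi, Finset.sum_insert hi, resPairing_add h, ih]

theorem resPairing_polyAct {z : ℂ} (h : HasQuadInv T z) (l : StrongDual ℝ W) (w : W) {p : ℝ[X]}
    {N : ℕ} (hp : p.natDegree ≤ N) :
    resPairing T l (polyAct T w p) z =
      ∑ k ∈ Finset.range (N + 1), (p.coeff k : ℂ) * resPairing T l ((extZero T)^[k] w) z := by
  rw [polyAct_eq_sum T w hp, resPairing_sum h]
  exact Finset.sum_congr rfl fun k _ => resPairing_smul h l _ _

/-- Each exchange of T for z costs a polynomial term -l(T ^ k w) z ^ j, by (z - T)⁻¹ T = z (z - T)⁻¹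
- 1. The polynomial D does not depend on z, and its degree stays below k. -/
theorem exists_resPairing_iterate (l : StrongDual ℝ W) {w : W} {j k : ℕ} (hjk : j ≤ k)
    (hw : w ∈ (opPow T k).domain) :
    ∃ D ∈ degreeLT ℂ k, ∀ z, HasQuadInv T z →
      z ^ j * resPairing T l ((extZero T)^[k] w) z =
        z ^ k * resPairing T l ((extZero T)^[j] w) z + D.eval z := by
  induction k, hjk using Nat.le_induction with
  | base => exact ⟨0, Submodule.zero_mem _, fun z _ => by simp⟩
  | succ k hjk ih =>
    obtain ⟨h1, h2⟩ := (mem_domain_opPow_succ T).1 hw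
    obtain ⟨D, hD, h⟩ := ih h1
    refine ⟨X * D - C (l ((extZero T)^[k] w) : ℂ) * X ^ j, ?_, fun z hz => ?_⟩
    · rw [mem_degreeLT] at hD ⊢
      refine (degree_sub_le _ _).trans_lt (max_lt ?_ ?_)
      · rcases eq_or_ne D 0 with rfl | hD0
        · simp
        · rw [← natDegree_lt_iff_degree_lt hD0] at hD
          rw [← natDegree_lt_iff_degree_lt (mul_ne_zero X_ne_zero hD0), natDegree_X_mul hD0]
          omega
      · refine (degree_C_mul_X_pow_le _ _).trans_lt ?_
        exact_mod_cast Nat.lt_succ_of_le hjk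
    · rw [Function.iterate_succ_apply', resPairing_extZero hz l h2]
      have := h z hz
      simp only [eval_sub, eval_mul, eval_X, eval_C, eval_pow]
      linear_combination z * this

/-- Bilinear extension of the monomial case. The degree of D stays below N, rather than 2N, because
each pair of monomials is exchanged only in the difference of their exponents. -/
theorem exists_resPairing_polyAct (l : StrongDual ℝ W) {w : W} {N : ℕ}
    (hw : w ∈ (opPow T N).domain) {p q : ℝ[X]} (hp : p.natDegree ≤ N) (hq : q.natDegree ≤ N) :
    ∃ D ∈ degreeLT ℂ N, ∀ z, HasQuadInv T z →
      aeval z p * resPairing T l (polyAct T w q) z =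
        aeval z q * resPairing T l (polyAct T w p) z + D.eval z := by
  have key : ∀ j k : ℕ, ∃ D ∈ degreeLT ℂ N, j ≤ N → k ≤ N → ∀ z, HasQuadInv T z →
      z ^ j * resPairing T l ((extZero T)^[k] w) z =
        z ^ k * resPairing T l ((extZero T)^[j] w) z + D.eval z := by
    intro j k
    by_cases hjk : j ≤ N ∧ k ≤ N
    swap
    · exact ⟨0, Submodule.zero_mem _, fun h1 h2 => absurd ⟨h1, h2⟩ hjk⟩
    obtain ⟨hj, hk⟩ := hjk
    rcases le_total j k with h | h
    · obtain ⟨D, hD, e⟩ := exists_resPairing_iterate l h (mem_domain_opPow_of_le hk hw)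
      exact ⟨D, degreeLT_mono hk hD, fun _ _ => e⟩
    · obtain ⟨D, hD, e⟩ := exists_resPairing_iterate l h (mem_domain_opPow_of_le hj hw)
      refine ⟨-D, Submodule.neg_mem _ (degreeLT_mono hj hD), fun _ _ z hz => ?_⟩
      rw [e z hz, eval_neg]
      ring
  choose D hD e using key
  refine ⟨∑ j ∈ Finset.range (N + 1), ∑ k ∈ Finset.range (N + 1),
    ((p.coeff j : ℂ) * (q.coeff k : ℂ)) • D j k, ?_, fun z hz => ?_⟩
  · exact Submodule.sum_mem _ fun j _ => Submodule.sum_mem _ fun k _ =>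
      Submodule.smul_mem _ _ (hD j k)
  · rw [resPairing_polyAct hz l w hp, resPairing_polyAct hz l w hq,
      aeval_eq_sum_range' (Nat.lt_succ_of_le hp), aeval_eq_sum_range' (Nat.lt_succ_of_le hq),
      Finset.sum_mul_sum, Finset.sum_mul_sum, Finset.sum_comm (f := fun i j =>
        q.coeff i • z ^ i * ((p.coeff j : ℂ) * resPairing T l ((extZero T)^[j] w) z)),
      eval_finsetSum, ← Finset.sum_add_distrib]
    refine Finset.sum_congr rfl fun j hj => ?_
    rw [eval_finsetSum, ← Finset.sum_add_distrib]
    refine Finset.sum_congr rfl fun k hk => ?_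
    rw [Finset.mem_range] at hj hk
    have := e j k (by omega) (by omega) z hz
    rw [eval_smul, Complex.real_smul, Complex.real_smul, smul_eq_mul]
    linear_combination (p.coeff j : ℂ) * (q.coeff k : ℂ) * this

theorem quad_I : quad Complex.I = X ^ 2 + 1 := by
  simp [quad]

theorem quad_neg_I : quad (-Complex.I) = X ^ 2 + 1 := by
  simp [quad]

theorem I_mem_openOuterCone {φ : ℝ} (h0 : 0 ≤ φ) (hφ : φ < Real.pi / 2) :
    Complex.I ∈ openOuterCone φ := by
  have := Real.cos_pos_of_mem_Ioo ⟨by linarith [Real.pi_pos], hφ⟩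
  simpa [openOuterCone] using this

/-- The scalar form of `(p/q)(T) q[T] w = p[T] w` for `p = X p₁`. -/
theorem HasSectorialBounds.boundaryInt_resPairing {ω θ : ℝ} (hω : 0 < ω) (hθ : θ < Real.pi / 2)
    (hT : HasSectorialBounds T ω) {p q : ℝ[X]} (hpq : p = 0 ∨ p.natDegree + 2 ≤ q.natDegree)
    (hq : ∀ z ∉ openOuterCone θ, aeval z q ≠ 0) {φ : ℝ} (hφ : φ ∈ Set.Ioo ω θ)
    (l : StrongDual ℝ W) {w : W} (hw : w ∈ (opPow T q.natDegree).domain) :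
    boundaryInt φ (fun s => resPairing T l (polyAct T w q) s * (aeval s (X * p) / aeval s q)) =
      2 * Real.pi * l (polyAct T w (X * p)) := by
  have h0 : 0 < φ := hω.trans hφ.1
  have hφ2 : φ < Real.pi / 2 := hφ.2.trans hθ
  rcases hpq with rfl | hdeg
  · simp [boundaryInt, rayInt]
  have hq0 : q ≠ 0 := by
    rintro rfl
    simp at hdeg
  have hqφ : ∀ z ∉ openOuterCone φ, aeval z q ≠ 0 := fun z hz => hq z fun h =>
    hz (outerCone_subset_openOuterCone h0 hφ.2 hθ (openOuterCone_subset _ h))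
  have hρ : ∀ z ∈ outerCone φ, z ∈ openOuterCone ω :=
    fun z hz => outerCone_subset_openOuterCone hω hφ.1 hφ2 hz
  -- The factor X² + 1 compensates the denominator of `reg`; the gap of two degrees between p and q
  -- is exactly what this costs.
  set P : ℝ[X] := (X ^ 2 + 1) * p with hP
  have hPdeg : P.natDegree ≤ q.natDegree := by
    refine natDegree_mul_le.trans ?_
    have : (X ^ 2 + 1 : ℝ[X]).natDegree ≤ 2 := by compute_degree
    omega
  obtain ⟨D, hD, hDe⟩ := exists_resPairing_polyAct l hw hPdeg le_rfl
  set u := polyAct T w P with hu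
  -- the part which is holomorphic inside the double sector
  have hmap : ∀ z : ℂ, aeval z q = (q.map (algebraMap ℝ ℂ)).eval z := fun z => by
    rw [eval_map_algebraMap]
  have hmap0 : q.map (algebraMap ℝ ℂ) ≠ 0 := by
    rwa [Ne, Polynomial.map_eq_zero]
  -- This makes s D(s)/q(s) bounded, as Cauchy's theorem in the sector requires.
  have hXD : (X * D).natDegree ≤ (q.map (algebraMap ℝ ℂ)).natDegree := by
    rw [natDegree_map]
    rcases eq_or_ne D 0 with rfl | hD0
    · simp
    · rw [mem_degreeLT, ← natDegree_lt_iff_degree_lt hD0] at hD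
      rw [natDegree_X_mul hD0]
      omega
  obtain ⟨C₁, -, hC₁⟩ := exists_norm_div_le (isClosed_compl_openOuterCone φ) hmap0
    (fun z hz => by rw [← hmap]; exact hqφ z hz) hXD
  obtain ⟨hi₁, he₁⟩ := boundaryInt_reg_mul_eq_zero (m := fun s => D.eval s / aeval s q) (C := C₁)
    h0.le hφ2 (fun s hs => by
      simp only [hmap]
      exact D.differentiableAt.div (Polynomial.differentiableAt _)
        (by rw [← hmap]; exact hqφ s hs))
    (fun s hs => by
      have := hC₁ s hs
      rw [eval_mul, eval_X, ← hmap, mul_div_assoc] at this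
      exact this)
  -- the part which is holomorphic outside the double sector
  obtain ⟨C₂, -, hC₂⟩ := hT.norm_resPairing_le ⟨hφ.1, hφ2⟩ l u
  obtain ⟨hi₂, he₂⟩ := boundaryInt_reg_mul (m := resPairing T l u) (C := C₂) h0 hφ2
    (fun s hs => hT.differentiableAt_resPairing (hφ.1.trans hφ2) l u (hρ s hs))
    (fun s hs => by
      have h1 := hC₂ s hs
      have h2 : 0 < ‖s‖ := norm_pos_iff.2 hs.1
      rwa [le_div_iff₀ h2, mul_comm, ← norm_mul] at h1)
  rw [boundaryInt_congr h0.le hφ2.le (h := fun s => reg s * resPairing T l u s +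
    reg s * (D.eval s / aeval s q)), boundaryInt_add hi₂ hi₁, he₁, he₂, add_zero]
  -- Evaluation of -π (R_u(i) + R_u(-i)). Since Q_{±i}[T] = T² + 1, the inverse strips this factor
  -- from u = P[T] w and leaves p[T] w. The terms with z̄ = ∓i cancel, and the two terms -l(T p[T]
  -- w) add up.
  · have hI := I_mem_openOuterCone hω.le (hφ.1.trans hφ2)
    have hquad : HasQuadInv T Complex.I := hT.hasQuadInv _ hI
    have hB : quadInv T (-Complex.I) = quadInv T Complex.I := by
      rw [quadInv, quadInv, quad_I, quad_neg_I]
    have hw' : w ∈ (opPow T (2 + p.natDegree)).domain := mem_domain_opPow_of_le (by omega) hw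
    have hBu : quadInv T Complex.I u = polyAct T w p := by
      rw [hu, hP, ← quad_I, polyAct_mul (natDegree_quad _).le le_rfl hw',
        quadInv_polyAct hquad (polyAct_mem le_rfl hw')]
    have hTp : extZero T (polyAct T w p) = polyAct T w (X * p) := by
      have := iterate_extZero_polyAct (T := T) (j := 1) (le_refl p.natDegree)
        (mem_domain_opPow_of_le (by omega) hw)
      simpa using this
    rw [resPairing, resPairing, hB, hBu, hTp]
    simp only [Complex.conj_I, map_neg]
    ring
  · intro s hs hs'
    have hqs := hqφ s hs'
    have hs1 : s ^ 2 + 1 ≠ 0 := by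
      intro h
      have : (s - Complex.I) * (s + Complex.I) = 0 := by
        linear_combination h - Complex.I_sq
      have hI := I_mem_openOuterCone h0.le hφ2
      rcases mul_eq_zero.1 this with h | h
      · rw [sub_eq_zero.1 h] at hs'
        exact hs' hI
      · rw [eq_neg_of_add_eq_zero_left h] at hs'
        exact hs' (neg_mem_openOuterCone_iff.2 hI)
    have h1 := hDe s (hT.hasQuadInv s (hρ s hs))
    have h2 : aeval s P = (s ^ 2 + 1) * aeval s p := by simp [hP]
    have h3 : aeval s (X * p) = s * aeval s p := by simp
    rw [h2] at h1
    rw [h3, reg]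
    field_simp
    linear_combination s * h1

end Bezout

/-! ### From the paths γ± to ray integrals. -/

section Path

open MeasureTheory Complex

/-- The path `γ₊` in the complex plane. -/
noncomputable def cPath (φ t : ℝ) : ℂ := (|t| * Real.cos φ : ℝ) - (t * Real.sin φ : ℝ) * I

/-- The derivative of the path `γ₊` in the complex plane. -/
noncomputable def cPathDeriv (φ t : ℝ) : ℂ := (Real.sign t * Real.cos φ : ℝ) - (Real.sin φ : ℝ) * I

theorem integral_Ioi_eq_rayInt (y : ℝ) (g : ℂ → ℂ) :
    ∫ t in Set.Ioi (0 : ℝ), exp (y * I) * g (t * exp (y * I)) = rayInt y g := by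
  have h := integral_image_eq_integral_abs_deriv_smul (s := Set.univ) (f := Real.exp)
    (f' := Real.exp) MeasurableSet.univ (fun x _ => (Real.hasDerivAt_exp x).hasDerivWithinAt)
    Real.exp_injective.injOn (fun t : ℝ => exp (y * I) * g (t * exp (y * I)))
  rw [Set.image_univ, Real.range_exp] at h
  rw [h, setIntegral_univ, rayInt]
  refine integral_congr_ae (Filter.Eventually.of_forall fun x => ?_)
  simp only [abs_of_pos (Real.exp_pos x), real_smul, ofReal_exp, exp_add]
  ring

/-- For t > 0 the path runs outwards along the ray of angle -φ, for t < 0 inwards along the ray of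
angle φ, whence the two signs. -/
theorem integral_cPath {φ : ℝ} {g : ℂ → ℂ}
    (hg : Integrable fun t => cPathDeriv φ t / I * g (cPath φ t)) :
    ∫ t, cPathDeriv φ t / I * g (cPath φ t) = (rayInt (-φ) g - rayInt φ g) / I := by
  have h1 : ∫ t in Set.Ioi (0 : ℝ), cPathDeriv φ t / I * g (cPath φ t) = rayInt (-φ) g / I := by
    rw [← integral_Ioi_eq_rayInt, ← integral_div]
    refine setIntegral_congr_fun measurableSet_Ioi fun t ht => ?_
    have e : exp ((-φ : ℝ) * I) = Real.cos φ - Real.sin φ * I := by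
      rw [exp_mul_I, ← ofReal_cos, ← ofReal_sin, Real.cos_neg, Real.sin_neg]
      push_cast
      ring
    have e2 : cPath φ t = t * (Real.cos φ - Real.sin φ * I) := by
      rw [cPath, abs_of_pos ht]; push_cast; ring
    have e3 : cPathDeriv φ t = Real.cos φ - Real.sin φ * I := by
      rw [cPathDeriv, Real.sign_of_pos ht, one_mul]
    simp only [e, e2, e3]
    ring
  have h2 : ∫ t in Set.Iic (0 : ℝ), cPathDeriv φ t / I * g (cPath φ t) = -rayInt φ g / I := by
    have h3 := integral_comp_neg_Ioi 0 fun t => cPathDeriv φ t / I * g (cPath φ t)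
    rw [neg_zero] at h3
    rw [← h3, ← integral_Ioi_eq_rayInt, ← integral_neg, ← integral_div]
    refine setIntegral_congr_fun measurableSet_Ioi fun t ht => ?_
    have e : exp (φ * I) = Real.cos φ + Real.sin φ * I := by
      rw [exp_mul_I, ← ofReal_cos, ← ofReal_sin]
    have e2 : cPath φ (-t) = t * (Real.cos φ + Real.sin φ * I) := by
      rw [cPath, abs_neg, abs_of_pos ht]; push_cast; ring
    have e3 : cPathDeriv φ (-t) = -(Real.cos φ + Real.sin φ * I) := by
      rw [cPathDeriv, Real.sign_of_neg (neg_lt_zero.2 ht)]; push_cast; ring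
    simp only [e, e2, e3]
    ring
  rw [← integral_add_compl (measurableSet_Ioi (a := (0 : ℝ))) hg, Set.compl_Ioi, h1, h2]
  ring

theorem integral_cPath_add {φ : ℝ} {g : ℂ → ℂ}
    (h₁ : Integrable fun t => cPathDeriv φ t / I * g (cPath φ t))
    (h₂ : Integrable fun t => -cPathDeriv φ t / I * g (-cPath φ t)) :
    (∫ t, cPathDeriv φ t / I * g (cPath φ t)) + ∫ t, -cPathDeriv φ t / I * g (-cPath φ t) =
      boundaryInt φ g := by
  have e : (fun t => -cPathDeriv φ t / I * g (-cPath φ t)) =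
      fun t => -(cPathDeriv φ t / I * g (-cPath φ t)) := by
    ext t; ring
  rw [e] at h₂ ⊢
  rw [integral_neg, integral_cPath h₁,
    integral_cPath (g := fun s => g (-s)) (by simpa using h₂.neg), boundaryInt]
  ring

end Path

end CliffordOmega

namespace CliffordOmega

open Polynomial

variable {n : ℕ}

/-! ### The planes `ℂ_J` as copies of ℂ, and the double sector seen in them. -/

section Paravectors

theorem Cl.norm_sq_eq (s : Cl n) : ‖s‖ ^ 2 = ∑ A, s.coeff A ^ 2 := by
  have h := EuclideanSpace.norm_sq_eq (𝕜 := ℝ) (n := Finset (Fin n)) s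
  refine h.trans (Finset.sum_congr rfl fun A _ => ?_)
  rw [Real.norm_eq_abs, sq_abs]
  rfl

theorem Cl.coeff_sum {ι : Type*} (s : Finset ι) (f : ι → Cl n) (A : Finset (Fin n)) :
    (∑ i ∈ s, f i).coeff A = ∑ i ∈ s, (f i).coeff A := by
  classical
  induction s using Finset.induction_on with
  | empty => simp
  | insert i s hi ih => rw [Finset.sum_insert hi, Finset.sum_insert hi, Cl.coeff_add, ih]

theorem continuous_coeff (A : Finset (Fin n)) : Continuous fun s : Cl n => s.coeff A :=
  (EuclideanSpace.proj (𝕜 := ℝ) A).continuous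

theorem coeff_basisVec (A B : Finset (Fin n)) :
    (basisVec A : Cl n).coeff B = if B = A then 1 else 0 := rfl

variable {J : Cl n}

theorem eq_sum_of_mem_imagSphere (hJ : J ∈ imagSphere n) :
    J = ∑ i, J.coeff {i} • basisVec {i} := by
  ext A
  rw [Cl.coeff_sum]
  simp only [Cl.coeff_smul, coeff_basisVec, mul_ite, mul_one, mul_zero]
  rcases Nat.lt_or_ge A.card 2 with h | h
  · rcases Nat.lt_succ_iff_lt_or_eq.1 h with h | h
    · obtain rfl := Finset.card_eq_zero.1 (Nat.lt_one_iff.1 h)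
      rw [hJ.2.1]
      simp
    · obtain ⟨a, rfl⟩ := Finset.card_eq_one.1 h
      simp
  · rw [hJ.1 A h]
    refine (Finset.sum_eq_zero fun i _ => if_neg ?_).symm
    rintro rfl
    simp at h

theorem sum_coeff_singleton_sq (hJ : J ∈ imagSphere n) : ∑ i, J.coeff {i} ^ 2 = 1 := by
  have h := Cl.norm_sq_eq J
  rw [hJ.2.2, one_pow] at h
  rw [h, ← Finset.sum_subset (Finset.subset_univ
    (Finset.univ.map ⟨fun i : Fin n => ({i} : Finset (Fin n)), Finset.singleton_injective⟩)),
    Finset.sum_map]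
  · rfl
  · intro A _ hA
    rcases Nat.lt_or_ge A.card 2 with h | h
    · rcases Nat.lt_succ_iff_lt_or_eq.1 h with h | h
      · rw [Finset.card_eq_zero.1 (Nat.lt_one_iff.1 h), hJ.2.1, zero_pow two_ne_zero]
      · obtain ⟨a, rfl⟩ := Finset.card_eq_one.1 h
        simp at hA
    · rw [hJ.1 A h, zero_pow two_ne_zero]

/-- Symmetrizing the double sum for J² cancels the mixed terms by anticommutation. What remains is
-2 times the sum of the squared coefficients, which is 1. -/
theorem mul_self_of_mem_imagSphere (hJ : J ∈ imagSphere n) : J * J = -1 := by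
  have h1 : J * J = ∑ i, ∑ j, (J.coeff {i} * J.coeff {j}) •
      (basisVec {i} * basisVec {j} : Cl n) := by
    conv_lhs => rw [eq_sum_of_mem_imagSphere hJ]
    rw [Finset.sum_mul_sum]
    exact Finset.sum_congr rfl fun i _ => Finset.sum_congr rfl fun j _ => smul_mul_smul_comm _ _ _ _
  have h2 : J * J + J * J = ∑ i, ∑ j, (J.coeff {i} * J.coeff {j}) •
      (basisVec {i} * basisVec {j} + basisVec {j} * basisVec {i} : Cl n) := by
    nth_rw 2 [h1]
    rw [Finset.sum_comm]
    nth_rw 1 [h1]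
    rw [← Finset.sum_add_distrib]
    refine Finset.sum_congr rfl fun i _ => ?_
    rw [← Finset.sum_add_distrib]
    refine Finset.sum_congr rfl fun j _ => ?_
    rw [smul_add, mul_comm (J.coeff {j})]
  have h3 : J * J + J * J = ∑ i, (J.coeff {i} ^ 2) • (-2 : Cl n) := by
    rw [h2]
    refine Finset.sum_congr rfl fun i _ => ?_
    rw [Finset.sum_eq_single i]
    · rw [basisVec_singleton_sq, sq]
      congr 1
      norm_num
    · intro j _ hj
      rw [basisVec_singleton_anticomm hj, add_neg_cancel, smul_zero]
    · simp
  rw [← Finset.sum_smul, sum_coeff_singleton_sq hJ, one_smul, ← two_smul ℝ] at h3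
  have h4 : (-2 : Cl n) = (2 : ℝ) • (-1 : Cl n) := by
    rw [two_smul]; norm_num
  rw [h4] at h3
  exact smul_right_injective _ (two_ne_zero (α := ℝ)) h3

/-- The embedding `x + i y ↦ x + J y` of the complex numbers onto `ℂ_J`. -/
noncomputable def planeEmb (hJ : J ∈ imagSphere n) : ℂ →ₐ[ℝ] Cl n :=
  Complex.liftAux J (mul_self_of_mem_imagSphere hJ)

variable (hJ : J ∈ imagSphere n)

theorem planeEmb_apply (z : ℂ) : planeEmb hJ z = z.re • (1 : Cl n) + z.im • J := by
  rw [planeEmb, Complex.liftAux_apply, Algebra.algebraMap_eq_smul_one]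

theorem planeEmb_I : planeEmb hJ Complex.I = J := by
  simp [planeEmb_apply]

theorem coeff_planeEmb (z : ℂ) (A : Finset (Fin n)) :
    (planeEmb hJ z).coeff A = (if A = ∅ then z.re else 0) + z.im * J.coeff A := by
  rw [planeEmb_apply, Cl.coeff_add, Cl.coeff_smul, Cl.coeff_smul, Cl.coeff_one, mul_ite, mul_one,
    mul_zero]

theorem coeff_empty_planeEmb (z : ℂ) : (planeEmb hJ z).coeff ∅ = z.re := by
  rw [coeff_planeEmb, if_pos rfl, hJ.2.1, mul_zero, add_zero]

theorem planeEmb_mem_paravectors (z : ℂ) : planeEmb hJ z ∈ paravectors n := fun A hA => by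
  rw [coeff_planeEmb, hJ.1 A hA, if_neg, mul_zero, add_zero]
  rintro rfl
  simp at hA

theorem norm_sq_planeEmb (z : ℂ) : ‖planeEmb hJ z‖ ^ 2 = z.re ^ 2 + z.im ^ 2 := by
  have h := Cl.norm_sq_eq J
  rw [hJ.2.2, one_pow] at h
  rw [Cl.norm_sq_eq]
  have h1 : ∀ A, (planeEmb hJ z).coeff A ^ 2 =
      (if A = ∅ then z.re ^ 2 else 0) + z.im ^ 2 * J.coeff A ^ 2 := fun A => by
    rw [coeff_planeEmb]
    split_ifs with hA
    · rw [hA, hJ.2.1]; ring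
    · ring
  simp only [h1, Finset.sum_add_distrib, ← Finset.mul_sum, ← h]
  simp

theorem norm_planeEmb (z : ℂ) : ‖planeEmb hJ z‖ = ‖z‖ := by
  refine (sq_eq_sq₀ (norm_nonneg _) (norm_nonneg _)).1 ?_
  rw [norm_sq_planeEmb, Complex.sq_norm, Complex.normSq_apply]
  ring

theorem continuous_planeEmb : Continuous (planeEmb hJ) :=
  (planeEmb hJ).toLinearMap.continuous_of_finiteDimensional

theorem conj_planeEmb (z : ℂ) : conj (planeEmb hJ z) = planeEmb hJ (starRingEnd ℂ z) := by
  ext A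
  rw [conj, Cl.coeff_ofCoeff, coeff_planeEmb, coeff_planeEmb]
  rcases Nat.lt_or_ge A.card 2 with h | h
  · rcases Nat.lt_succ_iff_lt_or_eq.1 h with h | h
    · obtain rfl := Finset.card_eq_zero.1 (Nat.lt_one_iff.1 h)
      simp [hJ.2.1]
    · obtain ⟨a, rfl⟩ := Finset.card_eq_one.1 h
      simp
  · have hA : A ≠ ∅ := by
      rintro rfl
      simp at h
    simp [hA, hJ.1 A h]

theorem inverse_planeEmb (z : ℂ) : Ring.inverse (planeEmb hJ z) = planeEmb hJ z⁻¹ := by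
  rcases eq_or_ne z 0 with rfl | hz
  · rw [map_zero, inv_zero, map_zero, Ring.inverse_zero]
  · let u : (Cl n)ˣ := ⟨planeEmb hJ z, planeEmb hJ z⁻¹,
      by rw [← map_mul, mul_inv_cancel₀ hz, map_one],
      by rw [← map_mul, inv_mul_cancel₀ hz, map_one]⟩
    exact Ring.inverse_unit u

theorem ratFun_planeEmb (p q : ℝ[X]) (z : ℂ) :
    ratFun p q (planeEmb hJ z) = planeEmb hJ (aeval z p / aeval z q) := by
  rw [ratFun, aeval_algHom_apply, aeval_algHom_apply, inverse_planeEmb, ← map_mul, div_eq_mul_inv]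

theorem polar_eq (t φ : ℝ) :
    polar J t φ = planeEmb hJ (t * Complex.exp (φ * Complex.I)) := by
  rw [planeEmb_apply, polar, Complex.re_ofReal_mul, Complex.im_ofReal_mul,
    Complex.exp_ofReal_mul_I_re, Complex.exp_ofReal_mul_I_im]

theorem nonempty_imagSphere (hn : 1 ≤ n) : (imagSphere n).Nonempty := by
  refine ⟨basisVec {⟨0, hn⟩}, fun A hA => ?_, ?_, ?_⟩
  · rw [coeff_basisVec, if_neg]
    rintro rfl
    simp at hA
  · rw [coeff_basisVec, if_neg (Finset.singleton_ne_empty _).symm]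
  · refine (sq_eq_sq₀ (norm_nonneg _) zero_le_one).1 ?_
    rw [Cl.norm_sq_eq]
    simp [coeff_basisVec]

/-- The complex form of the open double sector. -/
def innerCone (φ : ℝ) : Set ℂ := {z | |z.im| * Real.cos φ < |z.re| * Real.sin φ}

theorem notMem_openOuterCone_of_mem_innerCone {φ : ℝ} {z : ℂ} (hz : z ∈ innerCone φ) :
    z ∉ openOuterCone φ := fun h => by
  have h1 : |z.im| * Real.cos φ < |z.re| * Real.sin φ := hz
  exact lt_asymm h1 h

theorem abs_sin_mul_cos_lt_of_mem_Ioo {φ α : ℝ} (hφ : φ < Real.pi / 2)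
    (hα : α ∈ Set.Ioo (-φ) φ) : |Real.sin α| * Real.cos φ < |Real.cos α| * Real.sin φ := by
  have h1 : 0 < Real.sin (φ - α) :=
    Real.sin_pos_of_pos_of_lt_pi (by linarith [hα.2]) (by linarith [hα.1])
  have h2 : 0 < Real.sin (φ + α) :=
    Real.sin_pos_of_pos_of_lt_pi (by linarith [hα.1]) (by linarith [hα.2])
  rw [Real.sin_sub] at h1
  rw [Real.sin_add] at h2
  have h3 : 0 < Real.cos α := Real.cos_pos_of_mem_Ioo ⟨by linarith [hα.1], by linarith [hα.2]⟩
  rw [abs_of_pos h3]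
  rcases abs_cases (Real.sin α) with ⟨h, -⟩ | ⟨h, -⟩ <;> rw [h] <;> linarith

theorem abs_sin_mul_cos_lt {φ α : ℝ} (hφ : φ < Real.pi / 2) (hα : α ∈ angles φ) :
    |Real.sin α| * Real.cos φ < |Real.cos α| * Real.sin φ := by
  rcases hα with hα | hα
  · exact abs_sin_mul_cos_lt_of_mem_Ioo hφ hα
  · have := abs_sin_mul_cos_lt_of_mem_Ioo hφ (α := α - Real.pi)
      ⟨by linarith [hα.1], by linarith [hα.2]⟩
    rwa [Real.sin_sub_pi, Real.cos_sub_pi, abs_neg, abs_neg] at this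

theorem abs_arg_lt_of_mem_innerCone {φ : ℝ} (hφ : φ < Real.pi / 2) (h0 : 0 < φ) {z : ℂ}
    (hz : z ∈ innerCone φ) (hre : 0 < z.re) : |z.arg| < φ := by
  have hz0 : z ≠ 0 := by rintro rfl; simp at hre
  have hn : 0 < ‖z‖ := norm_pos_iff.2 hz0
  have hlt : |z.arg| < Real.pi / 2 := Complex.abs_arg_lt_pi_div_two_iff.2 (Or.inl hre)
  have h1 : |z.im| * Real.cos φ < |z.re| * Real.sin φ := hz
  have hc : 0 < Real.cos φ := Real.cos_pos_of_mem_Ioo ⟨by linarith, hφ⟩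
  rw [← Complex.norm_mul_cos_arg z, ← Complex.norm_mul_sin_arg z, abs_mul, abs_mul, abs_norm,
    mul_assoc, mul_assoc] at h1
  have h2 := lt_of_mul_lt_mul_left h1 hn.le
  have h3 : 0 < Real.cos z.arg := Real.cos_pos_of_mem_Ioo (abs_lt.1 hlt)
  rw [abs_of_pos h3] at h2
  have h4 : Real.sin |z.arg| ≤ |Real.sin z.arg| := by
    rcases abs_cases z.arg with ⟨h, -⟩ | ⟨h, -⟩ <;> rw [h]
    · exact le_abs_self _
    · rw [Real.sin_neg]; exact neg_le_abs _
  have h5 : 0 < Real.sin (φ - |z.arg|) := by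
    rw [Real.sin_sub, Real.cos_abs]
    have := mul_le_mul_of_nonneg_right h4 hc.le
    linarith
  by_contra hcon
  have := Real.sin_nonpos_of_nonpos_of_neg_pi_le (x := φ - |z.arg|) (by linarith)
    (by linarith [Real.pi_pos])
  linarith

/-- The imaginary unit witnessing membership may differ from J. The comparison uses the scalar part
and the norm, which determine Re z and |Im z| whatever the unit. -/
theorem planeEmb_mem_doubleSector_iff {φ : ℝ} (h0 : 0 < φ) (hφ : φ < Real.pi / 2) {z : ℂ} :
    planeEmb hJ z ∈ doubleSector n φ ↔ z ∈ innerCone φ := by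
  constructor
  · rintro ⟨K, hK, t, ht, α, hα, h⟩
    rw [polar_eq hK] at h
    set w : ℂ := t * Complex.exp (α * Complex.I) with hw
    have hre : z.re = w.re := by rw [← coeff_empty_planeEmb hJ, h, coeff_empty_planeEmb]
    have him : |z.im| = |w.im| := by
      have h1 := norm_sq_planeEmb hJ z
      rw [h, norm_sq_planeEmb, hre] at h1
      exact (sq_eq_sq_iff_abs_eq_abs _ _).1 (by linarith)
    have hwre : w.re = t * Real.cos α := by
      rw [hw, Complex.re_ofReal_mul, Complex.exp_ofReal_mul_I_re]
    have hwim : w.im = t * Real.sin α := by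
      rw [hw, Complex.im_ofReal_mul, Complex.exp_ofReal_mul_I_im]
    change |z.im| * _ < |z.re| * _
    rw [him, hre, hwre, hwim, abs_mul, abs_mul, mul_assoc, mul_assoc]
    exact mul_lt_mul_of_pos_left (abs_sin_mul_cos_lt hφ hα) (abs_pos.2 ht.ne')
  · intro hz
    have hre : z.re ≠ 0 := by
      intro h
      have h1 : |z.im| * Real.cos φ < |z.re| * Real.sin φ := hz
      rw [h, abs_zero, zero_mul] at h1
      have hc : 0 < Real.cos φ := Real.cos_pos_of_mem_Ioo ⟨by linarith, hφ⟩
      exact absurd h1 (not_lt.2 (by positivity))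
    have hz0 : z ≠ 0 := by rintro rfl; simp at hre
    rcases lt_or_gt_of_ne hre with hneg | hpos
    · have hnz : -z ∈ innerCone φ := by
        change |(-z).im| * _ < |(-z).re| * _
        rw [Complex.neg_im, Complex.neg_re, abs_neg, abs_neg]
        exact hz
      have harg := abs_lt.1 (abs_arg_lt_of_mem_innerCone hφ h0 hnz (by simpa using hneg))
      refine ⟨J, hJ, ‖-z‖, norm_pos_iff.2 (neg_ne_zero.2 hz0), Real.pi + (-z).arg,
        Or.inr ⟨by linarith [harg.1], by linarith [harg.2]⟩, ?_⟩
      rw [polar_eq hJ]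
      congr 1
      have := Complex.norm_mul_exp_arg_mul_I (-z)
      push_cast
      rw [add_mul, Complex.exp_add, Complex.exp_pi_mul_I]
      linear_combination this
    · have harg := abs_lt.1 (abs_arg_lt_of_mem_innerCone hφ h0 hz hpos)
      refine ⟨J, hJ, ‖z‖, norm_pos_iff.2 hz0, z.arg, Or.inl harg, ?_⟩
      rw [polar_eq hJ, Complex.norm_mul_exp_arg_mul_I]

theorem planeEmb_notMem_closure {ω : ℝ} (h0 : 0 < ω) (hω : ω < Real.pi / 2) {z : ℂ}
    (hz : z ∈ openOuterCone ω) : planeEmb hJ z ∉ closure (doubleSector n ω) := by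
  -- A closed condition in the norm and the scalar part only. It holds on the double sector and, on
  -- `ℂ_J`, excludes the open outer cone.
  set S : Set (Cl n) := {s | (‖s‖ ^ 2 - s.coeff ∅ ^ 2) * Real.cos ω ^ 2 ≤
    s.coeff ∅ ^ 2 * Real.sin ω ^ 2} with hS
  have hcl : IsClosed S := by
    have := continuous_coeff (n := n) ∅
    exact isClosed_le (by fun_prop) (by fun_prop)
  have hc : 0 < Real.cos ω := Real.cos_pos_of_mem_Ioo ⟨by linarith, hω⟩
  have hs : 0 < Real.sin ω := Real.sin_pos_of_pos_of_lt_pi h0 (by linarith)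
  have hmem : ∀ {K : Cl n} (hK : K ∈ imagSphere n) (w : ℂ), planeEmb hK w ∈ S ↔
      |w.im| * Real.cos ω ≤ |w.re| * Real.sin ω := by
    intro K hK w
    have h1 : |w.im| * Real.cos ω ≤ |w.re| * Real.sin ω ↔
        (|w.im| * Real.cos ω) ^ 2 ≤ (|w.re| * Real.sin ω) ^ 2 :=
      (sq_le_sq₀ (by positivity) (by positivity)).symm
    rw [h1, mul_pow, mul_pow, sq_abs, sq_abs, hS, Set.mem_ofPred_eq, coeff_empty_planeEmb,
      norm_sq_planeEmb, add_sub_cancel_left]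
  have hsub : doubleSector n ω ⊆ S := by
    rintro s hs'
    obtain ⟨K, hK, t, ht, α, hα, rfl⟩ := id hs'
    rw [polar_eq hK] at hs' ⊢
    rw [planeEmb_mem_doubleSector_iff hK h0 hω] at hs'
    exact (hmem hK _).2 (le_of_lt hs')
  intro h
  have h1 := (hmem hJ z).1 (closure_minimal hsub hcl h)
  exact absurd h1 (not_le.2 (by simpa [openOuterCone] using hz))

theorem planeEmb_mem_closure {ω : ℝ} (h0 : 0 < ω) (hω : ω < Real.pi / 2) {z : ℂ}
    (hz : z ∉ openOuterCone ω) : planeEmb hJ z ∈ closure (doubleSector n ω) := by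
  have hs : 0 < Real.sin ω := Real.sin_pos_of_pos_of_lt_pi h0 (by linarith)
  have hz1 : |z.im| * Real.cos ω ≤ |z.re| * Real.sin ω := not_lt.1 hz
  -- σ is a sign of Re z; moving the real part away from 0 by ε enters the open sector, also from
  -- the vertex 0.
  obtain ⟨σ, hσ⟩ : ∃ σ : ℝ, ∀ ε : ℝ, 0 < ε → |z.re| + ε = |z.re + ε * σ| := by
    rcases le_total 0 z.re with h | h
    · refine ⟨1, fun ε hε => ?_⟩
      rw [abs_of_nonneg h, abs_of_nonneg (by linarith), mul_one]
    · refine ⟨-1, fun ε hε => ?_⟩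
      rw [abs_of_nonpos h, abs_of_nonpos (by linarith)]
      ring
  have hcont : Continuous fun ε : ℝ => planeEmb hJ (z + (ε * σ : ℝ)) :=
    (continuous_planeEmb hJ).comp (by fun_prop)
  have hlim : Filter.Tendsto (fun ε : ℝ => planeEmb hJ (z + (ε * σ : ℝ)))
      (nhdsWithin 0 (Set.Ioi 0)) (nhds (planeEmb hJ z)) := by
    have := hcont.tendsto 0
    simp only [zero_mul, Complex.ofReal_zero, add_zero] at this
    exact this.mono_left nhdsWithin_le_nhds
  refine mem_closure_of_tendsto hlim ?_
  filter_upwards [self_mem_nhdsWithin] with ε hε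
  rw [planeEmb_mem_doubleSector_iff hJ h0 hω]
  change |(z + (ε * σ : ℝ)).im| * _ < |(z + (ε * σ : ℝ)).re| * _
  rw [Complex.add_im, Complex.add_re, Complex.ofReal_im, Complex.ofReal_re, add_zero, ← hσ ε hε,
    add_mul]
  have := mul_pos hε hs
  linarith

end Paravectors

end CliffordOmega

namespace CliffordOmega

open Polynomial

variable {n : ℕ} {E : Type*} [NormedAddCommGroup E] [NormedSpace ℝ E]

/-! ### Left multiplication on the Clifford module. -/

section LeftMul

theorem leftMul_apply (s : Cl n) (v : CliffordModule n E) (C : Finset (Fin n)) :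
    leftMul s v C = ∑ B, (sgn B (symmDiff B C) * s.coeff B) • v (symmDiff B C) := rfl

theorem leftMul_add (s t : Cl n) :
    (leftMul (s + t) : CliffordModule n E →L[ℝ] CliffordModule n E) = leftMul s + leftMul t := by
  ext v C
  rw [add_apply, PiLp.add_apply]
  simp only [leftMul_apply, Cl.coeff_add, mul_add, add_smul, Finset.sum_add_distrib]

theorem leftMul_smul (r : ℝ) (s : Cl n) :
    (leftMul (r • s) : CliffordModule n E →L[ℝ] CliffordModule n E) = r • leftMul s := by
  ext v C
  rw [smul_apply, PiLp.smul_apply]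
  simp only [leftMul_apply, Cl.coeff_smul, Finset.smul_sum, smul_smul]
  exact Finset.sum_congr rfl fun B _ => by rw [mul_left_comm]

theorem leftMul_one :
    (leftMul (1 : Cl n) : CliffordModule n E →L[ℝ] CliffordModule n E) = .id ℝ _ := by
  ext v C
  have h : symmDiff ∅ C = C := bot_symmDiff C
  rw [leftMul_apply, Finset.sum_eq_single ∅]
  · rw [h]
    simp [Cl.coeff_one]
  · intro B _ hB
    simp [Cl.coeff_one, hB]
  · simp

theorem leftMul_mul (s t : Cl n) :
    (leftMul (s * t) : CliffordModule n E →L[ℝ] CliffordModule n E) =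
      (leftMul s).comp (leftMul t) := by
  ext v D
  rw [ContinuousLinearMap.comp_apply]
  simp only [leftMul_apply, Cl.coeff_mul, Finset.mul_sum, Finset.sum_smul, Finset.smul_sum,
    smul_smul]
  rw [Finset.sum_comm]
  refine Finset.sum_congr rfl fun B _ => ?_
  have hinv : Function.Involutive (symmDiff B) := fun C => symmDiff_symmDiff_cancel_left B C
  refine Fintype.sum_equiv hinv.toPerm _ _ fun C => ?_
  rw [Function.Involutive.coe_toPerm]
  obtain ⟨X, rfl⟩ : ∃ X, C = symmDiff B X := ⟨symmDiff B C, (hinv C).symm⟩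
  obtain ⟨Y, rfl⟩ : ∃ Y, D = symmDiff (symmDiff B X) Y :=
    ⟨symmDiff (symmDiff B X) D, (symmDiff_symmDiff_cancel_left _ D).symm⟩
  have h1 : symmDiff B (symmDiff B X) = X := hinv X
  have h2 : symmDiff (symmDiff B X) (symmDiff (symmDiff B X) Y) = Y :=
    symmDiff_symmDiff_cancel_left _ Y
  have h3 : symmDiff B (symmDiff (symmDiff B X) Y) = symmDiff X Y := by
    rw [← symmDiff_assoc, h1]
  have h4 : symmDiff X (symmDiff X Y) = Y := symmDiff_symmDiff_cancel_left X Y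
  rw [h1, h2, h3, h4, sgn_symmDiff_left, sgn_symmDiff_right]
  congr 1
  ring

variable {J : Cl n} (hJ : J ∈ imagSphere n)

theorem leftMul_planeEmb (z : ℂ) (v : CliffordModule n E) :
    leftMul (planeEmb hJ z) v = z.re • v + z.im • leftMul J v := by
  rw [planeEmb_apply, leftMul_add, leftMul_smul, leftMul_smul, leftMul_one]
  rfl

theorem leftMul_leftMul_of_mem_imagSphere (hJ : J ∈ imagSphere n) (v : CliffordModule n E) :
    leftMul J (leftMul J v) = -v := by
  have h := leftMul_mul (E := E) J J
  rw [mul_self_of_mem_imagSphere hJ, show (-1 : Cl n) = (-1 : ℝ) • 1 by rw [neg_one_smul],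
    leftMul_smul, leftMul_one] at h
  have := DFunLike.congr_fun h v
  rw [ContinuousLinearMap.comp_apply] at this
  rw [← this]
  simp

theorem norm_leftMul_planeEmb_le (z : ℂ) :
    ‖(leftMul (planeEmb hJ z) : CliffordModule n E →L[ℝ] CliffordModule n E)‖ ≤
      (1 + ‖(leftMul J : CliffordModule n E →L[ℝ] CliffordModule n E)‖) * ‖z‖ := by
  refine ContinuousLinearMap.opNorm_le_bound _ (by positivity) fun v => ?_
  rw [leftMul_planeEmb]
  calc ‖z.re • v + z.im • leftMul J v‖ ≤ |z.re| * ‖v‖ + |z.im| * ‖leftMul J v‖ := by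
        refine (norm_add_le _ _).trans ?_
        rw [norm_smul, norm_smul, Real.norm_eq_abs, Real.norm_eq_abs]
    _ ≤ ‖z‖ * ‖v‖ + ‖z‖ *
        (‖(leftMul J : CliffordModule n E →L[ℝ] CliffordModule n E)‖ * ‖v‖) := by
        gcongr
        · exact Complex.abs_re_le_norm z
        · exact Complex.abs_im_le_norm z
        · exact ContinuousLinearMap.le_opNorm _ _
    _ = _ := by ring

/-- Left multiplication by elements of `ℂ_J`, as a function of a complex variable. -/
noncomputable def leftMulPlane : ℂ →ₗ[ℝ] (CliffordModule n E →L[ℝ] CliffordModule n E) where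
  toFun z := leftMul (planeEmb hJ z)
  map_add' z w := by rw [map_add, leftMul_add]
  map_smul' r z := by rw [map_smul, leftMul_smul, RingHom.id_apply]

theorem leftMulPlane_apply (z : ℂ) :
    (leftMulPlane hJ z : CliffordModule n E →L[ℝ] CliffordModule n E) =
      leftMul (planeEmb hJ z) := rfl

theorem continuous_leftMulPlane : Continuous (leftMulPlane (E := E) hJ) :=
  AddMonoidHomClass.continuous_of_bound (leftMulPlane (E := E) hJ) _ (norm_leftMul_planeEmb_le hJ)

end LeftMul

/-! ### From S-resolvent estimates to estimates of Q_z[T]⁻¹ and T Q_z[T]⁻¹. -/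

section Bounds

variable {T : CliffordModule n E →ₗ.[ℝ] CliffordModule n E} {J : Cl n} (hJ : J ∈ imagSphere n)

theorem opQ_planeEmb (T : CliffordModule n E →ₗ.[ℝ] CliffordModule n E) (z : ℂ) :
    opQ (planeEmb hJ z) T = polyOp T (quad z) := by
  rw [opQ, quad, coeff_empty_planeEmb, norm_planeEmb]

theorem mulQuadInv_apply [CompleteSpace E] (hT : T.IsClosed) {z : ℂ} (h : HasQuadInv T z)
    (v : CliffordModule n E) : mulQuadInv T z v = extZero T (quadInv T z v) := by
  rw [mulQuadInv, mulBounded_apply hT (quadInv_mem h), extZero_of_mem (quadInv_mem h v)]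

theorem leftSResolvent_planeEmb (T : CliffordModule n E →ₗ.[ℝ] CliffordModule n E) (z : ℂ) :
    leftSResolvent (planeEmb hJ z) T =
      (quadInv T z).comp (leftMulPlane hJ (starRingEnd ℂ z)) - mulQuadInv T z := by
  rw [leftSResolvent, conj_planeEmb, opQ_planeEmb, leftMulPlane_apply]
  rfl

theorem leftSResolvent_planeEmb_apply [CompleteSpace E] (hT : T.IsClosed) {z : ℂ}
    (h : HasQuadInv T z) (v : CliffordModule n E) :
    leftSResolvent (planeEmb hJ z) T v =
      z.re • quadInv T z v - z.im • quadInv T z (leftMul J v) - extZero T (quadInv T z v) := by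
  rw [leftSResolvent_planeEmb, sub_apply, ContinuousLinearMap.comp_apply,
    leftMulPlane_apply, leftMul_planeEmb, mulQuadInv_apply hT h, map_add, map_smul, map_smul,
    Complex.conj_re, Complex.conj_im, neg_smul, sub_eq_add_neg (z.re • _)]

theorem quad_conj (z : ℂ) : quad (starRingEnd ℂ z) = quad z := by
  rw [quad, quad, Complex.conj_re, RCLike.norm_conj]

theorem quadInv_conj (z : ℂ) : quadInv T (starRingEnd ℂ z) = quadInv T z := by
  rw [quadInv, quadInv, quad_conj]

theorem conj_mem_outerCone {φ : ℝ} {z : ℂ} (hz : z ∈ outerCone φ) :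
    starRingEnd ℂ z ∈ outerCone φ :=
  ⟨by simpa using hz.1, by simpa using hz.2⟩

theorem conj_mem_openOuterCone {φ : ℝ} {z : ℂ} (hz : z ∈ openOuterCone φ) :
    starRingEnd ℂ z ∈ openOuterCone φ := by
  simpa [openOuterCone] using hz

theorem norm_mul_sin_le_abs_im {φ : ℝ} (h0 : 0 < φ) (hφ : φ < Real.pi / 2) {z : ℂ}
    (hz : z ∈ outerCone φ) : ‖z‖ * Real.sin φ ≤ |z.im| := by
  have hs : 0 < Real.sin φ := Real.sin_pos_of_pos_of_lt_pi h0 (by linarith)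
  have hc : 0 < Real.cos φ := Real.cos_pos_of_mem_Ioo ⟨by linarith, hφ⟩
  have h1 := pow_le_pow_left₀ (by positivity) hz.2 2
  rw [mul_pow, mul_pow, sq_abs, sq_abs] at h1
  refine abs_le_of_sq_le_sq' ?_ (abs_nonneg _) |>.2
  rw [mul_pow, Complex.sq_norm, Complex.normSq_apply, sq_abs]
  nlinarith [Real.sin_sq_add_cos_sq φ]

theorem IsBisectorial.hasQuadInv (hJ : J ∈ imagSphere n) {ω : ℝ} (h0 : 0 < ω) (hω : ω < Real.pi / 2)
    (hT : IsBisectorial T ω) {z : ℂ} (hz : z ∈ openOuterCone ω) : HasQuadInv T z := by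
  have h1 := planeEmb_notMem_closure hJ h0 hω hz
  by_contra hcon
  refine h1 (hT.spectrum_subset ⟨planeEmb_mem_paravectors hJ z, fun h => hcon ?_⟩)
  obtain ⟨-, B, hB⟩ := h
  rw [opQ_planeEmb] at hB
  exact ⟨B, hB⟩

theorem norm_leftSResolvent_planeEmb_le {ω φ : ℝ} (h0 : 0 < ω) (hT : IsBisectorial T ω)
    (hφ : φ ∈ Set.Ioo ω (Real.pi / 2)) : ∃ C : ℝ, 0 ≤ C ∧ ∀ {J : Cl n} (hJ : J ∈ imagSphere n),
      ∀ z ∈ outerCone φ, ‖leftSResolvent (planeEmb hJ z) T‖ ≤ C / ‖z‖ := by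
  obtain ⟨C, hC, h⟩ := hT.resolvent_bound φ hφ
  refine ⟨C, hC, fun {J} hJ z hz => ?_⟩
  rw [← norm_planeEmb hJ z]
  refine h _ (planeEmb_mem_paravectors hJ z) ?_ ?_
  · rw [planeEmb_mem_doubleSector_iff hJ (h0.trans hφ.1) hφ.2]
    intro hcon
    exact not_lt.2 hz.2 hcon
  · rw [← norm_ne_zero_iff, norm_planeEmb, norm_ne_zero_iff]
    exact hz.1

/-- Q_z is the same at z and z̄, so subtracting the S-resolvents at these two points isolates 2 Im z
· Q_z⁻¹ J. Outside the sector |Im z| ≥ |z| sin φ, which gives the decay |z|⁻² of Q_z⁻¹; T Q_z⁻¹ is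
then recovered from the S-resolvent itself. -/
theorem IsBisectorial.hasSectorialBounds [CompleteSpace E] (hn : 1 ≤ n) {ω : ℝ} (h0 : 0 < ω)
    (hω : ω < Real.pi / 2) (hT : IsBisectorial T ω) : HasSectorialBounds T ω := by
  obtain ⟨J, hJ⟩ := nonempty_imagSphere hn
  refine ⟨fun z hz => hT.hasQuadInv hJ h0 hω hz, fun φ hφ => ?_⟩
  obtain ⟨C, hC, h⟩ := norm_leftSResolvent_planeEmb_le h0 hT hφ
  set K := ‖(leftMul J : CliffordModule n E →L[ℝ] CliffordModule n E)‖ with hK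
  have hK0 : 0 ≤ K := norm_nonneg _
  have hs : 0 < Real.sin φ :=
    Real.sin_pos_of_pos_of_lt_pi (h0.trans hφ.1) (by linarith [hφ.2])
  have hcl := hT.closedClifford.closed
  refine ⟨C * K / Real.sin φ + 2 * C, by positivity, fun z hz => ?_⟩
  have hzo := outerCone_subset_openOuterCone h0 hφ.1 hφ.2 hz
  have hρ := hT.hasQuadInv hJ h0 hω hzo
  have hρ' := hT.hasQuadInv hJ h0 hω (conj_mem_openOuterCone hzo)
  have hz0 : 0 < ‖z‖ := norm_pos_iff.2 hz.1
  have hy := norm_mul_sin_le_abs_im (h0.trans hφ.1) hφ.2 hz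
  have hyB : ∀ v, ‖z.im • quadInv T z (leftMul J v)‖ ≤ C / ‖z‖ * ‖v‖ := by
    intro v
    have e1 := leftSResolvent_planeEmb_apply hJ hcl hρ v
    have e2 := leftSResolvent_planeEmb_apply hJ hcl hρ' v
    rw [quadInv_conj, Complex.conj_re, Complex.conj_im] at e2
    have e3 : (2 : ℝ) • z.im • quadInv T z (leftMul J v) =
        leftSResolvent (planeEmb hJ (starRingEnd ℂ z)) T v -
          leftSResolvent (planeEmb hJ z) T v := by
      rw [e1, e2, two_smul, neg_smul]
      abel
    have b1 := (leftSResolvent (planeEmb hJ z) T).le_of_opNorm_le (h hJ z hz) v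
    have b2 := (leftSResolvent (planeEmb hJ (starRingEnd ℂ z)) T).le_of_opNorm_le
      (h hJ _ (conj_mem_outerCone hz)) v
    rw [RCLike.norm_conj] at b2
    have b3 := congrArg norm e3
    rw [norm_smul, Real.norm_of_nonneg zero_le_two] at b3
    have b4 := norm_sub_le (leftSResolvent (planeEmb hJ (starRingEnd ℂ z)) T v)
      (leftSResolvent (planeEmb hJ z) T v)
    linarith
  have hB : ∀ v, ‖quadInv T z v‖ ≤ C * K / Real.sin φ / ‖z‖ ^ 2 * ‖v‖ := by
    intro v
    -- Inserting J v removes J on the right of Q_z⁻¹, since J² = -1.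
    have b1 := hyB (leftMul J v)
    rw [leftMul_leftMul_of_mem_imagSphere hJ, map_neg, smul_neg, norm_neg, norm_smul,
      Real.norm_eq_abs] at b1
    have b2 : ‖leftMul J v‖ ≤ K * ‖v‖ := ContinuousLinearMap.le_opNorm _ _
    have b3 : ‖z‖ * Real.sin φ * ‖quadInv T z v‖ ≤ C / ‖z‖ * (K * ‖v‖) :=
      (mul_le_mul_of_nonneg_right hy (norm_nonneg _)).trans
        (b1.trans (mul_le_mul_of_nonneg_left b2 (by positivity)))
    have b4 : C * K / Real.sin φ / ‖z‖ ^ 2 * ‖v‖ =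
        (C / ‖z‖ * (K * ‖v‖)) / (‖z‖ * Real.sin φ) := by
      field_simp
    rw [b4, le_div_iff₀ (by positivity)]
    linarith
  refine ⟨fun v => (hB v).trans ?_, fun v => ?_⟩
  · gcongr
    linarith
  · have e1 := leftSResolvent_planeEmb_apply hJ hcl hρ v
    have b1 := (leftSResolvent (planeEmb hJ z) T).le_of_opNorm_le (h hJ z hz) v
    have e2 : extZero T (quadInv T z v) = z.re • quadInv T z v -
        z.im • quadInv T z (leftMul J v) - leftSResolvent (planeEmb hJ z) T v := by
      rw [e1]; abel
    have b2 : ‖z.re • quadInv T z v‖ ≤ ‖z‖ * (C * K / Real.sin φ / ‖z‖ ^ 2 * ‖v‖) := by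
      rw [norm_smul]
      exact mul_le_mul (Complex.abs_re_le_norm z) (hB v) (norm_nonneg _) (norm_nonneg _)
    have b3 := hyB v
    have b4 := norm_sub_le (z.re • quadInv T z v - z.im • quadInv T z (leftMul J v))
      (leftSResolvent (planeEmb hJ z) T v)
    have b5 := norm_sub_le (z.re • quadInv T z v) (z.im • quadInv T z (leftMul J v))
    rw [← e2] at b4
    have e3 : (C * K / Real.sin φ + 2 * C) / ‖z‖ * ‖v‖ =
        ‖z‖ * (C * K / Real.sin φ / ‖z‖ ^ 2 * ‖v‖) + C / ‖z‖ * ‖v‖ + C / ‖z‖ * ‖v‖ := by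
      field_simp
      ring
    rw [e3]
    linarith

end Bounds

end CliffordOmega

namespace CliffordOmega

open Polynomial

variable {n : ℕ} {E : Type*} [NormedAddCommGroup E] [NormedSpace ℝ E]

/-! ### Norm continuity of the resolvent, needed for measurability of the integrands. -/

section Continuity

open Filter Topology

variable {T : CliffordModule n E →ₗ.[ℝ] CliffordModule n E}

/-- The identity Q_z⁻¹ = Q_{z₀}⁻¹ + Q_z⁻¹ (Q_{z₀} - Q_z) Q_{z₀}⁻¹. The T² terms cancel in the
difference, so only T Q_{z₀}⁻¹ and Q_{z₀}⁻¹ occur, both bounded. -/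
theorem quadInv_sub_apply {W : Type*} [NormedAddCommGroup W] [NormedSpace ℝ W] {T : W →ₗ.[ℝ] W}
    {z z₀ : ℂ} (h : HasQuadInv T z) (h₀ : HasQuadInv T z₀) (v : W) :
    quadInv T z v = quadInv T z₀ v + quadInv T z ((2 * (z.re - z₀.re)) •
      extZero T (quadInv T z₀ v) - (‖z‖ ^ 2 - ‖z₀‖ ^ 2) • quadInv T z₀ v) := by
  have h1 := quadInv_polyAct h (quadInv_mem_two h₀ v)
  rw [polyAct_quad, extZero_extZero_quadInv h₀] at h1
  nth_rw 1 [← h1]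
  rw [← map_add]
  congr 1
  module

variable [CompleteSpace E] {ω : ℝ}

/-- The operators `Q_z[T]⁻¹` and `T Q_z[T]⁻¹` depend continuously on `z` in the operator norm. -/
theorem HasSectorialBounds.continuousAt_quadInv (hT : HasSectorialBounds T ω) (hcl : T.IsClosed)
    (hω : ω < Real.pi / 2) {z₀ : ℂ} (hz₀ : z₀ ∈ openOuterCone ω) :
    ContinuousAt (quadInv T) z₀ ∧ ContinuousAt (mulQuadInv T) z₀ := by
  obtain ⟨φ, hφ, hz₀φ⟩ := exists_mem_openOuterCone hω hz₀
  have hz0 : ‖z₀‖ ≠ 0 := norm_ne_zero_iff.2 (openOuterCone_subset _ hz₀).1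
  have h₀ := hT.hasQuadInv z₀ hz₀
  obtain ⟨C, hC, hb⟩ := hT.bound φ hφ
  let D : ℂ → (CliffordModule n E →L[ℝ] CliffordModule n E) := fun z =>
    (2 * (z.re - z₀.re)) • mulQuadInv T z₀ - (‖z‖ ^ 2 - ‖z₀‖ ^ 2) • quadInv T z₀
  have hD : Continuous D := by fun_prop
  have hD0 : D z₀ = 0 := by simp [D]
  have hDv : ∀ z v, D z v = (2 * (z.re - z₀.re)) • extZero T (quadInv T z₀ v) -
      (‖z‖ ^ 2 - ‖z₀‖ ^ 2) • quadInv T z₀ v := fun z v => by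
    rw [← mulQuadInv_apply hcl h₀]
    rfl
  have hnhds : ∀ᶠ z in 𝓝 z₀, z ∈ openOuterCone φ ∧ z ∈ openOuterCone ω := by
    filter_upwards [(isOpen_openOuterCone φ).mem_nhds hz₀φ,
      (isOpen_openOuterCone ω).mem_nhds hz₀] with z h h' using ⟨h, h'⟩
  have hlim : ∀ f : ℂ → ℝ, ContinuousAt f z₀ →
      Tendsto (fun z => f z * ‖D z‖) (𝓝 z₀) (𝓝 0) := fun f hf => by
    have h : Tendsto (fun z => f z * ‖D z‖) (𝓝 z₀) (𝓝 (f z₀ * ‖D z₀‖)) :=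
      hf.mul hD.norm.continuousAt
    rwa [hD0, norm_zero, mul_zero] at h
  constructor
  · rw [ContinuousAt, tendsto_iff_norm_sub_tendsto_zero]
    refine squeeze_zero' (Eventually.of_forall fun _ => norm_nonneg _) ?_
      (hlim (fun z => C / ‖z‖ ^ 2) (by fun_prop (disch := simpa using hz0)))
    filter_upwards [hnhds] with z hz
    have h := hT.hasQuadInv z hz.2
    have hbz := (hb z (openOuterCone_subset _ hz.1)).1
    refine ContinuousLinearMap.opNorm_le_bound _ (by positivity) fun v => ?_
    rw [sub_apply, quadInv_sub_apply h h₀, add_sub_cancel_left, ← hDv, mul_assoc]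
    exact (hbz _).trans (mul_le_mul_of_nonneg_left ((D z).le_opNorm v) (by positivity))
  · rw [ContinuousAt, tendsto_iff_norm_sub_tendsto_zero]
    refine squeeze_zero' (Eventually.of_forall fun _ => norm_nonneg _) ?_
      (hlim (fun z => C / ‖z‖) (by fun_prop (disch := simpa using hz0)))
    filter_upwards [hnhds] with z hz
    have h := hT.hasQuadInv z hz.2
    have hbz := (hb z (openOuterCone_subset _ hz.1)).2
    refine ContinuousLinearMap.opNorm_le_bound _ (by positivity) fun v => ?_
    rw [sub_apply, mulQuadInv_apply hcl h, mulQuadInv_apply hcl h₀, quadInv_sub_apply h h₀,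
      extZero_add (quadInv_mem h₀ _) (quadInv_mem h _), add_sub_cancel_left, ← hDv, mul_assoc]
    exact (hbz _).trans (mul_le_mul_of_nonneg_left ((D z).le_opNorm v) (by positivity))

theorem HasSectorialBounds.continuousOn_leftSResolvent (hT : HasSectorialBounds T ω)
    (hcl : T.IsClosed) (hω : ω < Real.pi / 2) {J : Cl n} (hJ : J ∈ imagSphere n) :
    ContinuousOn (fun z => leftSResolvent (planeEmb hJ z) T) (openOuterCone ω) := by
  intro z hz
  obtain ⟨h1, h2⟩ := hT.continuousAt_quadInv hcl hω hz
  simp only [leftSResolvent_planeEmb]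
  have h3 : ContinuousAt (fun z => leftMulPlane (E := E) hJ (starRingEnd ℂ z)) z :=
    ((continuous_leftMulPlane hJ).comp Complex.continuous_conj).continuousAt
  exact ((h1.clm_comp h3).sub h2).continuousWithinAt

end Continuity

/-! ### The paths in `ℂ_J` and absolute convergence. -/

section PathIntegral

open MeasureTheory

theorem cPath_re (φ t : ℝ) : (cPath φ t).re = |t| * Real.cos φ := by
  simp [cPath, -Complex.ofReal_mul]

theorem cPath_im (φ t : ℝ) : (cPath φ t).im = -(t * Real.sin φ) := by
  simp [cPath, -Complex.ofReal_mul]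

theorem norm_cPath (φ t : ℝ) : ‖cPath φ t‖ = |t| := by
  refine (sq_eq_sq₀ (norm_nonneg _) (abs_nonneg _)).1 ?_
  rw [Complex.sq_norm, Complex.normSq_apply, cPath_re, cPath_im]
  have := sq_abs t
  linear_combination (Real.cos φ ^ 2 - 1) * this + t ^ 2 * Real.sin_sq_add_cos_sq φ

theorem norm_cPathDeriv (φ : ℝ) {t : ℝ} (ht : t ≠ 0) : ‖cPathDeriv φ t‖ = 1 := by
  refine (sq_eq_sq₀ (norm_nonneg _) zero_le_one).1 ?_
  have h1 : (cPathDeriv φ t).re = Real.sign t * Real.cos φ := by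
    simp [cPathDeriv, -Complex.ofReal_mul, -Complex.ofReal_sin]
  have h2 : (cPathDeriv φ t).im = -Real.sin φ := by
    simp [cPathDeriv, -Complex.ofReal_mul, -Complex.ofReal_sin]
  have h3 : Real.sign t * Real.sign t = 1 := by
    rcases Real.sign_apply_eq_of_ne_zero t ht with h | h <;> rw [h] <;> norm_num
  rw [Complex.sq_norm, Complex.normSq_apply, h1, h2]
  linear_combination Real.cos φ ^ 2 * h3 + Real.sin_sq_add_cos_sq φ

theorem hasDerivAt_cPath (φ : ℝ) {t : ℝ} (ht : t ≠ 0) :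
    HasDerivAt (cPath φ) (cPathDeriv φ t) t := by
  have h1 : HasDerivAt (fun t : ℝ => |t|) (Real.sign t) t := by
    rcases lt_or_gt_of_ne ht with h | h
    · rw [Real.sign_of_neg h]
      exact hasDerivAt_abs_neg h
    · rw [Real.sign_of_pos h]
      exact hasDerivAt_abs_pos h
  have h2 := ((h1.mul_const (Real.cos φ)).ofReal_comp).sub
    ((((hasDerivAt_id t).mul_const (Real.sin φ)).ofReal_comp).mul_const Complex.I)
  rw [one_mul] at h2
  exact h2

theorem continuous_cPath (φ : ℝ) : Continuous (cPath φ) := by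
  unfold cPath
  fun_prop

theorem measurable_cPathDeriv (φ : ℝ) : Measurable (cPathDeriv φ) := by
  have : Measurable Real.sign := by
    unfold Real.sign
    exact Measurable.ite measurableSet_Iio measurable_const
      (Measurable.ite measurableSet_Ioi measurable_const measurable_const)
  unfold cPathDeriv
  fun_prop

theorem cPath_mem_outerCone {φ : ℝ} (h0 : 0 < φ) (hφ : φ < Real.pi / 2) {t : ℝ} (ht : t ≠ 0) :
    cPath φ t ∈ outerCone φ ∧ cPath φ t ∉ openOuterCone φ := by
  have hs : 0 < Real.sin φ := Real.sin_pos_of_pos_of_lt_pi h0 (by linarith)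
  have hc : 0 < Real.cos φ := Real.cos_pos_of_mem_Ioo ⟨by linarith, hφ⟩
  have h : |(cPath φ t).re| * Real.sin φ = |(cPath φ t).im| * Real.cos φ := by
    rw [cPath_re, cPath_im, abs_neg, abs_mul, abs_mul, abs_abs, abs_of_pos hs, abs_of_pos hc]
    ring
  refine ⟨⟨?_, h.le⟩, fun hcon => ?_⟩
  · rw [← norm_ne_zero_iff, norm_cPath]
    exact abs_ne_zero.2 ht
  · exact absurd h (ne_of_lt hcon)

theorem sign_mul_mem_outerCone {φ : ℝ} {σ z : ℂ} (hσ : σ = 1 ∨ σ = -1)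
    (hz : z ∈ outerCone φ ∧ z ∉ openOuterCone φ) :
    σ * z ∈ outerCone φ ∧ σ * z ∉ openOuterCone φ := by
  rcases hσ with rfl | rfl
  · rwa [one_mul]
  · rw [neg_one_mul]
    exact ⟨neg_mem_outerCone hz.1, mt neg_mem_openOuterCone_iff.1 hz.2⟩

theorem norm_sign {σ : ℂ} (hσ : σ = 1 ∨ σ = -1) : ‖σ‖ = 1 := by
  rcases hσ with rfl | rfl <;> simp

/-- Absolute convergence of the path integrals. -/
theorem integrable_smul_cPath {X : Type*} [NormedAddCommGroup X] [NormedSpace ℝ X] {ω φ C M : ℝ}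
    (hω : 0 < ω) (hφ : φ ∈ Set.Ioo ω (Real.pi / 2)) {A : ℂ → X}
    (hA : ContinuousOn A (openOuterCone ω)) (hC : ∀ z ∈ outerCone φ, ‖A z‖ ≤ C / ‖z‖)
    {σ : ℂ} (hσ : σ = 1 ∨ σ = -1) {g : ℝ → ℝ} (hg : Measurable g)
    (hM : ∀ t ≠ 0, |g t| ≤ M * |t| / (1 + t ^ 2)) :
    Integrable fun t => g t • A (σ * cPath φ t) := by
  have h0 : 0 < φ := hω.trans hφ.1
  have hmem : ∀ t ≠ 0, σ * cPath φ t ∈ outerCone φ := fun t ht =>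
    (sign_mul_mem_outerCone hσ (cPath_mem_outerCone h0 hφ.2 ht)).1
  have hcont : ContinuousOn (fun t => A (σ * cPath φ t)) {0}ᶜ :=
    hA.comp (continuous_const.mul (continuous_cPath φ)).continuousOn fun t ht =>
      outerCone_subset_openOuterCone hω hφ.1 hφ.2 (hmem t ht)
  have hmeas : AEStronglyMeasurable (fun t => A (σ * cPath φ t)) := by
    have := hcont.aestronglyMeasurable (μ := volume) (measurableSet_singleton (0 : ℝ)).compl
    rwa [Measure.restrict_eq_self_of_ae_mem] at this
    exact Measure.ae_ne volume 0
  refine (integrable_inv_one_add_sq.const_mul (M * C)).mono'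
    (hg.aestronglyMeasurable.smul hmeas) ?_
  filter_upwards [Measure.ae_ne volume (0 : ℝ)] with t ht
  have h1 := hC _ (hmem t ht)
  rw [norm_mul, norm_sign hσ, norm_cPath, one_mul] at h1
  have ht' : 0 < |t| := abs_pos.2 ht
  rw [norm_smul, Real.norm_eq_abs]
  calc |g t| * ‖A (σ * cPath φ t)‖ ≤ (M * |t| / (1 + t ^ 2)) * (C / |t|) :=
        mul_le_mul (hM t ht) h1 (norm_nonneg _) ((abs_nonneg _).trans (hM t ht))
    _ = M * C * (1 + t ^ 2)⁻¹ := by field_simp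

variable {J : Cl n} (hJ : J ∈ imagSphere n)

theorem boundaryPath_eq (φ : ℝ) : boundaryPath J φ = fun t => planeEmb hJ (cPath φ t) := by
  ext1 t
  rw [planeEmb_apply, cPath_re, cPath_im, boundaryPath, polar, Real.cos_neg, Real.sin_neg]
  rcases lt_trichotomy t 0 with h | rfl | h
  · rw [Real.sign_of_neg h, neg_one_mul, Real.cos_neg, Real.sin_neg, abs_of_neg h, neg_neg,
      neg_mul t, neg_mul t]
  · simp
  · rw [Real.sign_of_pos h, one_mul, abs_of_pos h, mul_neg]

variable (T : CliffordModule n E →ₗ.[ℝ] CliffordModule n E)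

/-- The path has a corner at t = 0, where `deriv` need not agree with `cPathDeriv`; that single
point does not affect the integrals. -/
theorem pathIntegrand_eq (p q : ℝ[X]) (φ : ℝ) (σ : ℂ) {t : ℝ} (ht : t ≠ 0) :
    pathIntegrand T (ratFun p q) J (fun t => planeEmb hJ (σ * cPath φ t)) t =
      (leftSResolvent (planeEmb hJ (σ * cPath φ t)) T).comp (leftMulPlane hJ
        (σ * cPathDeriv φ t / Complex.I *
          (aeval (σ * cPath φ t) p / aeval (σ * cPath φ t) q))) := by
  have hd : HasDerivAt (fun t => planeEmb hJ (σ * cPath φ t))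
      (planeEmb hJ (σ * cPathDeriv φ t)) t :=
    ((planeEmb hJ).toLinearMap.toContinuousLinearMap.hasFDerivAt).comp_hasDerivAt t
      ((hasDerivAt_cPath φ ht).const_mul σ)
  rw [pathIntegrand, hd.deriv, ratFun_planeEmb, leftMulPlane_apply]
  congr 2
  have hi : Ring.inverse J = planeEmb hJ Complex.I⁻¹ :=
    (congrArg Ring.inverse (planeEmb_I hJ)).symm.trans (inverse_planeEmb hJ Complex.I)
  rw [hi, ← map_mul, ← map_mul, div_eq_mul_inv _ Complex.I]

end PathIntegral

end CliffordOmega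

namespace CliffordOmega

open Polynomial

variable {n : ℕ} {E : Type*} [NormedAddCommGroup E] [NormedSpace ℝ E]

/-! ### Rational functions without poles in the closed double sector. -/

section RationalFunctions

/-- The factor X gives linear vanishing at 0 and the degree gap gives decay like 1/|z|. With the
resolvent bound C/|z| the integrand becomes O(1/(1 + t²)). -/
theorem exists_norm_rat_le {θ : ℝ} {p q : ℝ[X]} (hpq : p = 0 ∨ p.natDegree + 2 ≤ q.natDegree)
    (hq0 : q ≠ 0) (hq : ∀ z ∉ openOuterCone θ, aeval z q ≠ 0) :
    ∃ M : ℝ, 0 ≤ M ∧ ∀ z ∉ openOuterCone θ,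
      ‖aeval z (X * p) / aeval z q‖ ≤ M * ‖z‖ / (1 + ‖z‖ ^ 2) := by
  rcases hpq with rfl | hdeg
  · exact ⟨0, le_rfl, fun z _ => by simp⟩
  have hmap : ∀ (r : ℝ[X]) (z : ℂ), aeval z r = (r.map (algebraMap ℝ ℂ)).eval z := fun r z => by
    rw [eval_map_algebraMap]
  obtain ⟨c, hc, h⟩ := exists_le_norm_eval (isClosed_compl_openOuterCone θ)
    (q := q.map (algebraMap ℝ ℂ)) (by rwa [Ne, Polynomial.map_eq_zero])
    (fun z hz => by rw [← hmap]; exact hq z hz)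
  obtain ⟨C, hC, h'⟩ := exists_norm_eval_le (p.map (algebraMap ℝ ℂ)) (N := q.natDegree - 2)
    (by rw [natDegree_map]; omega)
  refine ⟨C / c, by positivity, fun z hz => ?_⟩
  have h1 := h z hz
  have h2 := h' z
  rw [← hmap] at h1 h2
  rw [natDegree_map] at h1
  have hq1 : 0 < ‖aeval z q‖ := norm_pos_iff.2 (hq z hz)
  have hz0 := norm_nonneg z
  rw [map_mul, aeval_X, norm_div, norm_mul, div_mul_eq_mul_div, div_div,
    div_le_div_iff₀ hq1 (by positivity)]
  have h3 : (1 + ‖z‖) ^ q.natDegree = (1 + ‖z‖) ^ (q.natDegree - 2) * (1 + ‖z‖) ^ 2 := by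
    rw [← pow_add]
    congr 1
    omega
  have h4 : 1 + ‖z‖ ^ 2 ≤ (1 + ‖z‖) ^ 2 := by nlinarith
  calc ‖z‖ * ‖aeval z p‖ * (c * (1 + ‖z‖ ^ 2))
      ≤ ‖z‖ * (C * (1 + ‖z‖) ^ (q.natDegree - 2)) * (c * (1 + ‖z‖) ^ 2) := by gcongr
    _ = C * ‖z‖ * (c * (1 + ‖z‖) ^ q.natDegree) := by rw [h3]; ring
    _ ≤ C * ‖z‖ * ‖aeval z q‖ := by gcongr

/-- A polynomial without zeros in a closed double sector has no zeros in a larger one. -/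
theorem exists_angle {ω : ℝ} (hω : ω < Real.pi / 2) {q : ℝ[X]} (hq0 : q ≠ 0)
    (hq : ∀ z ∉ openOuterCone ω, aeval z q ≠ 0) :
    ∃ θ ∈ Set.Ioo ω (Real.pi / 2), ∀ z ∉ openOuterCone θ, aeval z q ≠ 0 := by
  have hmap0 : q.map (algebraMap ℝ ℂ) ≠ 0 := by rwa [Ne, Polynomial.map_eq_zero]
  have h1 : ∀ z ∈ (q.map (algebraMap ℝ ℂ)).roots.toFinset,
      ∀ᶠ θ in nhdsWithin ω (Set.Ioi ω), z ∈ openOuterCone θ := by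
    intro z hz
    rw [Multiset.mem_toFinset, mem_roots hmap0, IsRoot, eval_map_algebraMap] at hz
    have hz' : z ∈ openOuterCone ω := by
      by_contra hcon
      exact hq z hcon hz
    have : IsOpen {θ : ℝ | |z.re| * Real.sin θ < |z.im| * Real.cos θ} :=
      isOpen_lt (by fun_prop) (by fun_prop)
    exact mem_nhdsWithin_of_mem_nhds (this.mem_nhds hz')
  obtain ⟨θ, h, hθ⟩ := (((Filter.eventually_all_finset _).2 h1).and (Ioo_mem_nhdsGT hω)).exists
  refine ⟨θ, hθ, fun z hz h0 => hz (h z ?_)⟩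
  rwa [Multiset.mem_toFinset, mem_roots hmap0, IsRoot, eval_map_algebraMap]

/-- Every complex zero z of q lies in the open outer cone and is therefore not real. So the real
polynomial `quad z` divides q, and induction on the degree peels off one bijective factor Q_z[T] at
a time. -/
theorem bijectivePoly_of_roots {W : Type*} [NormedAddCommGroup W] [NormedSpace ℝ W]
    {T : W →ₗ.[ℝ] W} {ω : ℝ} (hT : ∀ z ∈ openOuterCone ω, HasQuadInv T z) (h0 : 0 < ω)
    (hω : ω < Real.pi / 2) {q : ℝ[X]} (hq0 : q ≠ 0)
    (hq : ∀ z ∉ openOuterCone ω, aeval z q ≠ 0) : BijectivePoly T q := by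
  induction hN : q.natDegree using Nat.strong_induction_on generalizing q with
  | _ N ih =>
    rcases Nat.eq_zero_or_pos N with rfl | hpos
    · obtain ⟨a, rfl⟩ := natDegree_eq_zero.1 hN
      exact bijectivePoly_C fun h => hq0 (by rw [h, C_0])
    · obtain ⟨z, hz⟩ := IsAlgClosed.exists_aeval_eq_zero ℂ q (by
        rw [Ne, degree_eq_natDegree hq0, hN]
        exact_mod_cast hpos.ne')
      have hzo : z ∈ openOuterCone ω := by
        by_contra hcon
        exact hq z hcon hz
      have him : z.im ≠ 0 := by
        intro h
        have h1 : |z.re| * Real.sin ω < |z.im| * Real.cos ω := hzo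
        rw [h, abs_zero, zero_mul] at h1
        have : 0 < Real.sin ω := Real.sin_pos_of_pos_of_lt_pi h0 (by linarith)
        exact absurd h1 (not_lt.2 (by positivity))
      obtain ⟨r, hr⟩ := q.quadratic_dvd_of_aeval_eq_zero_im_ne_zero hz him
      change q = quad z * r at hr
      have hr0 : r ≠ 0 := by
        rintro rfl
        exact hq0 (by rw [hr, mul_zero])
      have hdeg := natDegree_mul (quad_ne_zero z) hr0
      rw [← hr, natDegree_quad, hN] at hdeg
      obtain ⟨B, hB⟩ := hT z hzo
      rw [hr]
      refine BijectivePoly.mul (quad_ne_zero z) hr0 hB.bijectivePoly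
        (ih r.natDegree (by omega) hr0 (fun w hw hcon => hq w hw ?_) rfl)
      rw [hr, map_mul, hcon, mul_zero]

theorem planeSet_doubleSector (hn : 1 ≤ n) {θ : ℝ} (h0 : 0 < θ) (hθ : θ < Real.pi / 2)
    (x : ℝ × ℝ) :
    x ∈ planeSet (doubleSector n θ) ↔ Complex.equivRealProdCLM.symm x ∈ innerCone θ := by
  have h : ∀ {J : Cl n} (hJ : J ∈ imagSphere n), x.1 • (1 : Cl n) + x.2 • J =
      planeEmb hJ (Complex.equivRealProdCLM.symm x) := fun hJ => by
    rw [planeEmb_apply]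
    simp
  constructor
  · intro hx
    obtain ⟨J, hJ⟩ := nonempty_imagSphere hn
    have := hx J hJ
    rwa [h hJ, planeEmb_mem_doubleSector_iff hJ h0 hθ] at this
  · intro hx J hJ
    rwa [h hJ, planeEmb_mem_doubleSector_iff hJ h0 hθ]

theorem isIntrinsic_ratFun (hn : 1 ≤ n) {θ : ℝ} (h0 : 0 < θ) (hθ : θ < Real.pi / 2) (p : ℝ[X])
    {q : ℝ[X]} (hq : ∀ z ∉ openOuterCone θ, aeval z q ≠ 0) :
    IsIntrinsic (doubleSector n θ) (ratFun p q) := by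
  set e : (ℝ × ℝ) ≃L[ℝ] ℂ := Complex.equivRealProdCLM.symm with he
  set r : ℂ → ℂ := fun z => aeval z p / aeval z q with hr
  let ι : ℝ →L[ℝ] Cl n := ContinuousLinearMap.toSpanSingleton ℝ (1 : Cl n)
  have hι : ∀ a, ι a = algebraMap ℝ (Cl n) a := fun a => by
    rw [Algebra.algebraMap_eq_smul_one]
    exact ContinuousLinearMap.toSpanSingleton_apply _ _ _
  have hmem := planeSet_doubleSector (n := n) hn h0 hθ
  have hqx : ∀ x ∈ planeSet (doubleSector n θ), aeval (e x) q ≠ 0 := fun x hx =>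
    hq _ (notMem_openOuterCone_of_mem_innerCone ((hmem x).1 hx))
  have hrd : ∀ x ∈ planeSet (doubleSector n θ), ContDiffAt ℂ 1 r (e x) := fun x hx =>
    (p.contDiff_aeval 1).contDiffAt.div (q.contDiff_aeval 1).contDiffAt (hqx x hx)
  have hre : ∀ x ∈ planeSet (doubleSector n θ), ContDiffAt ℝ 1 (fun x => r (e x)) x :=
    fun x hx => ((hrd x hx).restrict_scalars ℝ).comp x e.contDiff.contDiffAt
  -- With d the complex derivative of r, the real derivative is v ↦ e(v) d; its values d and i d on
  -- the two coordinate vectors give both Cauchy-Riemann equations.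
  have hfd : ∀ x ∈ planeSet (doubleSector n θ), ∃ d : ℂ, ∀ L : ℂ →L[ℝ] ℝ, ∀ v,
      fderiv ℝ (fun x => ι (L (r (e x)))) x v = ι (L (e v * d)) := by
    intro x hx
    refine ⟨deriv r (e x), fun L v => ?_⟩
    have h1 : HasDerivAt r (deriv r (e x)) (e x) :=
      ((hrd x hx).differentiableAt one_ne_zero).hasDerivAt
    have h2 := (h1.hasFDerivAt.restrictScalars ℝ).comp x e.hasFDerivAt
    have h3 := (ι.comp L).hasFDerivAt.comp x h2
    have h4 : fderiv ℝ (fun x => ι (L (r (e x)))) x = _ := h3.fderiv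
    rw [h4]
    simp
  -- Real coefficients of p and q yield the even and odd parity of the two components.
  have hconj : ∀ x : ℝ × ℝ, r (e (x.1, -x.2)) = starRingEnd ℂ (r (e x)) := by
    intro x
    have : e (x.1, -x.2) = starRingEnd ℂ (e x) := by
      apply Complex.ext <;> simp [he]
    rw [this, hr]
    simp only [map_div₀, Polynomial.aeval_conj]
  refine ⟨fun x => ι (r (e x)).re, fun x => ι (r (e x)).im, ⟨?_, ?_, ?_, ?_, ?_, ?_, ?_⟩,
    fun x _ => ⟨⟨_, hι _⟩, ⟨_, hι _⟩⟩⟩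
  · exact fun x hx => ((ι.comp Complex.reCLM).contDiff.contDiffAt.comp x
      (hre x hx)).contDiffWithinAt
  · exact fun x hx => ((ι.comp Complex.imCLM).contDiff.contDiffAt.comp x
      (hre x hx)).contDiffWithinAt
  · intro x hx J hJ
    have h1 : x.1 • (1 : Cl n) + x.2 • J = planeEmb hJ (e x) := by
      rw [planeEmb_apply]
      simp [he]
    rw [h1, ratFun_planeEmb, planeEmb_apply, hι, hι, Algebra.algebraMap_eq_smul_one,
      Algebra.algebraMap_eq_smul_one, mul_smul_comm, mul_one]
  · intro x _
    simp only [hconj, Complex.conj_re]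
  · intro x _
    simp only [hconj, Complex.conj_im, map_neg]
  · intro x hx
    obtain ⟨d, hd⟩ := hfd x hx
    have h1 := hd Complex.reCLM (1, 0)
    have h2 := hd Complex.imCLM (0, 1)
    simp only [Complex.reCLM_apply, Complex.imCLM_apply] at h1 h2
    rw [h1, h2]
    simp [he]
  · intro x hx
    obtain ⟨d, hd⟩ := hfd x hx
    have h1 := hd Complex.reCLM (0, 1)
    have h2 := hd Complex.imCLM (1, 0)
    simp only [Complex.reCLM_apply, Complex.imCLM_apply] at h1 h2
    rw [h1, h2]
    simp [he]

theorem memNZero_ratFun (hn : 1 ≤ n) {θ : ℝ} (h0 : 0 < θ) (hθ : θ < Real.pi / 2) {p q : ℝ[X]}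
    (hpq : p = 0 ∨ p.natDegree + 2 ≤ q.natDegree) (hq0 : q ≠ 0)
    (hq : ∀ z ∉ openOuterCone θ, aeval z q ≠ 0) : MemNZero (n := n) θ (ratFun (X * p) q) := by
  obtain ⟨M, hM, hb⟩ := exists_norm_rat_le hpq hq0 hq
  have hsector : ∀ {J : Cl n} (hJ : J ∈ imagSphere n) {t φ : ℝ}, 0 < t → φ ∈ angles θ →
      (t * Complex.exp (φ * Complex.I) : ℂ) ∉ openOuterCone θ := by
    intro J hJ t φ ht hφ
    refine notMem_openOuterCone_of_mem_innerCone ((planeEmb_mem_doubleSector_iff hJ h0 hθ).1 ?_)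
    exact ⟨J, hJ, t, ht, φ, hφ, (polar_eq hJ t φ).symm⟩
  have hnorm : ∀ t φ : ℝ, 0 < t → ‖(t * Complex.exp (φ * Complex.I) : ℂ)‖ = t := by
    intro t φ ht
    rw [norm_mul, Complex.norm_exp_ofReal_mul_I, mul_one, Complex.norm_real, Real.norm_of_nonneg
      ht.le]
  have hle : ∀ {J : Cl n} (_ : J ∈ imagSphere n) {t φ : ℝ}, 0 < t → φ ∈ angles θ →
      ‖ratFun (X * p) q (polar J t φ)‖ ≤ M * t / (1 + t ^ 2) := by
    intro J hJ t φ ht hφ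
    rw [polar_eq hJ, ratFun_planeEmb, norm_planeEmb]
    have := hb _ (hsector hJ ht hφ)
    rwa [hnorm t φ ht] at this
  refine ⟨isIntrinsic_ratFun hn h0 hθ _ hq, ⟨M, ?_⟩, ?_⟩
  · rintro s ⟨J, hJ, t, ht, φ, hφ, rfl⟩
    refine (hle hJ ht hφ).trans ?_
    rw [div_le_iff₀ (by positivity)]
    exact mul_le_mul_of_nonneg_left (by nlinarith [sq_nonneg (t - 1)]) hM
  · intro J hJ φ hφ
    have hmeas : Measurable fun t : ℝ => ‖ratFun (X * p) q (polar J t φ)‖ / t := by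
      have : ∀ t : ℝ, ‖ratFun (X * p) q (polar J t φ)‖ =
          ‖aeval (t * Complex.exp (φ * Complex.I) : ℂ) (X * p) /
            aeval (t * Complex.exp (φ * Complex.I) : ℂ) q‖ := fun t => by
        rw [polar_eq hJ, ratFun_planeEmb, norm_planeEmb]
      simp only [this]
      have h1 : ∀ r : ℝ[X], Measurable fun t : ℝ => aeval (t * Complex.exp (φ * Complex.I) : ℂ) r :=
        fun r => (r.continuous_aeval.comp (by fun_prop : Continuous fun t : ℝ =>
          (t * Complex.exp (φ * Complex.I) : ℂ))).measurable
      exact ((h1 _).div (h1 _)).norm.div measurable_id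
    refine (MeasureTheory.Integrable.integrableOn (f := fun t : ℝ => M * (1 + t ^ 2)⁻¹)
      (integrable_inv_one_add_sq.const_mul M)).mono' hmeas.aestronglyMeasurable ?_
    filter_upwards [MeasureTheory.ae_restrict_mem measurableSet_Ioi] with t ht
    have ht' : 0 < t := ht
    rw [Real.norm_of_nonneg (by positivity), div_le_iff₀ ht']
    refine (hle hJ ht' hφ).trans (le_of_eq ?_)
    field_simp

end RationalFunctions

end CliffordOmega

namespace CliffordOmega

open Polynomial

variable {n : ℕ} {E : Type*} [NormedAddCommGroup E] [NormedSpace ℝ E]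

/-! ### The operator integrals evaluated through scalar ones. -/

section Calculus

open MeasureTheory

variable {T : CliffordModule n E →ₗ.[ℝ] CliffordModule n E} {J : Cl n} (hJ : J ∈ imagSphere n)

/-- The weight `γ'(t) / i * p(γ(t)) / q(γ(t))` for the path `γ = σ γ₊`. -/
noncomputable def pathWeight (p q : ℝ[X]) (φ : ℝ) (σ : ℂ) (t : ℝ) : ℂ :=
  σ * cPathDeriv φ t / Complex.I * (aeval (σ * cPath φ t) p / aeval (σ * cPath φ t) q)

theorem measurable_pathWeight (p q : ℝ[X]) (φ : ℝ) (σ : ℂ) : Measurable (pathWeight p q φ σ) := by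
  have h1 : ∀ r : ℝ[X], Measurable fun t : ℝ => aeval (σ * cPath φ t) r := fun r =>
    (r.continuous_aeval.comp (continuous_const.mul (continuous_cPath φ))).measurable
  exact ((measurable_const.mul (measurable_cPathDeriv φ)).div measurable_const).mul
    ((h1 p).div (h1 q))

theorem norm_pathWeight_le {p q : ℝ[X]} {φ M : ℝ} (h0 : 0 < φ) (hφ : φ < Real.pi / 2)
    (hM : ∀ z ∉ openOuterCone φ, ‖aeval z p / aeval z q‖ ≤ M * ‖z‖ / (1 + ‖z‖ ^ 2)) {σ : ℂ}
    (hσ : σ = 1 ∨ σ = -1) {t : ℝ} (ht : t ≠ 0) :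
    ‖pathWeight p q φ σ t‖ ≤ M * |t| / (1 + t ^ 2) := by
  have h1 := hM _ (sign_mul_mem_outerCone hσ (cPath_mem_outerCone h0 hφ ht)).2
  rw [norm_mul, norm_sign hσ, one_mul, norm_cPath, sq_abs] at h1
  rw [pathWeight, norm_mul, norm_div, norm_mul, norm_sign hσ, norm_cPathDeriv φ ht, Complex.norm_I,
    one_mul, div_one, one_mul]
  exact h1

theorem comp_leftMulPlane (A : CliffordModule n E →L[ℝ] CliffordModule n E) (c : ℂ) :
    A.comp (leftMulPlane hJ c) = c.re • A + c.im • A.comp (leftMul J) := by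
  ext1 v
  rw [ContinuousLinearMap.comp_apply, leftMulPlane_apply, leftMul_planeEmb, map_add, map_smul,
    map_smul]
  rfl

/-- The bridge between the Clifford and the complex setting: J does not pass through Q_z[T]⁻¹, so
both v and J v must be paired, and J² = -1 sorts the terms into a real and an imaginary part. -/
theorem apply_leftSResolvent_leftMulPlane [CompleteSpace E] (hcl : T.IsClosed) {z : ℂ}
    (h : HasQuadInv T z) (l : StrongDual ℝ (CliffordModule n E)) (v : CliffordModule n E) (c : ℂ) :
    l (leftSResolvent (planeEmb hJ z) T (leftMulPlane hJ c v)) =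
      (c * resPairing T l v z).re + (c * resPairing T l (leftMul J v) z).im := by
  have h1 := comp_leftMulPlane hJ (leftSResolvent (planeEmb hJ z) T) c
  have h2 := DFunLike.congr_fun h1 v
  have h3 : leftSResolvent (planeEmb hJ z) T (leftMulPlane hJ c v) =
    c.re • leftSResolvent (planeEmb hJ z) T v +
      c.im • leftSResolvent (planeEmb hJ z) T (leftMul J v) := h2
  rw [h3, leftSResolvent_planeEmb_apply hJ hcl h, leftSResolvent_planeEmb_apply hJ hcl h,
    leftMul_leftMul_of_mem_imagSphere hJ]
  simp only [resPairing, map_add, map_sub, map_smul, map_neg, smul_eq_mul, Complex.mul_re,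
    Complex.mul_im, Complex.sub_re, Complex.sub_im, Complex.conj_re, Complex.conj_im,
    Complex.ofReal_re, Complex.ofReal_im]
  ring

variable {ω θ φ : ℝ}

theorem integrable_pathWeight_mul_resPairing (hω : 0 < ω) (hT : HasSectorialBounds T ω)
    (hφ : φ ∈ Set.Ioo ω (Real.pi / 2)) {p q : ℝ[X]} {M : ℝ}
    (hM : ∀ z ∉ openOuterCone φ, ‖aeval z p / aeval z q‖ ≤ M * ‖z‖ / (1 + ‖z‖ ^ 2)) {σ : ℂ}
    (hσ : σ = 1 ∨ σ = -1) (l : StrongDual ℝ (CliffordModule n E)) (v : CliffordModule n E) :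
    Integrable fun t => pathWeight p q φ σ t * resPairing T l v (σ * cPath φ t) := by
  obtain ⟨C, -, hC⟩ := hT.norm_resPairing_le hφ l v
  have hcont : ContinuousOn (resPairing T l v) (openOuterCone ω) := fun z hz =>
    (hT.continuousAt_resPairing (hφ.1.trans hφ.2) l v hz).continuousWithinAt
  have hw := measurable_pathWeight p q φ σ
  have hwb := fun t (ht : t ≠ 0) => norm_pathWeight_le (hω.trans hφ.1) hφ.2 hM hσ ht
  have h1 := integrable_smul_cPath hω hφ hcont hC hσ (Complex.measurable_re.comp hw)
    fun t ht => (Complex.abs_re_le_norm _).trans (hwb t ht)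
  have h2 := integrable_smul_cPath hω hφ hcont hC hσ (Complex.measurable_im.comp hw)
    fun t ht => (Complex.abs_im_le_norm _).trans (hwb t ht)
  refine (h1.add (h2.const_mul Complex.I)).congr (Filter.Eventually.of_forall fun t => ?_)
  simp only [Pi.add_apply, Function.comp_apply, Complex.real_smul]
  nth_rw 3 [← Complex.re_add_im (pathWeight p q φ σ t)]
  ring

variable [CompleteSpace E]

theorem integrable_pathIntegrand (hω : 0 < ω) (hT : IsBisectorial T ω)
    (hTb : HasSectorialBounds T ω) (hφ : φ ∈ Set.Ioo ω (Real.pi / 2)) {p q : ℝ[X]} {M : ℝ}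
    (hM : ∀ z ∉ openOuterCone φ, ‖aeval z p / aeval z q‖ ≤ M * ‖z‖ / (1 + ‖z‖ ^ 2)) {σ : ℂ}
    (hσ : σ = 1 ∨ σ = -1) :
    Integrable (pathIntegrand T (ratFun p q) J fun t => planeEmb hJ (σ * cPath φ t)) := by
  obtain ⟨C, hC0, hC⟩ := norm_leftSResolvent_planeEmb_le hω hT hφ
  have hcont := hTb.continuousOn_leftSResolvent hT.closedClifford.closed (hφ.1.trans hφ.2) hJ
  have hw := measurable_pathWeight p q φ σ
  have hwb := fun t (ht : t ≠ 0) => norm_pathWeight_le (hω.trans hφ.1) hφ.2 hM hσ ht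
  have h1 := integrable_smul_cPath hω hφ hcont (hC hJ) hσ (Complex.measurable_re.comp hw)
    fun t ht => (Complex.abs_re_le_norm _).trans (hwb t ht)
  have h2 := integrable_smul_cPath hω hφ (C := C * ‖(leftMul J : _ →L[ℝ] CliffordModule n E)‖)
    (A := fun z => (leftSResolvent (planeEmb hJ z) T).comp (leftMul J))
    (hcont.clm_comp continuousOn_const)
    (fun z hz => (ContinuousLinearMap.opNorm_comp_le _ _).trans (by
      rw [mul_div_right_comm]
      exact mul_le_mul_of_nonneg_right (hC hJ z hz) (norm_nonneg _)))
    hσ (Complex.measurable_im.comp hw)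
    fun t ht => (Complex.abs_im_le_norm _).trans (hwb t ht)
  refine (h1.add h2).congr ?_
  filter_upwards [Measure.ae_ne volume (0 : ℝ)] with t ht
  rw [pathIntegrand_eq hJ T p q φ σ ht, comp_leftMulPlane]
  rfl

theorem apply_integral_pathIntegrand (hω : 0 < ω) (hT : IsBisectorial T ω)
    (hTb : HasSectorialBounds T ω) (hφ : φ ∈ Set.Ioo ω (Real.pi / 2)) {p q : ℝ[X]} {M : ℝ}
    (hM : ∀ z ∉ openOuterCone φ, ‖aeval z p / aeval z q‖ ≤ M * ‖z‖ / (1 + ‖z‖ ^ 2)) {σ : ℂ}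
    (hσ : σ = 1 ∨ σ = -1) (l : StrongDual ℝ (CliffordModule n E)) (v : CliffordModule n E) :
    l ((∫ t, pathIntegrand T (ratFun p q) J (fun t => planeEmb hJ (σ * cPath φ t)) t) v) =
      (∫ t, pathWeight p q φ σ t * resPairing T l v (σ * cPath φ t)).re +
        (∫ t, pathWeight p q φ σ t * resPairing T l (leftMul J v) (σ * cPath φ t)).im := by
  let L : (CliffordModule n E →L[ℝ] CliffordModule n E) →L[ℝ] ℝ :=
    l.comp (ContinuousLinearMap.apply ℝ _ v)
  have h1 := integrable_pathWeight_mul_resPairing hω hTb hφ hM hσ l v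
  have h2 := integrable_pathWeight_mul_resPairing hω hTb hφ hM hσ l (leftMul J v)
  have h3 := L.integral_comp_comm (integrable_pathIntegrand hJ hω hT hTb hφ hM hσ)
  have h4 := Complex.reCLM.integral_comp_comm h1
  have h5 := Complex.imCLM.integral_comp_comm h2
  simp only [Complex.reCLM_apply, Complex.imCLM_apply] at h4 h5
  have i1 : Integrable fun t =>
    (pathWeight p q φ σ t * resPairing T l v (σ * cPath φ t)).re := h1.re
  have i2 : Integrable fun t =>
    (pathWeight p q φ σ t * resPairing T l (leftMul J v) (σ * cPath φ t)).im := h2.im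
  rw [← h4, ← h5, ← integral_add i1 i2]
  refine h3.symm.trans (integral_congr_ae ?_)
  filter_upwards [Measure.ae_ne volume (0 : ℝ)] with t ht
  have hz := outerCone_subset_openOuterCone hω hφ.1 hφ.2
    (sign_mul_mem_outerCone hσ (cPath_mem_outerCone (hω.trans hφ.1) hφ.2 ht)).1
  rw [pathIntegrand_eq hJ T p q φ σ ht]
  exact apply_leftSResolvent_leftMulPlane hJ hT.closedClifford.closed (hTb.hasQuadInv _ hz) l v _

/-- The path integral of `p/q` maps `q[T] w` to `p[T] w`. -/
theorem integral_pathIntegrand_apply (hω : 0 < ω) (hθ : θ < Real.pi / 2) (hT : IsBisectorial T ω)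
    (hTb : HasSectorialBounds T ω) {p q : ℝ[X]} (hpq : p = 0 ∨ p.natDegree + 2 ≤ q.natDegree)
    (hqb : BijectivePoly T q) {M : ℝ} (hq : ∀ z ∉ openOuterCone θ, aeval z q ≠ 0)
    (hM : ∀ z ∉ openOuterCone θ, ‖aeval z (X * p) / aeval z q‖ ≤ M * ‖z‖ / (1 + ‖z‖ ^ 2))
    (hφ : φ ∈ Set.Ioo ω θ) {w : CliffordModule n E} (hw : w ∈ (opPow T q.natDegree).domain) :
    ((1 / (2 * Real.pi)) •
      ((∫ t, pathIntegrand T (ratFun (X * p) q) J (fun t => planeEmb hJ (1 * cPath φ t)) t) +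
        ∫ t, pathIntegrand T (ratFun (X * p) q) J (fun t => planeEmb hJ (-1 * cPath φ t)) t))
      (polyAct T w q) = polyAct T w (X * p) := by
  have hφ' : φ ∈ Set.Ioo ω (Real.pi / 2) := ⟨hφ.1, hφ.2.trans hθ⟩
  have hMφ : ∀ z ∉ openOuterCone φ,
      ‖aeval z (X * p) / aeval z q‖ ≤ M * ‖z‖ / (1 + ‖z‖ ^ 2) := fun z hz => hM z fun h =>
    hz (outerCone_subset_openOuterCone (hω.trans hφ.1) hφ.2 hθ (openOuterCone_subset _ h))
  have hi₁ := fun l v => integrable_pathWeight_mul_resPairing hω hTb hφ' hMφ (Or.inl rfl) l v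
  have hi₂ := fun l v => integrable_pathWeight_mul_resPairing hω hTb hφ' hMφ (Or.inr rfl) l v
  have key : ∀ (l : StrongDual ℝ (CliffordModule n E)) (u : CliffordModule n E),
      u ∈ (opPow T q.natDegree).domain →
      (∫ t, pathWeight (X * p) q φ 1 t * resPairing T l (polyAct T u q) (1 * cPath φ t)) +
        (∫ t, pathWeight (X * p) q φ (-1) t * resPairing T l (polyAct T u q) (-1 * cPath φ t)) =
      2 * Real.pi * l (polyAct T u (X * p)) := by
    intro l u hu
    rw [← hTb.boundaryInt_resPairing hω hθ hpq hq hφ l hu]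
    have e₁ : ∀ t, pathWeight (X * p) q φ 1 t *
        resPairing T l (polyAct T u q) (1 * cPath φ t) = cPathDeriv φ t / Complex.I *
          (resPairing T l (polyAct T u q) (cPath φ t) *
            (aeval (cPath φ t) (X * p) / aeval (cPath φ t) q)) := fun t => by
      rw [pathWeight, one_mul, one_mul]; ring
    have e₂ : ∀ t, pathWeight (X * p) q φ (-1) t *
        resPairing T l (polyAct T u q) (-1 * cPath φ t) = -cPathDeriv φ t / Complex.I *
          (resPairing T l (polyAct T u q) (-cPath φ t) *
            (aeval (-cPath φ t) (X * p) / aeval (-cPath φ t) q)) := fun t => by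
      rw [pathWeight, neg_one_mul, neg_one_mul]; ring
    have j₁ := hi₁ l (polyAct T u q)
    have j₂ := hi₂ l (polyAct T u q)
    simp only [e₁] at j₁ ⊢
    simp only [e₂] at j₂ ⊢
    exact integral_cPath_add (g := fun s => resPairing T l (polyAct T u q) s *
      (aeval s (X * p) / aeval s q)) j₁ j₂
  refine (SeparatingDual.eq_iff_forall_dual_eq (R := ℝ)).2 fun l => ?_
  -- Surjectivity of q[T] brings the term with J into the scope of `key`. Its integral is the real
  -- number 2π l((X p)[T] u), and only the imaginary part is used.
  obtain ⟨u, hu, hu'⟩ := hqb.1 (leftMul J (polyAct T w q))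
  have k₁ := congrArg Complex.re (key l w hw)
  have k₂ := congrArg Complex.im (key l u hu)
  rw [hu'] at k₂
  have hlin : ∀ (c : ℝ) (A B : CliffordModule n E →L[ℝ] CliffordModule n E) v,
      l ((c • (A + B)) v) = c * (l (A v) + l (B v)) := fun c A B v => by
    rw [← map_add, ← smul_eq_mul, ← map_smul]
    rfl
  rw [hlin, apply_integral_pathIntegrand hJ hω hT hTb hφ' hMφ (Or.inl rfl),
    apply_integral_pathIntegrand hJ hω hT hTb hφ' hMφ (Or.inr rfl)]
  have r₁ : ((2 * Real.pi * l (polyAct T w (X * p)) : ℂ)).re =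
      2 * Real.pi * l (polyAct T w (X * p)) := by
    simp
  have r₂ : ((2 * Real.pi * l (polyAct T u (X * p)) : ℂ)).im = 0 := by
    simp
  rw [r₁, Complex.add_re] at k₁
  rw [r₂, Complex.add_im] at k₂
  rw [div_mul_eq_mul_div, one_mul, div_eq_iff (by positivity)]
  linarith

end Calculus

end CliffordOmega

/-! ### The main theorem. -/

open CliffordOmega Polynomial

theorem mainTheorem3 {n : ℕ} (hn : 1 ≤ n)
    {E : Type*} [NormedAddCommGroup E] [NormedSpace ℝ E] [CompleteSpace E]
    (T : CliffordModule n E →ₗ.[ℝ] CliffordModule n E) (ω : ℝ)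
    (hω : ω ∈ Set.Ioo 0 (Real.pi / 2)) (hT : IsBisectorial T ω)
    (p q : Polynomial ℝ) (hdeg : p.degree + 1 ≤ q.degree) (hp : p.IsRoot 0)
    (hq : ∀ s ∈ closure (doubleSector n ω), Polynomial.aeval s q ≠ 0) :
    Function.Bijective (polyOp T q) ∧
    ∃ θ ∈ Set.Ioo ω (Real.pi / 2),
      MemNZero (n := n) θ (ratFun p q) ∧
      ∃ F : CliffordModule n E →L[ℝ] CliffordModule n E,
        HasOmegaCalculus T ω θ (ratFun p q) F ∧
        F.toLinearMap.toPMap ⊤ = opMul (polyOp T p) (polyOp T q).inverse := by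
  obtain ⟨h0, hω2⟩ := hω
  obtain ⟨J₀, hJ₀⟩ := nonempty_imagSphere hn
  have hqc : ∀ z ∉ openOuterCone ω, aeval z q ≠ 0 := by
    intro z hz hcon
    refine hq _ (planeEmb_mem_closure hJ₀ h0 hω2 hz) ?_
    rw [aeval_algHom_apply, hcon, map_zero]
  have hq0 : q ≠ 0 := by
    rintro rfl
    -- The vertex 0 lies in the closed double sector, so q cannot vanish identically.
    exact hqc 0 (by simp [openOuterCone]) (map_zero _)
  -- From here on p denotes the quotient by X, so the degree gap to q grows from one to two. The
  -- zero polynomial is kept apart because its `natDegree` carries no information.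
  obtain ⟨p, rfl⟩ := dvd_iff_isRoot.2 hp
  rw [C_0, sub_zero] at hdeg ⊢
  have hpq : p = 0 ∨ p.natDegree + 2 ≤ q.natDegree := by
    rcases eq_or_ne p 0 with h | h
    · exact Or.inl h
    · right
      rw [degree_eq_natDegree (mul_ne_zero X_ne_zero h), degree_eq_natDegree hq0,
        natDegree_X_mul h] at hdeg
      exact_mod_cast hdeg
  have hTb := hT.hasSectorialBounds hn h0 hω2
  have hqb := bijectivePoly_of_roots hTb.hasQuadInv h0 hω2 hq0 hqc
  obtain ⟨θ, hθ, hqθ⟩ := exists_angle hω2 hq0 hqc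
  obtain ⟨M, -, hM⟩ := exists_norm_rat_le hpq hq0 hqθ
  refine ⟨hqb.bijective, θ, hθ, memNZero_ratFun hn (h0.trans hθ.1) hθ.2 hpq hq0 hqθ, ?_⟩
  have hval : ∀ {J : Cl n} (hJ : J ∈ imagSphere n), ∀ φ ∈ Set.Ioo ω θ, ∀ w ∈
      (opPow T q.natDegree).domain, ((1 / (2 * Real.pi)) •
        ((∫ t, pathIntegrand T (ratFun (X * p) q) J (fun t => planeEmb hJ (1 * cPath φ t)) t) +
          ∫ t, pathIntegrand T (ratFun (X * p) q) J (fun t => planeEmb hJ (-1 * cPath φ t)) t))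
        (polyAct T w q) = polyAct T w (X * p) := fun hJ φ hφ w hw =>
    integral_pathIntegrand_apply hJ h0 hθ.2 hT hTb hpq hqb hqθ hM hφ hw
  -- Any admissible angle and unit may define F. All choices agree because each integral takes q[T]
  -- w to the same vector and q[T] is onto.
  obtain ⟨φ₀, hφ₀⟩ := exists_between hθ.1
  have hF := hval hJ₀ φ₀ hφ₀
  set F : CliffordModule n E →L[ℝ] CliffordModule n E := (1 / (2 * Real.pi)) •
    ((∫ t, pathIntegrand T (ratFun (X * p) q) J₀ (fun t => planeEmb hJ₀ (1 * cPath φ₀ t)) t) +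
      ∫ t, pathIntegrand T (ratFun (X * p) q) J₀ (fun t => planeEmb hJ₀ (-1 * cPath φ₀ t)) t)
  refine ⟨F, fun φ hφ J hJ => ?_, ?_⟩
  · have e₁ : boundaryPath J φ = fun t => planeEmb hJ (1 * cPath φ t) := by
      rw [boundaryPath_eq hJ]
      simp only [one_mul]
    have e₂ : -boundaryPath J φ = fun t => planeEmb hJ (-1 * cPath φ t) := by
      rw [boundaryPath_eq hJ]
      ext1 t
      rw [neg_one_mul, map_neg]
      rfl
    have hMφ : ∀ z ∉ openOuterCone φ,
        ‖aeval z (X * p) / aeval z q‖ ≤ M * ‖z‖ / (1 + ‖z‖ ^ 2) := fun z hz => hM z fun h =>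
      hz (outerCone_subset_openOuterCone (h0.trans hφ.1) hφ.2 hθ.2 (openOuterCone_subset _ h))
    have hφ' : φ ∈ Set.Ioo ω (Real.pi / 2) := ⟨hφ.1, hφ.2.trans hθ.2⟩
    rw [e₂, e₁]
    refine ⟨integrable_pathIntegrand hJ h0 hT hTb hφ' hMφ (Or.inl rfl),
      integrable_pathIntegrand hJ h0 hT hTb hφ' hMφ (Or.inr rfl), ?_⟩
    ext1 v
    obtain ⟨w, hw, rfl⟩ := hqb.1 v
    exact (hF w hw).trans (hval hJ φ hφ w hw).symm
  · have hker : LinearMap.ker (polyOp T q).toFun = ⊥ :=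
      LinearMap.ker_eq_bot.2 hqb.bijective.injective
    have hinv : ∀ w, ∀ hw : w ∈ (opPow T q.natDegree).domain,
        ∃ h : polyAct T w q ∈ (polyOp T q).inverse.domain,
          (polyOp T q).inverse ⟨polyAct T w q, h⟩ = w := by
      intro w hw
      have h : polyAct T w q ∈ (polyOp T q).inverse.domain := by
        rw [LinearPMap.inverse_domain]
        exact ⟨⟨w, hw⟩, polyOp_apply T q _⟩
      exact ⟨h, LinearPMap.inverse_apply_eq hker (x := ⟨w, hw⟩) (polyOp_apply T q _)⟩
    -- The range dom T^(deg q) of q[T]⁻¹ lies in the domain of the numerator, so the product is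
    -- everywhere defined.
    have hle : (X * p).natDegree ≤ q.natDegree := by
      rcases hpq with rfl | h
      · simp
      · exact natDegree_mul_le.trans (by rw [natDegree_X]; omega)
    have hdom : ∀ v, v ∈ (opMul (polyOp T (X * p)) (polyOp T q).inverse).domain := by
      intro v
      obtain ⟨w, hw, rfl⟩ := hqb.1 v
      obtain ⟨h, e⟩ := hinv w hw
      refine ⟨h, ?_⟩
      rw [e]
      exact mem_domain_opPow_of_le hle hw
    refine LinearPMap.ext (Submodule.ext fun v => ⟨fun _ => hdom v, fun _ => trivial⟩) ?_
    intro v h1 h2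
    obtain ⟨w, hw, rfl⟩ := hqb.1 v
    obtain ⟨h, e⟩ := hinv w hw
    have h3 : opMul (polyOp T (X * p)) (polyOp T q).inverse ⟨polyAct T w q, h2⟩ =
        polyAct T ((polyOp T q).inverse ⟨polyAct T w q, h⟩ : CliffordModule n E) (X * p) :=
      polyOp_apply T (X * p) ⟨(polyOp T q).inverse ⟨polyAct T w q, h⟩, h2.snd⟩
    rw [h3, e]
    exact hF w hw
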